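/- Let $(M,g)$ be a smooth Riemannian manifold of dimension $d\ge 2$ with constant sectional curvature $\kappa\in\mathbb R$ and injectivity radius at least $10$. (The injectivity radius of $M$ is the infimum over $p\in M$ of the supremum of all $r$ such that $\exp_p$ is defined on the ball of radius $r$ about $0$ in $T_pM$ and is a diffeomorphism from it onto its image.) Let $p\in M$ and let $B=\exp_p(\{v\in T_pM:|v|<1\})$ be the unit geodesic ball about $p$. Then there are $R>0$ and a smooth diffeomorphism $\Phi$ from $B$ onto the ball $\{y\in\mathbb R^d:|y|<R\}$ that maps all geodesics to straight lines: for every nonconstant geodesic $\gamma:I\to B$ on an open interval $I$ there are a line $\{a+\tau w:\tau\in\mathbb R\}$, $w\ne0$, and a strictly increasing $f:I\to\mathbb R$ such that $\Phi(\gamma(t))=a+f(t)w$ for all $t\in I$; and if $\gamma$ is a maximal geodesic of $B$ (one that does not extend to a geodesic in $B$ on a larger interval), then $\Phi(\gamma(I))$ is the whole intersection of this line with the ball. Moreover $\Phi$ may be chosen as follows. * If $\kappa>0$: $\Phi=P\circ\iota$ on $B$, where $\iota$ is a bijection from $B$ onto the geodesic ball of radius $\sqrt\kappa$ about $(0,\dots,0,-1)$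 in the unit sphere $\mathbb S^d\subset\mathbb R^{d+1}$, it is smooth with $\iota^*g_{\mathbb S^d}=\kappa g$ (so it is an isometry up to the scaling that normalizes the curvature to $1$), its image lies in $\{x_{d+1}<0\}$, and $P(x)=(-x_1/x_{d+1},\dots,-x_d/x_{d+1})$ is the gnomonic projection. * If $\kappa=0$: $\Phi$ is an isometry from $B$ onto its image with the Euclidean metric. * If $\kappa<0$: $\Phi=T\circ\iota$ on $B$, where $\iota$ is a bijection from $B$ onto the geodesic ball of radius $\sqrt{-\kappa}$ about $(0,\dots,0,1)$ in the hyperboloid $\mathbb H^d=\{x\in\mathbb R^{d+1}:x_1^2+\dots+x_d^2-x_{d+1}^2=-1,\ x_{d+1}>0\}$, it is smooth with $\iota^*g_{\mathbb H^d}=-\kappa g$, where $g_{\mathbb H^d}$ is the metric induced by the Lorentz form $dx_1^2+\dots+dx_d^2-dx_{d+1}^2$, and $T(x)=(x_1/x_{d+1},\dots,x_d/x_{d+1})$ is the Beltrami–Klein map. -/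

import Mathlib

open Set Bundle
open scoped Manifold ContDiff ENNReal NNReal

noncomputable section

namespace SpaceForm

/-- `f` restricts to a smooth diffeomorphism from the open set `U` onto the open set `V`. -/
structure IsDiffeoOn (E₁ E₂ : Type*) [NormedAddCommGroup E₁] [NormedSpace ℝ E₁]
    [NormedAddCommGroup E₂] [NormedSpace ℝ E₂] {X Y : Type*} [TopologicalSpace X]
    [TopologicalSpace Y] [ChartedSpace E₁ X] [ChartedSpace E₂ Y]
    (f : X → Y) (U : Set X) (V : Set Y) : Prop where
  isOpen_source : IsOpen U
  isOpen_target : IsOpen V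
  mapsTo : MapsTo f U V
  contMDiffOn : ContMDiffOn 𝓘(ℝ, E₁) 𝓘(ℝ, E₂) ∞ f U
  exists_inverse : ∃ g : Y → X, MapsTo g V U ∧ InvOn g f U V ∧
    ContMDiffOn 𝓘(ℝ, E₂) 𝓘(ℝ, E₁) ∞ g V

section Riemannian

variable {d : ℕ} {M : Type*} [TopologicalSpace M] [ChartedSpace (EuclideanSpace ℝ (Fin d)) M]

/-- The `i`-th standard basis vector of `ℝᵈ`. -/
def basisVec (i : Fin d) : EuclideanSpace ℝ (Fin d) := EuclideanSpace.single i 1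

section Metric

variable [RiemannianBundle (fun x : M => TangentSpace (𝓡 d) x)]

/-- The coefficients `g_ij = ⟨∂_i, ∂_j⟩` of the Riemannian metric in the local coordinates `e`,
as functions of the coordinates `y ∈ e.target`; here `∂_i = d(e⁻¹)_y (e_i)`. -/
def metricCoeff (e : OpenPartialHomeomorph M (EuclideanSpace ℝ (Fin d)))
    (y : EuclideanSpace ℝ (Fin d)) : Matrix (Fin d) (Fin d) ℝ :=
  Matrix.of fun i j =>
    inner ℝ (mfderiv (𝓡 d) (𝓡 d) e.symm y (basisVec i) : TangentSpace (𝓡 d) (e.symm y))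
      (mfderiv (𝓡 d) (𝓡 d) e.symm y (basisVec j) : TangentSpace (𝓡 d) (e.symm y))

/-- `∂_k g_ij` in the local coordinates `e`. -/
def metricDeriv (e : OpenPartialHomeomorph M (EuclideanSpace ℝ (Fin d)))
    (y : EuclideanSpace ℝ (Fin d)) (k i j : Fin d) : ℝ :=
  fderiv ℝ (fun z => metricCoeff e z i j) y (basisVec k)

/-- The Christoffel symbols
`Γ^k_ij = ½ ∑_l g^{kl} (∂_i g_jl + ∂_j g_il - ∂_l g_ij)` of the Levi-Civita connection. -/
def christoffel (e : OpenPartialHomeomorph M (EuclideanSpace ℝ (Fin d)))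
    (y : EuclideanSpace ℝ (Fin d)) (k i j : Fin d) : ℝ :=
  (1 / 2) * ∑ l, (metricCoeff e y)⁻¹ k l *
    (metricDeriv e y i j l + metricDeriv e y j i l - metricDeriv e y l i j)

/-- `∂_m Γ^k_ij`. -/
def christoffelDeriv (e : OpenPartialHomeomorph M (EuclideanSpace ℝ (Fin d)))
    (y : EuclideanSpace ℝ (Fin d)) (m k i j : Fin d) : ℝ :=
  fderiv ℝ (fun z => christoffel e z k i j) y (basisVec m)

/-- The curvature tensor `R(∂_i, ∂_j) ∂_k = ∑_l R^l_ijk ∂_l`, with the convention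
`R(X, Y) Z = ∇_X ∇_Y Z - ∇_Y ∇_X Z - ∇_[X,Y] Z`. -/
def curvatureCoeff (e : OpenPartialHomeomorph M (EuclideanSpace ℝ (Fin d)))
    (y : EuclideanSpace ℝ (Fin d)) (l i j k : Fin d) : ℝ :=
  christoffelDeriv e y i l j k - christoffelDeriv e y j l i k +
    ∑ m, (christoffel e y l i m * christoffel e y m j k -
      christoffel e y l j m * christoffel e y m i k)

/-- The Riemannian inner product of the tangent vectors with components `u` and `v`. -/
def metricInner (e : OpenPartialHomeomorph M (EuclideanSpace ℝ (Fin d)))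
    (y u v : EuclideanSpace ℝ (Fin d)) : ℝ :=
  ∑ i, ∑ j, metricCoeff e y i j * u i * v j

/-- The components of `R(u, v) w`. -/
def curvatureVec (e : OpenPartialHomeomorph M (EuclideanSpace ℝ (Fin d)))
    (y u v w : EuclideanSpace ℝ (Fin d)) : EuclideanSpace ℝ (Fin d) :=
  WithLp.toLp 2 fun l => ∑ i, ∑ j, ∑ k, curvatureCoeff e y l i j k * u i * v j * w k

/-- The sectional curvature `⟨R(u, v) v, u⟩ / (|u|² |v|² - ⟨u, v⟩²)` of the plane spanned by the
tangent vectors with components `u` and `v` at the point with coordinates `y`. -/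
def sectionalCurvature (e : OpenPartialHomeomorph M (EuclideanSpace ℝ (Fin d)))
    (y u v : EuclideanSpace ℝ (Fin d)) : ℝ :=
  metricInner e y (curvatureVec e y u v v) u /
    (metricInner e y u u * metricInner e y v v - metricInner e y u v ^ 2)

variable (d M) in
/-- All sectional curvatures of `M` (computed in arbitrary smooth local coordinates) equal `κ`. -/
def HasConstantSectionalCurvature (κ : ℝ) : Prop :=
  ∀ e ∈ IsManifold.maximalAtlas (𝓡 d) ∞ M, ∀ y ∈ e.target, ∀ u v : EuclideanSpace ℝ (Fin d),
    LinearIndependent ℝ ![u, v] → sectionalCurvature e y u v = κ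

variable (d) in
/-- `γ` is a (Riemannian, affinely parametrized) geodesic on the open interval `s`: it is smooth,
and in all smooth local coordinates it satisfies
`(γ^k)'' + ∑_ij Γ^k_ij (γ^i)' (γ^j)' = 0`. -/
structure IsGeodesicOn (γ : ℝ → M) (s : Set ℝ) : Prop where
  isOpen : IsOpen s
  ordConnected : s.OrdConnected
  contMDiffOn : ContMDiffOn 𝓘(ℝ, ℝ) (𝓡 d) ∞ γ s
  equation : ∀ e ∈ IsManifold.maximalAtlas (𝓡 d) ∞ M, ∀ t ∈ s, γ t ∈ e.source → ∀ k : Fin d,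
    deriv (deriv fun τ => e (γ τ) k) t +
      ∑ i, ∑ j, christoffel e (e (γ t)) k i j *
        deriv (fun τ => e (γ τ) i) t * deriv (fun τ => e (γ τ) j) t = 0

variable (d) in
/-- The velocity `γ'(t)`, as an element of the tangent bundle. -/
def velocity (γ : ℝ → M) (t : ℝ) : TangentBundle (𝓡 d) M :=
  ⟨γ t, mfderiv 𝓘(ℝ, ℝ) (𝓡 d) γ t (1 : ℝ)⟩

variable (d) in
/-- The set of `v ∈ T_p M` such that the geodesic with initial velocity `v` exists up to time `1`:
the domain of the exponential map at `p`. -/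
def expDomain (p : M) : Set (TangentSpace (𝓡 d) p) :=
  {v | ∃ (γ : ℝ → M) (s : Set ℝ), IsGeodesicOn d γ s ∧ Icc 0 1 ⊆ s ∧ velocity d γ 0 = ⟨p, v⟩}

variable (d) in
open Classical in
/-- The exponential map: `exp_p v = γ(1)` for the geodesic `γ` with initial velocity `v ∈ T_p M`
(and the junk value `p` outside the domain of `exp_p`). -/
def expMap (p : M) (v : TangentSpace (𝓡 d) p) : M :=
  if h : v ∈ expDomain d p then h.choose 1 else p

/-- The norm of a tangent vector given by the Riemannian metric. -/
def tangentNorm {p : M} (v : TangentSpace (𝓡 d) p) : ℝ := ‖v‖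

variable (d) in
/-- The open ball of radius `r` about the origin of `T_p M`, for the norm given by the Riemannian
metric. `T_p M` is regarded as `ℝᵈ` with its usual smooth structure. -/
def tangentBall (p : M) (r : ℝ) : Set (EuclideanSpace ℝ (Fin d)) :=
  {v | tangentNorm (p := p) v < r}

variable (d) in
/-- The geodesic ball of centre `p` and radius `r`, `exp_p {v ∈ T_p M : |v| < r}`. -/
def geodesicBall (p : M) (r : ℝ) : Set M :=
  (fun v : EuclideanSpace ℝ (Fin d) => expMap d p v) '' tangentBall d p r

variable (d) in
/-- The exponential map at `p` is defined on the ball of radius `r` in `T_p M`, and it is a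
diffeomorphism from this ball onto its image. -/
def IsInjectivityBound (p : M) (r : ℝ) : Prop :=
  (∀ v ∈ tangentBall d p r, (v : TangentSpace (𝓡 d) p) ∈ expDomain d p) ∧
    IsDiffeoOn (EuclideanSpace ℝ (Fin d)) (EuclideanSpace ℝ (Fin d))
      (fun v : EuclideanSpace ℝ (Fin d) => expMap d p v) (tangentBall d p r) (geodesicBall d p r)

variable (d) in
/-- The injectivity radius at a point. -/
def injectivityRadiusAt (p : M) : ℝ≥0∞ :=
  ⨆ (r : ℝ≥0) (_ : IsInjectivityBound d p (r : ℝ)), (r : ℝ≥0∞)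

variable (d M) in
/-- The injectivity radius of `M`. -/
def injectivityRadius : ℝ≥0∞ := ⨅ p : M, injectivityRadiusAt d p

variable (d) in
/-- `γ : s → B` is a geodesic of `B` that is not the restriction of a geodesic of `B` on a larger
interval. -/
def IsMaximalGeodesicIn (B : Set M) (γ : ℝ → M) (s : Set ℝ) : Prop :=
  IsGeodesicOn d γ s ∧ MapsTo γ s B ∧
    ∀ (γ' : ℝ → M) (s' : Set ℝ), IsGeodesicOn d γ' s' → MapsTo γ' s' B → s ⊆ s' →
      EqOn γ γ' s → s' = s

/-- The map `Φ` sends the nonconstant geodesics of `B` to straight lines in the ball of radius `R`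
about `0`. A geodesic `γ : s → B` is mapped, injectively and monotonically, to a
piece of a line, and it is mapped onto the whole intersection of the line with the ball
if it is a maximal geodesic of `B`. -/
def MapsGeodesicsToLines (B : Set M) (R : ℝ) (Φ : M → EuclideanSpace ℝ (Fin d)) : Prop :=
  ∀ (γ : ℝ → M) (s : Set ℝ), IsGeodesicOn d γ s → MapsTo γ s B → (γ '' s).Nontrivial →
    ∃ a w : EuclideanSpace ℝ (Fin d), w ≠ 0 ∧
      (∃ f : ℝ → ℝ, StrictMonoOn f s ∧ ∀ t ∈ s, Φ (γ t) = a + f t • w) ∧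
      (IsMaximalGeodesicIn d B γ s →
        Φ '' (γ '' s) = {y | ∃ τ : ℝ, y = a + τ • w} ∩ Metric.ball 0 R)

variable (d) in
/-- The pullback by `ι`, at the points of `B`, of the symmetric bilinear form `b` on the vector
space `V` is `c` times the Riemannian metric; `ι` is smooth on `B`. -/
def IsHomotheticOn {V : Type*} [NormedAddCommGroup V] [NormedSpace ℝ V]
    (b : V → V → ℝ) (c : ℝ) (B : Set M) (ι : M → V) : Prop :=
  ContMDiffOn (𝓡 d) 𝓘(ℝ, V) ∞ ι B ∧
    ∀ x ∈ B, ∀ u v : TangentSpace (𝓡 d) x,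
      b (mfderiv (𝓡 d) 𝓘(ℝ, V) ι x u : V) (mfderiv (𝓡 d) 𝓘(ℝ, V) ι x v : V) = c * inner ℝ u v

end Metric

end Riemannian

/-! ### The models in `ℝ^{d+1}` -/

section Models

variable {d : ℕ}

/-- The Lorentz form `x_1 y_1 + ⋯ + x_d y_d - x_{d+1} y_{d+1}`. -/
def lorentzForm (x y : EuclideanSpace ℝ (Fin (d + 1))) : ℝ :=
  ∑ i : Fin d, x i.castSucc * y i.castSucc - x (Fin.last d) * y (Fin.last d)

/-- The hyperboloid `x_1² + ⋯ + x_d² - x_{d+1}² = -1`, `x_{d+1} > 0`. -/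
def hyperboloid (d : ℕ) : Set (EuclideanSpace ℝ (Fin (d + 1))) :=
  {x | lorentzForm x x = -1 ∧ 0 < x (Fin.last d)}

/-- The geodesic ball of radius `ρ` of the unit sphere about the south pole `(0, …, 0, -1)`
(for `0 < ρ ≤ π`): the points at angle less than `ρ` from the pole. -/
def sphereBall (d : ℕ) (ρ : ℝ) : Set (EuclideanSpace ℝ (Fin (d + 1))) :=
  {x | ‖x‖ = 1 ∧ x (Fin.last d) < -Real.cos ρ}

/-- The geodesic ball of radius `ρ > 0` of the hyperboloid about `(0, …, 0, 1)`: the points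
at hyperbolic distance `arcosh x_{d+1} < ρ`. -/
def hyperbolicBall (d : ℕ) (ρ : ℝ) : Set (EuclideanSpace ℝ (Fin (d + 1))) :=
  {x | x ∈ hyperboloid d ∧ x (Fin.last d) < Real.cosh ρ}

/-- The gnomonic projection `(-x_1 / x_{d+1}, …, -x_d / x_{d+1})` of the lower open hemisphere, from
the centre of the sphere to the plane `x_{d+1} = -1`. -/
def gnomonic (x : EuclideanSpace ℝ (Fin (d + 1))) : EuclideanSpace ℝ (Fin d) :=
  WithLp.toLp 2 fun i => -(x i.castSucc / x (Fin.last d))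

/-- The Beltrami–Klein map `(x_1 / x_{d+1}, …, x_d / x_{d+1})` of the hyperboloid. -/
def beltramiKlein (x : EuclideanSpace ℝ (Fin (d + 1))) : EuclideanSpace ℝ (Fin d) :=
  WithLp.toLp 2 fun i => x i.castSucc / x (Fin.last d)

end Models

end SpaceForm

end

/-! Curvature determines the metric in normal coordinates at `p`. Radial directions keep their
Euclidean length (Gauss lemma, `metric_radial`). Along a unit-speed ray `t v`, the Jacobi field `t
w` with `w ⟂ v` has length `|sn t| |w|`, where `sn'' + κ sn = 0`, `sn 0 = 0`, `sn' 0 = 1`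
(`metric_orthogonal`). Since `exp_p` is a diffeomorphism on a ball of radius greater than `9`, `sn`
has no zero on `(0, 9]`. For `κ > 0` this forces `√κ < π / 9`, so `cn = sn'` is positive on `[0, 1]`
and the unit ball corresponds to a cap inside an open hemisphere.

The radial map that sends a point at distance `t` to distance `sn t / cn t` is therefore well
defined on the unit ball. It carries the metric to the Klein metric `⟨a, b⟩ / (1 + κ|y|²) - κ⟨y,
a⟩⟨y, b⟩ / (1 + κ|y|²)²` (`kleinMetric_eq_of_normal`, `exists_kleinChart`). In these coordinates
`Γ(a, a)` is a multiple of `a` (`IsKleinChart.christoffel`), so the acceleration of a geodesic is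
parallel to its velocity and geodesics run on straight lines. Conversely every chord of the ball is
traced by a geodesic, whose time parameter is found by separation of variables. By uniqueness a
geodesic is a piece of such a chord, and a maximal one fills it
(`IsKleinChart.mapsGeodesicsToLines`).

After scaling by `σ = √|κ|`, the Klein metric is, up to the factor `σ²`, the pullback of the form on
the sphere or the hyperboloid under the inverse of the gnomonic or Beltrami–Klein map
(`modelForm_fderiv_modelLift`). Composing the coordinates with this inverse gives `ι`. A sign `ε =
±1` treats the two models together. -/

noncomputable section

namespace SpaceForm

open Filter Topology

/-! ### Instances for spaces of bilinear maps -/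

section Shortcuts

variable {E F H : Type*} [NormedAddCommGroup E] [NormedSpace ℝ E] [NormedAddCommGroup F]
  [NormedSpace ℝ F] [NormedAddCommGroup H] [NormedSpace ℝ H]

instance instNormedAddCommGroupBilin : NormedAddCommGroup (E →L[ℝ] F →L[ℝ] H) :=
  ContinuousLinearMap.toNormedAddCommGroup

instance instAddCommGroupBilin : AddCommGroup (E →L[ℝ] F →L[ℝ] H) :=
  ContinuousLinearMap.addCommGroup

instance instNormedSpaceBilin : NormedSpace ℝ (E →L[ℝ] F →L[ℝ] H) :=
  ContinuousLinearMap.toNormedSpace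

instance instModuleBilin : Module ℝ (E →L[ℝ] F →L[ℝ] H) :=
  ContinuousLinearMap.module

end Shortcuts

/-! ### Levi-Civita connection on an open subset of a vector space -/

section LocalRiemannian

variable {E : Type*} [NormedAddCommGroup E] [NormedSpace ℝ E]

/-- On the open subset `U` of a vector space, `G` is a Riemannian metric and `Γ` is its
Christoffel tensor. -/
structure IsLeviCivitaOn (G : E → E →L[ℝ] E →L[ℝ] ℝ) (Γ : E → E →L[ℝ] E →L[ℝ] E)
    (U : Set E) : Prop where
  isOpen : IsOpen U
  contDiffOn_metric : ContDiffOn ℝ ∞ G U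
  contDiffOn_christoffel : ContDiffOn ℝ ∞ Γ U
  symm : ∀ x ∈ U, ∀ a b, G x a b = G x b a
  pos : ∀ x ∈ U, ∀ a, a ≠ 0 → 0 < G x a a
  koszul : ∀ x ∈ U, ∀ a b c, 2 * G x (Γ x a b) c =
    fderiv ℝ G x a b c + fderiv ℝ G x b a c - fderiv ℝ G x c a b

/-- The curvature tensor of the connection with Christoffel tensor `Γ`. -/
def curvature (Γ : E → E →L[ℝ] E →L[ℝ] E) (x u v w : E) : E :=
  fderiv ℝ Γ x u v w - fderiv ℝ Γ x v u w + Γ x u (Γ x v w) - Γ x v (Γ x u w)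

namespace IsLeviCivitaOn

variable {G : E → E →L[ℝ] E →L[ℝ] ℝ} {Γ : E → E →L[ℝ] E →L[ℝ] E} {U : Set E}

lemma hasFDerivAt_metric (L : IsLeviCivitaOn G Γ U) {x : E} (hx : x ∈ U) :
    HasFDerivAt G (fderiv ℝ G x) x :=
  ((L.contDiffOn_metric.contDiffAt (L.isOpen.mem_nhds hx)).differentiableAt
    (by simp)).hasFDerivAt

lemma hasFDerivAt_christoffel (L : IsLeviCivitaOn G Γ U) {x : E} (hx : x ∈ U) :
    HasFDerivAt Γ (fderiv ℝ Γ x) x :=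
  ((L.contDiffOn_christoffel.contDiffAt (L.isOpen.mem_nhds hx)).differentiableAt
    (by simp)).hasFDerivAt

/-- Nondegeneracy, tested with `c = a - b`. Vector identities such as the Christoffel formulas are
later proved by pairing with an arbitrary `c`. -/
lemma eq_of_metric_eq (L : IsLeviCivitaOn G Γ U) {x : E} (hx : x ∈ U) {a b : E}
    (h : ∀ c, G x a c = G x b c) : a = b := by
  by_contra hab
  have h1 := L.pos x hx (a - b) (sub_ne_zero.2 hab)
  have h2 := h (a - b)
  simp only [map_sub, sub_apply] at h1 h2
  linarith

lemma fderiv_metric_symm (L : IsLeviCivitaOn G Γ U) {x : E} (hx : x ∈ U) (a b c : E) :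
    fderiv ℝ G x a b c = fderiv ℝ G x a c b := by
  have h : ∀ b c : E, HasFDerivAt (fun y => G y b c)
      (((ContinuousLinearMap.apply ℝ ℝ c).comp
        ((ContinuousLinearMap.apply ℝ (E →L[ℝ] ℝ) b))).comp (fderiv ℝ G x)) x := fun b c =>
    ((ContinuousLinearMap.apply ℝ ℝ c).comp
        ((ContinuousLinearMap.apply ℝ (E →L[ℝ] ℝ) b))).hasFDerivAt.comp x (L.hasFDerivAt_metric hx)
  have h1 := (h c b).congr_of_eventuallyEq (f₁ := fun y => G y b c) (by
    filter_upwards [L.isOpen.mem_nhds hx] with y hy using L.symm y hy b c)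
  have := DFunLike.congr_fun ((h b c).unique h1) a
  simpa using this

lemma christoffel_symm (L : IsLeviCivitaOn G Γ U) {x : E} (hx : x ∈ U) (a b : E) :
    Γ x a b = Γ x b a := by
  refine L.eq_of_metric_eq hx fun c => ?_
  have h1 := L.koszul x hx a b c
  have h2 := L.koszul x hx b a c
  rw [L.fderiv_metric_symm hx c b a] at h2
  linarith

/-- The connection is compatible with the metric. -/
lemma fderiv_metric (L : IsLeviCivitaOn G Γ U) {x : E} (hx : x ∈ U) (c a b : E) :
    fderiv ℝ G x c a b = G x (Γ x c a) b + G x a (Γ x c b) := by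
  have h1 := L.koszul x hx c a b
  have h2 := L.koszul x hx c b a
  rw [L.symm x hx a]
  have := L.fderiv_metric_symm hx
  linarith [this a c b, this b c a, this c b a]

/-- Derivative of the inner product of two vector fields along a curve. -/
lemma hasDerivAt_inner (L : IsLeviCivitaOn G Γ U) {x X Y : ℝ → E} {t : ℝ} {x' X' Y' : E}
    (hx : HasDerivAt x x' t) (hX : HasDerivAt X X' t) (hY : HasDerivAt Y Y' t) (hU : x t ∈ U) :
    HasDerivAt (fun s => G (x s) (X s) (Y s))
      (G (x t) (X' + Γ (x t) x' (X t)) (Y t) + G (x t) (X t) (Y' + Γ (x t) x' (Y t))) t := by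
  have h := (((L.hasFDerivAt_metric hU).comp_hasDerivAt t hx).clm_apply hX).clm_apply hY
  refine h.congr_deriv ?_
  simp only [Function.comp_apply, add_apply, map_add,
    L.fderiv_metric hU]
  ring

end IsLeviCivitaOn

end LocalRiemannian

/-! ### The Gauss lemma -/

section NormalCoordinates

variable {E : Type*} [NormedAddCommGroup E] [InnerProductSpace ℝ E]

namespace IsLeviCivitaOn

variable {G : E → E →L[ℝ] E →L[ℝ] ℝ} {Γ : E → E →L[ℝ] E →L[ℝ] E} {r : ℝ}

/-- By `hrad` the constant field `x` is parallel along the ray `s ↦ s x`, so its length keeps its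
value at the origin. -/
lemma metric_self_radial (L : IsLeviCivitaOn G Γ (Metric.ball 0 r)) (hG0 : ∀ a b, G 0 a b = inner ℝ a b)
    (hrad : ∀ (v : E) (t : ℝ), t • v ∈ Metric.ball (0 : E) r → Γ (t • v) v v = 0)
    {x : E} (hx : x ∈ Metric.ball (0 : E) r) : G x x x = inner ℝ x x := by
  have hmem : ∀ t ∈ Icc (0 : ℝ) 1, t • x ∈ Metric.ball (0 : E) r := by
    intro t ht
    rw [mem_ball_zero_iff] at hx ⊢
    rw [norm_smul, Real.norm_of_nonneg ht.1]
    exact (mul_le_of_le_one_left (norm_nonneg _) ht.2).trans_lt hx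
  have hd : ∀ t ∈ Icc (0 : ℝ) 1, HasDerivAt (fun s : ℝ => G (s • x) x x) 0 t := by
    intro t ht
    have := L.hasDerivAt_inner (x := fun s : ℝ => s • x) ((hasDerivAt_id t).smul_const x)
      (hasDerivAt_const t x) (hasDerivAt_const t x) (hmem t ht)
    refine this.congr_deriv ?_
    simp [hrad x t (hmem t ht)]
  have := constant_of_derivWithin_zero (f := fun s : ℝ => G (s • x) x x) (a := 0) (b := 1)
    (fun t ht => (hd t ht).differentiableAt.differentiableWithinAt)
    (fun t ht => (hd t (Ico_subset_Icc_self ht)).hasDerivWithinAt.derivWithin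
      (uniqueDiffOn_Icc zero_lt_one t (Ico_subset_Icc_self ht))) 1 (by simp)
  simpa [hG0] using this

/-- The Gauss lemma. -/
lemma metric_radial (L : IsLeviCivitaOn G Γ (Metric.ball 0 r)) (hG0 : ∀ a b, G 0 a b = inner ℝ a b)
    (hrad : ∀ (v : E) (t : ℝ), t • v ∈ Metric.ball (0 : E) r → Γ (t • v) v v = 0)
    {x : E} (hx : x ∈ Metric.ball (0 : E) r) (w : E) : G x x w = inner ℝ x w := by
  have hmem : ∀ t ∈ Icc (0 : ℝ) 1, t • x ∈ Metric.ball (0 : E) r := by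
    intro t ht
    rw [mem_ball_zero_iff] at hx ⊢
    rw [norm_smul, Real.norm_of_nonneg ht.1]
    exact (mul_le_of_le_one_left (norm_nonneg _) ht.2).trans_lt hx
  -- Derivative in the direction `w` of the identity `G y y y = ⟨y, y⟩` of `metric_self_radial`.
  have hdw : ∀ y ∈ Metric.ball (0 : E) r, fderiv ℝ G y w y y + 2 * G y w y = 2 * inner ℝ y w := by
    intro y hy
    have hl : HasDerivAt (fun s : ℝ => y + s • w) w 0 := by
      simpa using ((hasDerivAt_id (0 : ℝ)).smul_const w).const_add y
    have h1 := L.hasDerivAt_inner (x := fun s : ℝ => y + s • w) hl hl hl (by simpa using hy)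
    have h2 : HasDerivAt (fun s : ℝ => inner ℝ (y + s • w) (y + s • w)) (2 * inner ℝ y w) 0 := by
      have := hl.inner ℝ hl
      simpa [real_inner_comm, two_mul] using this
    have h3 : (fun s : ℝ => G (y + s • w) (y + s • w) (y + s • w)) =ᶠ[𝓝 0]
        fun s : ℝ => inner ℝ (y + s • w) (y + s • w) := by
      have : ∀ᶠ s : ℝ in 𝓝 0, y + s • w ∈ Metric.ball (0 : E) r :=
        hl.continuousAt.eventually_mem (by simpa using Metric.isOpen_ball.mem_nhds hy)
      filter_upwards [this] with s hs using L.metric_self_radial hG0 hrad hs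
    have h4 := h1.unique (h2.congr_of_eventuallyEq h3)
    rw [L.fderiv_metric hy]
    simp only [zero_smul, add_zero, map_add, add_apply] at h4
    rw [L.symm y hy y w] at h4
    linarith
  -- The factor `s` makes the derivative equal to `G x w + s G x (Γ x w) - ⟨x, w⟩` at `s x`, which
  -- is `hdw` at `y = s x` divided by `s`; the case `s = 0` is `hG0`.
  have hd : ∀ t ∈ Icc (0 : ℝ) 1, HasDerivAt (fun s : ℝ => s * G (s • x) x w - s * inner ℝ x w) 0 t := by
    intro t ht
    have hU := hmem t ht
    have h1 := L.hasDerivAt_inner (x := fun s : ℝ => s • x) ((hasDerivAt_id t).smul_const x)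
      (hasDerivAt_const t x) (hasDerivAt_const t w) hU
    have h2 := ((hasDerivAt_id t).mul h1).sub ((hasDerivAt_id t).mul_const (inner ℝ x w))
    refine h2.congr_deriv ?_
    rcases eq_or_lt_of_le ht.1 with h0 | h0
    · subst h0
      simp [hG0]
    · have h3 := hdw _ hU
      rw [L.fderiv_metric hU] at h3
      simp only [map_smul, smul_apply, smul_eq_mul, inner_smul_left] at h3
      rw [L.symm _ hU x (Γ _ w x), L.christoffel_symm hU w x, L.symm _ hU w x] at h3
      rw [L.symm _ hU _ x] at h3
      simp only [one_smul, zero_add, hrad x t hU, map_zero, zero_apply, id]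
      have ht0 : t ≠ 0 := h0.ne'
      apply mul_left_cancel₀ ht0
      simp only [conj_trivial] at h3
      linarith
  have := constant_of_derivWithin_zero (f := fun s : ℝ => s * G (s • x) x w - s * inner ℝ x w)
    (a := 0) (b := 1)
    (fun t ht => (hd t ht).differentiableAt.differentiableWithinAt)
    (fun t ht => (hd t (Ico_subset_Icc_self ht)).hasDerivWithinAt.derivWithin
      (uniqueDiffOn_Icc zero_lt_one t (Ico_subset_Icc_self ht))) 1 (by simp)
  simp only [one_smul, one_mul, zero_mul, sub_self] at this
  linarith

end IsLeviCivitaOn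
end NormalCoordinates

/-! ### Jacobi fields along rays in constant curvature -/

section NormalCoordinates

variable {E : Type*} [NormedAddCommGroup E] [InnerProductSpace ℝ E]

namespace IsLeviCivitaOn

variable {G : E → E →L[ℝ] E →L[ℝ] ℝ} {Γ : E → E →L[ℝ] E →L[ℝ] E} {r : ℝ}

lemma fderiv_christoffel_symm {U : Set E} (L : IsLeviCivitaOn G Γ U) {x : E} (hx : x ∈ U)
    (a b c : E) : fderiv ℝ Γ x a b c = fderiv ℝ Γ x a c b := by
  have h : ∀ b c : E, HasFDerivAt (fun y => Γ y b c)
      (((ContinuousLinearMap.apply ℝ E c).comp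
        ((ContinuousLinearMap.apply ℝ (E →L[ℝ] E) b))).comp (fderiv ℝ Γ x)) x := fun b c =>
    ((ContinuousLinearMap.apply ℝ E c).comp
        ((ContinuousLinearMap.apply ℝ (E →L[ℝ] E) b))).hasFDerivAt.comp x
          (L.hasFDerivAt_christoffel hx)
  have h1 := (h c b).congr_of_eventuallyEq (f₁ := fun y => Γ y b c) (by
    filter_upwards [L.isOpen.mem_nhds hx] with y hy using L.christoffel_symm hy b c)
  have := DFunLike.congr_fun ((h b c).unique h1) a
  simpa using this

/-- The Gauss lemma differentiated in the base point. -/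
lemma fderiv_metric_radial (L : IsLeviCivitaOn G Γ (Metric.ball 0 r))
    (hG0 : ∀ a b, G 0 a b = inner ℝ a b)
    (hrad : ∀ (v : E) (t : ℝ), t • v ∈ Metric.ball (0 : E) r → Γ (t • v) v v = 0)
    {x : E} (hx : x ∈ Metric.ball (0 : E) r) (u w : E) :
    fderiv ℝ G x u x w + G x u w = inner ℝ u w := by
  have h1 : HasFDerivAt (fun y => G y y w) (((fderiv ℝ G x).flip x + G x).flip w) x := by
    refine (((L.hasFDerivAt_metric hx).clm_apply (hasFDerivAt_id x)).clm_apply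
      (hasFDerivAt_const w x)).congr_fderiv ?_
    ext a
    simp [add_comm]
  have h2 : HasFDerivAt (fun y => inner ℝ y w) ((innerSL ℝ).flip w) x :=
    ((innerSL ℝ).flip w).hasFDerivAt
  have h3 := h1.unique (h2.congr_of_eventuallyEq (f₁ := fun y => G y y w) (by
    filter_upwards [Metric.isOpen_ball.mem_nhds hx] with y hy
    simpa using L.metric_radial hG0 hrad hy w))
  exact DFunLike.congr_fun h3 u

-- The identity `Γ y y y = 0`, which is `hrad` at time `1`, differentiated in `y`.
set_option synthInstance.maxHeartbeats 200000 in
lemma fderiv_christoffel_radial (L : IsLeviCivitaOn G Γ (Metric.ball 0 r))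
    (hrad : ∀ (v : E) (t : ℝ), t • v ∈ Metric.ball (0 : E) r → Γ (t • v) v v = 0)
    {x : E} (hx : x ∈ Metric.ball (0 : E) r) (w : E) :
    fderiv ℝ Γ x w x x + (2 : ℝ) • Γ x x w = 0 := by
  have h1 : HasFDerivAt (fun y => Γ y y y) (((fderiv ℝ Γ x).flip x + Γ x).flip x + Γ x x) x := by
    refine (((L.hasFDerivAt_christoffel hx).clm_apply (hasFDerivAt_id x)).clm_apply
      (hasFDerivAt_id x)).congr_fderiv ?_
    ext a
    simp [add_comm]
  have h3 := h1.unique ((hasFDerivAt_const (0 : E) x).congr_of_eventuallyEq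
    (f₁ := fun y => Γ y y y) (by
    filter_upwards [Metric.isOpen_ball.mem_nhds hx] with y hy
    simpa using hrad y 1 (by simpa using hy)))
  have h4 := DFunLike.congr_fun h3 w
  simp only [add_apply, ContinuousLinearMap.flip_apply, zero_apply] at h4
  rw [L.christoffel_symm hx w x] at h4
  rw [← h4, two_smul]
  abel

/-- The metric in normal coordinates, for constant sectional curvature `κ`, in directions
orthogonal to the radial one. -/
theorem metric_orthogonal (L : IsLeviCivitaOn G Γ (Metric.ball 0 r))
    (hG0 : ∀ a b, G 0 a b = inner ℝ a b)
    (hrad : ∀ (v : E) (t : ℝ), t • v ∈ Metric.ball (0 : E) r → Γ (t • v) v v = 0)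
    {κ : ℝ} (hcurv : ∀ x ∈ Metric.ball (0 : E) r, ∀ u v,
      G x (curvature Γ x u v v) u = κ * (G x u u * G x v v - G x u v ^ 2))
    {sn cn : ℝ → ℝ} (hsn : ∀ t, HasDerivAt sn (cn t) t) (hcn : ∀ t, HasDerivAt cn (-κ * sn t) t)
    (hsn0 : sn 0 = 0) (hcn0 : cn 0 = 1) (hpyth : ∀ t, cn t ^ 2 + κ * sn t ^ 2 = 1)
    {v w : E} (hv : ‖v‖ = 1) (hvw : inner ℝ v w = 0) {t : ℝ} (ht0 : 0 ≤ t) (htr : t < r) :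
    t ^ 2 * G (t • v) w w = sn t ^ 2 * inner ℝ w w := by
  have hvv : inner ℝ v v = 1 := by simp [hv]
  have hmem : ∀ s ∈ Icc 0 t, s • v ∈ Metric.ball (0 : E) r := fun s hs => by
    rw [mem_ball_zero_iff, norm_smul, hv, Real.norm_of_nonneg hs.1, mul_one]
    exact hs.2.trans_lt htr
  have hline : ∀ s : ℝ, HasDerivAt (fun s : ℝ => s • v) v s := fun s => by
    simpa using (hasDerivAt_id s).smul_const v
  have hev : ∀ s ∈ Icc 0 t, ∀ᶠ τ in 𝓝 s, τ • v ∈ Metric.ball (0 : E) r := fun s hs =>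
    (hline s).continuousAt.eventually_mem (Metric.isOpen_ball.mem_nhds (hmem s hs))
  -- `P w` is the covariant derivative along the ray `s v` of the Jacobi field `J = s w`, and `P' w`
  -- is the ordinary derivative of `P w`.
  set P : E → ℝ → E := fun w s => w + s • Γ (s • v) v w with hP
  set P' : E → ℝ → E := fun w s => Γ (s • v) v w + s • fderiv ℝ Γ (s • v) v v w with hP'
  have hPd : ∀ w, ∀ s ∈ Icc 0 t, HasDerivAt (P w) (P' w s) s := fun w s hs => by
    have h1 : HasDerivAt (fun s : ℝ => Γ (s • v) v w) (fderiv ℝ Γ (s • v) v v w) s := by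
      simpa using (((L.hasFDerivAt_christoffel (hmem s hs)).comp_hasDerivAt s (hline s)).clm_apply
        (hasDerivAt_const s v)).clm_apply (hasDerivAt_const s w)
    refine (((hasDerivAt_id s).smul h1).const_add w).congr_deriv ?_
    simp [hP', add_comm]
  -- The Wronskian of the Jacobi fields `s a` and `s b` vanishes. By Koszul it is an antisymmetrized
  -- derivative of `G`, and the differentiated Gauss lemma shows that this derivative is symmetric
  -- in `a` and `b`.
  have hsymm : ∀ a b, ∀ s : ℝ, s • v ∈ Metric.ball (0 : E) r →
      G (s • v) (s • a) (P b s) = G (s • v) (P a s) (s • b) := by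
    intro a b s hs
    have k1 := L.koszul _ hs v a b
    have k2 := L.koszul _ hs v b a
    have g1 := L.fderiv_metric_radial hG0 hrad hs a b
    have g2 := L.fderiv_metric_radial hG0 hrad hs b a
    rw [L.fderiv_metric_symm hs v b a] at k2
    rw [L.symm _ hs b a, real_inner_comm] at g2
    simp only [hP, map_add, map_smul, add_apply, smul_apply, smul_eq_mul] at g1 g2 ⊢
    rw [L.symm _ hs a (Γ _ _ _)]
    linear_combination (s / 2) * (s * k2 - s * k1) + (s / 2) * 2 * (g2 - g1)
  -- The Jacobi equation `∇∇J = -R(J, v)v` for `J = s a`. At `s = 0` it amounts to `Γ 0 v a = 0`, by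
  -- polarization of `Γ 0 a a = 0`.
  have hcur : ∀ s ∈ Icc 0 t, ∀ a, P' a s + Γ (s • v) v (P a s) =
      -s • curvature Γ (s • v) a v v := by
    intro s hs a
    rcases eq_or_lt_of_le hs.1 with h0 | h0
    · have hz : ∀ a, Γ 0 a a = 0 := fun a => by
        simpa using hrad a 0 (by simpa using hmem 0 ⟨le_rfl, ht0⟩)
      have h1 := hz (v + a)
      have hU : (0 : E) ∈ Metric.ball (0 : E) r := by simpa using hmem 0 ⟨le_rfl, ht0⟩
      simp only [map_add, add_apply, hz, zero_add, add_zero, L.christoffel_symm hU a v] at h1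
      rw [← h0]
      simp only [hP, hP', zero_smul, add_zero, neg_zero]
      exact h1
    · have f1 := L.fderiv_christoffel_symm (hmem s hs) v a v
      have f2 := hrad v s (hmem s hs)
      have f3 := L.fderiv_christoffel_radial hrad (hmem s hs) a
      have f4 := L.christoffel_symm (hmem s hs) a v
      simp only [map_smul, smul_apply] at f3
      have f5 : s • fderiv ℝ Γ (s • v) a v v = -(2 : ℝ) • Γ (s • v) v a := by
        have : s • (s • fderiv ℝ Γ (s • v) a v v + (2 : ℝ) • Γ (s • v) v a) = 0 := by
          rw [← f3]; module
        rcases smul_eq_zero.1 this with h | h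
        · exact absurd h h0.ne'
        · rw [eq_neg_of_add_eq_zero_left h]; module
      have f6 : -s • curvature Γ (s • v) a v v = -(s • fderiv ℝ Γ (s • v) a v v) +
          s • fderiv ℝ Γ (s • v) v v a + s • Γ (s • v) v (Γ (s • v) v a) := by
        rw [curvature, f1, f2, f4, map_zero]
        module
      rw [f6, f5]
      simp only [hP, hP', map_add, map_smul]
      module
  have hQ : ∀ s ∈ Icc 0 t, P' w s + Γ (s • v) v (P w s) = -(κ * s) • w := by
    intro s hs
    rcases eq_or_lt_of_le hs.1 with h0 | h0
    · rw [hcur s hs, ← h0]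
      simp
    rw [hcur s hs]
    have hU := hmem s hs
    -- Self-adjointness of `R(·, v)v` comes from differentiating the Wronskian identity `hsymm` and
    -- inserting the Jacobi equation.
    have hR : ∀ a b, G (s • v) a (curvature Γ (s • v) b v v) =
        G (s • v) (curvature Γ (s • v) a v v) b := by
      intro a b
      have hJ : ∀ a : E, HasDerivAt (fun s : ℝ => s • a) a s := fun a => by
        simpa using (hasDerivAt_id s).smul_const a
      have h1 := (L.hasDerivAt_inner (hline s) (hJ a) (hPd b s hs) hU).unique
        ((L.hasDerivAt_inner (hline s) (hPd a s hs) (hJ b) hU).congr_of_eventuallyEq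
          ((hev s hs).mono fun τ hτ => hsymm a b τ hτ))
      have hJP : ∀ a, a + Γ (s • v) v (s • a) = P a s := fun a => by simp [hP]
      rw [hcur s hs, hcur s hs, hJP, hJP] at h1
      simp only [map_smul, smul_apply, smul_eq_mul] at h1
      have : s ^ 2 ≠ 0 := by positivity
      apply mul_left_cancel₀ this
      linarith
    have hvr : ∀ a, G (s • v) v a = inner ℝ v a := fun a => by
      have := L.metric_radial hG0 hrad hU a
      simp only [map_smul, smul_apply, smul_eq_mul, inner_smul_left, conj_trivial] at this
      exact mul_left_cancel₀ h0.ne' this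
    have hadd : ∀ a b, curvature Γ (s • v) (a + b) v v =
        curvature Γ (s • v) a v v + curvature Γ (s • v) b v v := fun a b => by
      simp only [curvature, map_add, add_apply]
      abel
    -- Polarization of the sectional curvature identity in its first vector; it needs `hR` to merge
    -- the two mixed terms, and `w ⟂ v` by the Gauss lemma.
    have hcw : curvature Γ (s • v) w v v = κ • w := by
      refine L.eq_of_metric_eq hU fun c => ?_
      have c1 := hcurv _ hU (w + c) v
      have c2 := hcurv _ hU w v
      have c3 := hcurv _ hU c v
      rw [hadd] at c1
      simp only [map_add, add_apply] at c1
      rw [L.symm _ hU (curvature Γ (s • v) c v v) w, hR w c, L.symm _ hU c w] at c1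
      rw [L.symm _ hU w v, hvr, hvr, hvw, hvv] at c1 c2
      rw [L.symm _ hU c v, hvr] at c1
      rw [L.symm _ hU c v, hvr, hvr, hvv] at c3
      simp only [map_smul, smul_apply, smul_eq_mul]
      linarith
    rw [hcw]
    module
  -- By `hQ`, `∇∇J = -κJ`, so the combinations `cn J - sn ∇J` and `κ sn J + cn ∇J` are parallel and
  -- have constant length. The first vanishes at `0` and the second equals `w` there. No parallel
  -- frame is needed.
  have hX : ∀ s ∈ Icc 0 t, HasDerivAt (fun s : ℝ => G (s • v) (cn s • s • w - sn s • P w s)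
      (cn s • s • w - sn s • P w s)) 0 s := by
    intro s hs
    have hd : HasDerivAt (fun s : ℝ => cn s • s • w - sn s • P w s)
      (-(Γ (s • v) v (cn s • s • w - sn s • P w s))) s := by
      refine (((hcn s).smul ((hasDerivAt_id s).smul_const w)).sub
        ((hsn s).smul (hPd w s hs))).congr_deriv ?_
      rw [eq_sub_of_add_eq (hQ s hs)]
      simp only [hP, map_sub, map_smul, map_add, id]
      module
    simpa using L.hasDerivAt_inner (hline s) hd hd (hmem s hs)
  have hY : ∀ s ∈ Icc 0 t, HasDerivAt (fun s : ℝ => G (s • v) ((κ * sn s) • s • w + cn s • P w s)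
      ((κ * sn s) • s • w + cn s • P w s)) 0 s := by
    intro s hs
    have hd : HasDerivAt (fun s : ℝ => (κ * sn s) • s • w + cn s • P w s)
      (-(Γ (s • v) v ((κ * sn s) • s • w + cn s • P w s))) s := by
      refine ((((hsn s).const_mul κ).smul ((hasDerivAt_id s).smul_const w)).add
        ((hcn s).smul (hPd w s hs))).congr_deriv ?_
      rw [eq_sub_of_add_eq (hQ s hs)]
      simp only [hP, map_smul, map_add, id]
      module
    simpa using L.hasDerivAt_inner (hline s) hd hd (hmem s hs)
  have key : ∀ f : ℝ → ℝ, (∀ s ∈ Icc 0 t, HasDerivAt f 0 s) → f t = f 0 := by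
    intro f hf
    rcases eq_or_lt_of_le ht0 with h | h
    · rw [h]
    exact constant_of_derivWithin_zero (f := f) (a := 0) (b := t)
      (fun t ht => (hf t ht).differentiableAt.differentiableWithinAt)
      (fun s ht => (hf s (Ico_subset_Icc_self ht)).hasDerivWithinAt.derivWithin
        (uniqueDiffOn_Icc h s (Ico_subset_Icc_self ht))) t (by simp [ht0])
  have hXt := key _ hX
  have hYt := key _ hY
  have htt : t ∈ Icc 0 t := by simp [ht0]
  have hX0 : cn t • t • w - sn t • P w t = 0 := by
    by_contra hne
    have := L.pos _ (hmem t htt) _ hne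
    rw [hXt] at this
    simp [hsn0] at this
  simp only [hsn0, hcn0, hP, zero_smul, add_zero, one_smul, smul_zero, zero_add, hG0] at hYt
  -- With `cn J = sn ∇J` and `cn² + κ sn² = 1`, the Jacobi field is `sn` times the second parallel
  -- field.
  have htw : t • w = sn t • ((κ * sn t) • t • w + cn t • P w t) := by
    have h1 : t • w = cn t • cn t • t • w + (κ * sn t ^ 2) • t • w := by
      conv_lhs => rw [← one_smul ℝ (t • w), ← hpyth t]
      module
    refine h1.trans ?_
    rw [sub_eq_zero.1 hX0]
    module
  have h2 : G (t • v) (t • w) (t • w) = t ^ 2 * G (t • v) w w := by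
    simp; ring
  rw [← h2, htw]
  simp only [hP] at hYt ⊢
  simp only [map_smul, smul_apply] at hYt ⊢
  rw [hYt]
  simp only [smul_eq_mul]
  ring

end IsLeviCivitaOn
end NormalCoordinates

/-! ### The full metric in normal coordinates -/

section NormalCoordinates

variable {E : Type*} [NormedAddCommGroup E] [InnerProductSpace ℝ E]

namespace IsLeviCivitaOn

variable {G : E → E →L[ℝ] E →L[ℝ] ℝ} {Γ : E → E →L[ℝ] E →L[ℝ] E} {r : ℝ}

/-- The metric in normal coordinates, for constant sectional curvature `κ`. -/
theorem metric_normal (L : IsLeviCivitaOn G Γ (Metric.ball 0 r))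
    (hG0 : ∀ a b, G 0 a b = inner ℝ a b)
    (hrad : ∀ (v : E) (t : ℝ), t • v ∈ Metric.ball (0 : E) r → Γ (t • v) v v = 0)
    {κ : ℝ} (hcurv : ∀ x ∈ Metric.ball (0 : E) r, ∀ u v,
      G x (curvature Γ x u v v) u = κ * (G x u u * G x v v - G x u v ^ 2))
    {sn cn : ℝ → ℝ} (hsn : ∀ t, HasDerivAt sn (cn t) t) (hcn : ∀ t, HasDerivAt cn (-κ * sn t) t)
    (hsn0 : sn 0 = 0) (hcn0 : cn 0 = 1) (hpyth : ∀ t, cn t ^ 2 + κ * sn t ^ 2 = 1)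
    {x : E} (hx : x ∈ Metric.ball (0 : E) r) {S : ℝ} (hS : sn ‖x‖ = ‖x‖ * S) (u : E) :
    ‖x‖ ^ 2 * G x u u = inner ℝ x u ^ 2 + S ^ 2 * (‖x‖ ^ 2 * inner ℝ u u - inner ℝ x u ^ 2) := by
  by_cases h0 : x = 0
  · simp [h0]
  have hn : ‖x‖ ≠ 0 := norm_ne_zero_iff.2 h0
  have hr : ‖x‖ < r := mem_ball_zero_iff.1 hx
  obtain ⟨v, hv⟩ : ∃ v, v = ‖x‖⁻¹ • x := ⟨_, rfl⟩
  have hxv : x = ‖x‖ • v := by rw [hv, smul_inv_smul₀ hn]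
  have hv1 : ‖v‖ = 1 := by rw [hv, norm_smul, norm_inv, norm_norm, inv_mul_cancel₀ hn]
  have hvv : inner ℝ v v = 1 := by rw [real_inner_self_eq_norm_sq, hv1, one_pow]
  -- The radial part of `u` is handled by the Gauss lemma and the rest, `w`, by `metric_orthogonal`.
  -- The two parts are orthogonal for `G x` as well, by `hwv`.
  obtain ⟨w, hw⟩ : ∃ w, w = u - inner ℝ v u • v := ⟨_, rfl⟩
  have hvw : inner ℝ v w = 0 := by
    rw [hw, inner_sub_right, inner_smul_right, hvv]; ring
  have hu : u = inner ℝ v u • v + w := by rw [hw]; abel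
  have h1 := L.metric_orthogonal hG0 hrad hcurv hsn hcn hsn0 hcn0 hpyth hv1 hvw (norm_nonneg x) hr
  rw [← hxv, hS] at h1
  have hvr : ∀ a, G x v a = inner ℝ v a := fun a => by
    have h2 := L.metric_radial hG0 hrad hx a
    have h3 : G x x a = ‖x‖ * G x v a := by
      have : G x (‖x‖ • v) a = ‖x‖ * G x v a := by simp
      rwa [← hxv] at this
    have h4 : inner ℝ x a = ‖x‖ * inner ℝ v a := by
      have : inner ℝ (‖x‖ • v) a = ‖x‖ * inner ℝ v a := by rw [inner_smul_left]; simp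
      rwa [← hxv] at this
    rw [h3, h4] at h2
    exact mul_left_cancel₀ hn h2
  have hxu : inner ℝ x u = ‖x‖ * inner ℝ v u := by
    have : inner ℝ (‖x‖ • v) u = ‖x‖ * inner ℝ v u := by rw [inner_smul_left]; simp
    rwa [← hxv] at this
  have hwv : G x w v = 0 := by rw [L.symm x hx, hvr, hvw]
  have hG : G x u u = inner ℝ v u ^ 2 + G x w w := by
    conv_lhs => rw [hu]
    simp only [map_add, map_smul, add_apply, smul_apply, smul_eq_mul, hvr, hwv, hvw, hvv]
    ring
  have hw2 : inner ℝ w w = inner ℝ u u - inner ℝ v u ^ 2 := by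
    rw [hw, inner_sub_left, inner_sub_right, inner_sub_right, inner_smul_left, inner_smul_left,
      inner_smul_right, inner_smul_right, hvv, real_inner_comm v u]
    simp; ring
  rw [hw2] at h1
  have h5 : G x w w = S ^ 2 * (inner ℝ u u - inner ℝ v u ^ 2) := by
    have : ‖x‖ ^ 2 ≠ 0 := pow_ne_zero _ hn
    apply mul_left_cancel₀ this
    rw [h1]; ring
  rw [hG, h5, hxu]
  ring

/-- There are no conjugate points in the domain of normal coordinates. -/
theorem no_conjugate_point (L : IsLeviCivitaOn G Γ (Metric.ball 0 r))
    (hG0 : ∀ a b, G 0 a b = inner ℝ a b)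
    (hrad : ∀ (v : E) (t : ℝ), t • v ∈ Metric.ball (0 : E) r → Γ (t • v) v v = 0)
    {κ : ℝ} (hcurv : ∀ x ∈ Metric.ball (0 : E) r, ∀ u v,
      G x (curvature Γ x u v v) u = κ * (G x u u * G x v v - G x u v ^ 2))
    {sn cn : ℝ → ℝ} (hsn : ∀ t, HasDerivAt sn (cn t) t) (hcn : ∀ t, HasDerivAt cn (-κ * sn t) t)
    (hsn0 : sn 0 = 0) (hcn0 : cn 0 = 1) (hpyth : ∀ t, cn t ^ 2 + κ * sn t ^ 2 = 1)
    {v w : E} (hv : ‖v‖ = 1) (hw : w ≠ 0) (hvw : inner ℝ v w = 0) {t : ℝ} (ht0 : 0 < t)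
    (htr : t < r) : sn t ≠ 0 := by
  -- A zero of `sn` would give `w ≠ 0` zero length at `t v`.
  intro h
  have h1 := L.metric_orthogonal hG0 hrad hcurv hsn hcn hsn0 hcn0 hpyth hv hvw ht0.le htr
  have h2 := L.pos (t • v) (by
    rw [mem_ball_zero_iff, norm_smul, hv, Real.norm_of_nonneg ht0.le, mul_one]; exact htr) w hw
  rw [h] at h1
  have : 0 < t ^ 2 * G (t • v) w w := by positivity
  rw [h1] at this
  simp at this

end IsLeviCivitaOn
end NormalCoordinates

/-! ### Generalized sine and cosine -/

section Trigonometric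

/-- The entire function `∑ (-z)ⁿ / (2n)!`, whose value at `s²` is `cos s`. -/
def cosSqrt (z : ℝ) : ℝ := ∑' n : ℕ, ((-1) ^ n / (2 * n).factorial : ℝ) * z ^ n

/-- The entire function `∑ (-z)ⁿ / (2n + 1)!`, whose value at `s²` is `sin s / s`. -/
def sincSqrt (z : ℝ) : ℝ := ∑' n : ℕ, ((-1) ^ n / (2 * n + 1).factorial : ℝ) * z ^ n

/-- The ratio test gives infinite radius of convergence. Smoothness in the variable `t²` is what
makes the radial maps below smooth at the origin. -/
lemma contDiff_tsum_pow {c : ℕ → ℝ} (hc : ∀ n, c n ≠ 0)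
    (hlim : Tendsto (fun n => ‖c n.succ‖ / ‖c n‖) atTop (𝓝 0)) :
    ContDiff ℝ ∞ fun z : ℝ => ∑' n, c n * z ^ n := by
  have hr := FormalMultilinearSeries.ofScalars_radius_eq_top_of_tendsto ℝ c
    (Eventually.of_forall hc) hlim
  have h := (FormalMultilinearSeries.ofScalars ℝ c).hasFPowerSeriesOnBall (by rw [hr]; simp)
  rw [hr] at h
  have h2 : AnalyticOnNhd ℝ (FormalMultilinearSeries.ofScalars ℝ c).sum univ := by
    have := h.analyticOnNhd
    simpa using this
  have h3 : (FormalMultilinearSeries.ofScalars ℝ c).sum = fun z : ℝ => ∑' n, c n * z ^ n := by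
    funext z
    exact FormalMultilinearSeries.ofScalars_sum_eq (E := ℝ) c z
  rw [← h3]
  exact (contDiffOn_univ.1 (h2.contDiffOn uniqueDiffOn_univ))

lemma contDiff_cosSqrt : ContDiff ℝ ∞ cosSqrt := by
  refine contDiff_tsum_pow (fun n => by positivity) ?_
  have h : ∀ n : ℕ, ‖((-1) ^ n.succ / (2 * n.succ).factorial : ℝ)‖ /
      ‖((-1) ^ n / (2 * n).factorial : ℝ)‖ = 1 / ((2 * n + 2) * (2 * n + 1)) := by
    intro n
    rw [show 2 * n.succ = 2 * n + 1 + 1 by lia, Nat.factorial_succ, Nat.factorial_succ]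
    simp only [norm_div, norm_pow, norm_neg, norm_one, one_pow, Real.norm_natCast]
    push_cast
    field_simp
    ring
  simp_rw [h]
  refine squeeze_zero (fun n => by positivity) (fun n => ?_) tendsto_one_div_add_atTop_nhds_zero_nat
  gcongr
  have : (0 : ℝ) ≤ n := n.cast_nonneg
  nlinarith

lemma contDiff_sincSqrt : ContDiff ℝ ∞ sincSqrt := by
  refine contDiff_tsum_pow (fun n => by positivity) ?_
  have h : ∀ n : ℕ, ‖((-1) ^ n.succ / (2 * n.succ + 1).factorial : ℝ)‖ /
      ‖((-1) ^ n / (2 * n + 1).factorial : ℝ)‖ = 1 / ((2 * n + 3) * (2 * n + 2)) := by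
    intro n
    rw [show 2 * n.succ + 1 = 2 * n + 1 + 1 + 1 by lia, Nat.factorial_succ (2 * n + 1 + 1),
      Nat.factorial_succ (2 * n + 1)]
    simp only [norm_div, norm_pow, norm_neg, norm_one, one_pow, Real.norm_natCast]
    push_cast
    field_simp
    ring
  simp_rw [h]
  refine squeeze_zero (fun n => by positivity) (fun n => ?_) tendsto_one_div_add_atTop_nhds_zero_nat
  gcongr
  have : (0 : ℝ) ≤ n := n.cast_nonneg
  nlinarith

lemma cosSqrt_sq (s : ℝ) : cosSqrt (s ^ 2) = Real.cos s := by
  rw [← (Real.hasSum_cos s).tsum_eq, cosSqrt]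
  congr! 2 with n
  rw [← pow_mul]; ring

lemma cosSqrt_neg_sq (s : ℝ) : cosSqrt (-s ^ 2) = Real.cosh s := by
  rw [← (Real.hasSum_cosh s).tsum_eq, cosSqrt]
  congr! 2 with n
  rw [neg_pow (s ^ 2) n, ← pow_mul, ← mul_assoc, div_mul_eq_mul_div, ← mul_pow]; norm_num; ring

lemma mul_sincSqrt_sq (s : ℝ) : s * sincSqrt (s ^ 2) = Real.sin s := by
  rw [← (Real.hasSum_sin s).tsum_eq, sincSqrt, ← tsum_mul_left]
  congr! 2 with n
  rw [← pow_mul]; ring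

lemma mul_sincSqrt_neg_sq (s : ℝ) : s * sincSqrt (-s ^ 2) = Real.sinh s := by
  rw [← (Real.hasSum_sinh s).tsum_eq, sincSqrt, ← tsum_mul_left]
  congr! 2 with n
  rw [neg_pow (s ^ 2) n, ← pow_mul, ← mul_assoc ((-1) ^ n / _ : ℝ), div_mul_eq_mul_div, ← mul_pow]
  norm_num; ring

lemma cosSqrt_zero : cosSqrt 0 = 1 := by simpa using cosSqrt_sq 0

lemma sincSqrt_zero : sincSqrt 0 = 1 := by
  rw [sincSqrt, tsum_eq_single 0]
  · simp
  · intro n hn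
    simp [hn]

/-- The solution of `f'' + κ f = 0` with `f 0 = 1` and `f' 0 = 0`. -/
def genCos (κ t : ℝ) : ℝ := cosSqrt (κ * t ^ 2)

/-- The solution of `f'' + κ f = 0` with `f 0 = 0` and `f' 0 = 1`. -/
def genSin (κ t : ℝ) : ℝ := t * sincSqrt (κ * t ^ 2)

lemma genCos_sq (σ t : ℝ) : genCos (σ ^ 2) t = Real.cos (σ * t) := by
  rw [genCos, ← mul_pow, cosSqrt_sq]

lemma genCos_neg_sq (σ t : ℝ) : genCos (-σ ^ 2) t = Real.cosh (σ * t) := by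
  rw [genCos, neg_mul, ← mul_pow, cosSqrt_neg_sq]

lemma genCos_zero_left (t : ℝ) : genCos 0 t = 1 := by
  rw [genCos, zero_mul, cosSqrt_zero]

lemma genSin_sq {σ : ℝ} (hσ : σ ≠ 0) (t : ℝ) : genSin (σ ^ 2) t = Real.sin (σ * t) / σ := by
  rw [genSin, ← mul_pow, ← mul_sincSqrt_sq]; field_simp

lemma genSin_neg_sq {σ : ℝ} (hσ : σ ≠ 0) (t : ℝ) :
    genSin (-σ ^ 2) t = Real.sinh (σ * t) / σ := by
  rw [genSin, neg_mul, ← mul_pow, ← mul_sincSqrt_neg_sq]; field_simp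

lemma genSin_zero_left (t : ℝ) : genSin 0 t = t := by
  rw [genSin, zero_mul, sincSqrt_zero, mul_one]

lemma genCos_zero (κ : ℝ) : genCos κ 0 = 1 := by simp [genCos, cosSqrt_zero]

lemma genSin_zero (κ : ℝ) : genSin κ 0 = 0 := by simp [genSin]

lemma curvature_cases (κ : ℝ) :
    (∃ σ, 0 < σ ∧ κ = σ ^ 2) ∨ κ = 0 ∨ ∃ σ, 0 < σ ∧ κ = -σ ^ 2 := by
  rcases lt_trichotomy κ 0 with h | h | h
  · exact Or.inr (Or.inr ⟨√(-κ), Real.sqrt_pos.2 (by linarith), by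
      rw [Real.sq_sqrt (by linarith)]; ring⟩)
  · exact Or.inr (Or.inl h)
  · exact Or.inl ⟨√κ, Real.sqrt_pos.2 h, by rw [Real.sq_sqrt h.le]⟩

lemma hasDerivAt_genSin (κ t : ℝ) : HasDerivAt (genSin κ) (genCos κ t) t := by
  rcases curvature_cases κ with ⟨σ, hσ, rfl⟩ | rfl | ⟨σ, hσ, rfl⟩
  · rw [funext (genSin_sq hσ.ne'), genCos_sq]
    refine (((hasDerivAt_id t).const_mul σ).sin.div_const σ).congr_deriv ?_
    field_simp
    simp
  · rw [funext genSin_zero_left, genCos_zero_left]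
    exact hasDerivAt_id t
  · rw [funext (genSin_neg_sq hσ.ne'), genCos_neg_sq]
    refine (((hasDerivAt_id t).const_mul σ).sinh.div_const σ).congr_deriv ?_
    field_simp
    simp

lemma hasDerivAt_genCos (κ t : ℝ) : HasDerivAt (genCos κ) (-κ * genSin κ t) t := by
  rcases curvature_cases κ with ⟨σ, hσ, rfl⟩ | rfl | ⟨σ, hσ, rfl⟩
  · rw [funext (genCos_sq σ), genSin_sq hσ.ne']
    refine (((hasDerivAt_id t).const_mul σ).cos).congr_deriv ?_
    field_simp
    simp
  · rw [funext genCos_zero_left]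
    simpa using hasDerivAt_const t (1 : ℝ)
  · rw [funext (genCos_neg_sq σ), genSin_neg_sq hσ.ne']
    refine (((hasDerivAt_id t).const_mul σ).cosh).congr_deriv ?_
    field_simp
    simp

lemma genCos_sq_add (κ t : ℝ) : genCos κ t ^ 2 + κ * genSin κ t ^ 2 = 1 := by
  rcases curvature_cases κ with ⟨σ, hσ, rfl⟩ | rfl | ⟨σ, hσ, rfl⟩
  · rw [genCos_sq, genSin_sq hσ.ne']
    field_simp
    linarith [Real.sin_sq_add_cos_sq (σ * t)]
  · rw [genCos_zero_left]; simp
  · rw [genCos_neg_sq, genSin_neg_sq hσ.ne']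
    field_simp
    linarith [Real.cosh_sq (σ * t)]

/-- Only `κ = σ² > 0` needs the hypothesis: `sin (σ t)` vanishes at `t = π / σ`, so `π / σ > 9` and
`σ t ≤ σ < π / 9`. Any bound of at least `2` in place of `9` would suffice. -/
lemma genCos_pos_of_genSin_ne_zero {κ : ℝ} (h : ∀ t, 0 < t → t ≤ 9 → genSin κ t ≠ 0) {t : ℝ}
    (ht : t ∈ Icc (0 : ℝ) 1) : 0 < genCos κ t := by
  rcases curvature_cases κ with ⟨σ, hσ, rfl⟩ | rfl | ⟨σ, hσ, rfl⟩
  · rw [genCos_sq]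
    have h1 : 9 < Real.pi / σ := by
      by_contra! h2
      refine h (Real.pi / σ) (by positivity) h2 ?_
      rw [genSin_sq hσ.ne', mul_div_cancel₀ _ hσ.ne']
      simp
    rw [lt_div_iff₀ hσ] at h1
    have h3 : 0 ≤ σ * t := mul_nonneg hσ.le ht.1
    have h4 : σ * t ≤ σ := mul_le_of_le_one_right hσ.le ht.2
    exact Real.cos_pos_of_mem_Ioo ⟨by linarith [Real.pi_pos], by linarith⟩
  · rw [genCos_zero_left]; exact one_pos
  · rw [genCos_neg_sq]; exact Real.cosh_pos _

end Trigonometric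

/-! ### Central projection and the Klein metric -/

section Projective

variable {E : Type*} [NormedAddCommGroup E] [InnerProductSpace ℝ E]

/-- The function `T` with `t * T (t²) = genSin κ t / genCos κ t`. -/
def radialFactor (κ q : ℝ) : ℝ := sincSqrt (κ * q) / cosSqrt (κ * q)

/-- The expression in normal coordinates of the central projection of the space form of curvature
`κ`. -/
def centralProj (κ : ℝ) (x : E) : E := radialFactor κ (‖x‖ ^ 2) • x

/-- The metric of the space form of curvature `κ` in projective coordinates. -/
def kleinMetric (κ : ℝ) (y a b : E) : ℝ :=
  inner ℝ a b / (1 + κ * ‖y‖ ^ 2) - κ * inner ℝ y a * inner ℝ y b / (1 + κ * ‖y‖ ^ 2) ^ 2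

lemma mul_radialFactor_sq (κ t : ℝ) : t * radialFactor κ (t ^ 2) = genSin κ t / genCos κ t := by
  rw [radialFactor, genSin, genCos, mul_div_assoc]

lemma contDiffAt_radialFactor {κ q : ℝ} (hq : cosSqrt (κ * q) ≠ 0) :
    ContDiffAt ℝ ∞ (radialFactor κ) q :=
  ((contDiff_sincSqrt.comp (contDiff_const.mul contDiff_id)).contDiffAt).div
    ((contDiff_cosSqrt.comp (contDiff_const.mul contDiff_id)).contDiffAt) hq

lemma contDiffAt_centralProj {κ : ℝ} {x : E} (hx : genCos κ ‖x‖ ≠ 0) :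
    ContDiffAt ℝ ∞ (centralProj κ) x :=
  ((contDiffAt_radialFactor hx).comp x (contDiff_norm_sq ℝ).contDiffAt).smul contDiffAt_id

/-- Both sides are the derivative of `genSin / genCos` at `t`; the left side is the stretching
factor of the central projection in the radial direction. -/
lemma radialFactor_add_deriv {κ t : ℝ} (ht : genCos κ t ≠ 0) :
    radialFactor κ (t ^ 2) + 2 * t ^ 2 * deriv (radialFactor κ) (t ^ 2) = 1 / genCos κ t ^ 2 := by
  have h1 : HasDerivAt (fun s => s * radialFactor κ (s ^ 2))
      (radialFactor κ (t ^ 2) + 2 * t ^ 2 * deriv (radialFactor κ) (t ^ 2)) t := by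
    have hd : HasDerivAt (radialFactor κ) (deriv (radialFactor κ) (t ^ 2)) (t ^ 2) :=
      ((contDiffAt_radialFactor ht).differentiableAt (by simp)).hasDerivAt
    have hp : HasDerivAt (fun s : ℝ => s ^ 2) (2 * t) t := by simpa using hasDerivAt_pow 2 t
    refine ((hasDerivAt_id t).mul (HasDerivAt.comp (h := fun s : ℝ => s ^ 2) t hd hp)).congr_deriv ?_
    simp; ring
  rw [funext (mul_radialFactor_sq κ)] at h1
  have h2 := (hasDerivAt_genSin κ t).fun_div (hasDerivAt_genCos κ t) ht
  rw [h1.unique h2, ← genCos_sq_add κ t]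
  congr 1; ring

lemma hasFDerivAt_centralProj {κ : ℝ} {x : E} (hx : genCos κ ‖x‖ ≠ 0) :
    HasFDerivAt (centralProj κ) (radialFactor κ (‖x‖ ^ 2) • ContinuousLinearMap.id ℝ E +
      ((2 * deriv (radialFactor κ) (‖x‖ ^ 2)) • innerSL ℝ x).smulRight x) x := by
  have hd : HasDerivAt (radialFactor κ) (deriv (radialFactor κ) (‖x‖ ^ 2)) (‖x‖ ^ 2) :=
      ((contDiffAt_radialFactor hx).differentiableAt (by simp)).hasDerivAt
  have hn : HasFDerivAt (fun x : E => ‖x‖ ^ 2) ((2 : ℝ) • innerSL ℝ x) x := by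
    refine (hasStrictFDerivAt_norm_sq x).hasFDerivAt.congr_fderiv ?_
    ext u
    simp
  refine ((hd.comp_hasFDerivAt x hn).smul (hasFDerivAt_id x)).congr_fderiv ?_
  ext u
  simp [smul_smul]
  congr 1; ring

/-- The analogue of `1 + tan² = 1 / cos²`. -/
lemma genCos_sq_mul {κ : ℝ} {x : E} (hx : genCos κ ‖x‖ ≠ 0) :
    genCos κ ‖x‖ ^ 2 * (1 + κ * ‖centralProj κ x‖ ^ 2) = 1 := by
  have h : ‖centralProj κ x‖ ^ 2 = (genSin κ ‖x‖ / genCos κ ‖x‖) ^ 2 := by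
    rw [← mul_radialFactor_sq, centralProj, norm_smul, mul_pow, mul_pow, Real.norm_eq_abs, sq_abs]
    ring
  rw [h]
  field_simp
  exact genCos_sq_add κ ‖x‖

/-- The factor `‖x‖²` on the left gives the shape of `IsLeviCivitaOn.metric_normal`, so that the two
right-hand sides agree and no division by `‖x‖` occurs. -/
lemma kleinMetric_centralProj {κ : ℝ} {x : E} (hx : genCos κ ‖x‖ ≠ 0) (u : E) :
    ‖x‖ ^ 2 * kleinMetric κ (centralProj κ x) (fderiv ℝ (centralProj κ) x u)
      (fderiv ℝ (centralProj κ) x u) =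
    inner ℝ x u ^ 2 + sincSqrt (κ * ‖x‖ ^ 2) ^ 2 * (‖x‖ ^ 2 * inner ℝ u u - inner ℝ x u ^ 2) := by
  have hD := genCos_sq_mul hx
  rw [(hasFDerivAt_centralProj hx).fderiv]
  have hT := radialFactor_add_deriv hx
  have hS : sincSqrt (κ * ‖x‖ ^ 2) = radialFactor κ (‖x‖ ^ 2) * genCos κ ‖x‖ := by
    rw [radialFactor, ← genCos, div_mul_cancel₀ _ hx]
  have hP := genCos_sq_add κ ‖x‖
  rw [genSin, hS] at hP
  rw [hS, kleinMetric]
  have hD' : 1 + κ * ‖centralProj κ x‖ ^ 2 = 1 / genCos κ ‖x‖ ^ 2 := by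
    field_simp; linarith
  rw [hD', centralProj]
  set T := radialFactor κ (‖x‖ ^ 2)
  set T' := deriv (radialFactor κ) (‖x‖ ^ 2)
  set c := genCos κ ‖x‖
  obtain ⟨m, hm⟩ : ∃ m, m = inner ℝ u u := ⟨_, rfl⟩
  obtain ⟨s, hs⟩ : ∃ s, s = inner ℝ x u := ⟨_, rfl⟩
  obtain ⟨q, hq⟩ : ∃ q, q = ‖x‖ ^ 2 := ⟨_, rfl⟩
  have e1 : (T • ContinuousLinearMap.id ℝ E + ((2 * T') • innerSL ℝ x).smulRight x) u =
      T • u + (2 * T' * s) • x := by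
    simp [hs]
  rw [e1]
  simp only [inner_add_left, inner_add_right, inner_smul_left, inner_smul_right, conj_trivial,
    real_inner_self_eq_norm_sq x, real_inner_comm x u]
  rw [← hq] at hT ⊢
  rw [← hm, ← hs]
  rw [mul_pow, ← hq] at hP
  -- The radial derivative `hA` and the Pythagorean identity `hP` are the only relations needed
  -- between `T`, `T'` and `c`.
  have hA : c ^ 2 * (T + 2 * q * T') = 1 := by rw [hT]; field_simp
  simp only [one_div, div_inv_eq_mul, inv_pow]
  linear_combination (-c ^ 2 * s ^ 2 * (T + 2 * q * T') ^ 2) * hP +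
    s ^ 2 * (c ^ 2 * (T + 2 * q * T') + 1) * hA

/-- The central projection is an isometry onto its image with the metric `kleinMetric κ`. -/
theorem kleinMetric_eq_of_normal {κ : ℝ} {x : E} (hx : genCos κ ‖x‖ ≠ 0) {u : E} {g : ℝ}
    (h0 : x = 0 → g = inner ℝ u u) (hg : ‖x‖ ^ 2 * g = inner ℝ x u ^ 2 +
      sincSqrt (κ * ‖x‖ ^ 2) ^ 2 * (‖x‖ ^ 2 * inner ℝ u u - inner ℝ x u ^ 2)) :
    kleinMetric κ (centralProj κ x) (fderiv ℝ (centralProj κ) x u)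
      (fderiv ℝ (centralProj κ) x u) = g := by
  -- At the origin `hg` reads `0 = 0`, so the value of `g` has to come from `h0`.
  by_cases hx0 : x = 0
  · rw [h0 hx0, (hasFDerivAt_centralProj hx).fderiv, hx0]
    simp [kleinMetric, centralProj, radialFactor, sincSqrt_zero, cosSqrt_zero]
  · have : ‖x‖ ^ 2 ≠ 0 := pow_ne_zero _ (norm_ne_zero_iff.2 hx0)
    apply mul_left_cancel₀ this
    rw [hg, kleinMetric_centralProj hx]

/-- The radius of the image of the unit ball under the central projection. -/
def kleinRadius (κ : ℝ) : ℝ := genSin κ 1 / genCos κ 1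

lemma strictMonoOn_genSin_div_genCos {κ : ℝ} (hκ : ∀ t ∈ Icc (0 : ℝ) 1, 0 < genCos κ t) :
    StrictMonoOn (fun t => genSin κ t / genCos κ t) (Icc 0 1) := by
  have hd : ∀ t ∈ Icc (0 : ℝ) 1, HasDerivAt (fun t => genSin κ t / genCos κ t)
      (1 / genCos κ t ^ 2) t := by
    intro t ht
    refine ((hasDerivAt_genSin κ t).fun_div (hasDerivAt_genCos κ t) (hκ t ht).ne').congr_deriv ?_
    rw [← genCos_sq_add κ t]
    congr 1; ring
  refine strictMonoOn_of_deriv_pos (convex_Icc 0 1)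
    (fun t ht => (hd t ht).continuousAt.continuousWithinAt) fun t ht => ?_
  rw [interior_Icc] at ht
  have := hκ t (Ioo_subset_Icc_self ht)
  rw [(hd t (Ioo_subset_Icc_self ht)).deriv]
  positivity

lemma continuousOn_genSin_div_genCos {κ : ℝ} (hκ : ∀ t ∈ Icc (0 : ℝ) 1, 0 < genCos κ t) :
    ContinuousOn (fun t => genSin κ t / genCos κ t) (Icc 0 1) := fun t ht =>
  ((hasDerivAt_genSin κ t).fun_div (hasDerivAt_genCos κ t)
    (hκ t ht).ne').continuousAt.continuousWithinAt

lemma kleinRadius_pos {κ : ℝ} (hκ : ∀ t ∈ Icc (0 : ℝ) 1, 0 < genCos κ t) : 0 < kleinRadius κ := by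
  have := strictMonoOn_genSin_div_genCos hκ (by simp : (0 : ℝ) ∈ Icc (0 : ℝ) 1) (by simp) one_pos
  simp only [genSin_zero, zero_div] at this
  exact this

lemma radialFactor_pos {κ : ℝ} (hκ : ∀ t ∈ Icc (0 : ℝ) 1, 0 < genCos κ t) {t : ℝ}
    (ht : t ∈ Icc (0 : ℝ) 1) : 0 < radialFactor κ (t ^ 2) := by
  rcases eq_or_lt_of_le ht.1 with h | h
  · rw [← h]; simp [radialFactor, sincSqrt_zero, cosSqrt_zero]
  · have := strictMonoOn_genSin_div_genCos hκ (by simp : (0 : ℝ) ∈ Icc (0 : ℝ) 1) ht h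
    simp only [genSin_zero, zero_div] at this
    rw [← mul_radialFactor_sq] at this
    exact pos_of_mul_pos_right this ht.1

lemma norm_centralProj {κ : ℝ} (hκ : ∀ t ∈ Icc (0 : ℝ) 1, 0 < genCos κ t) {x : E}
    (hx : ‖x‖ ≤ 1) : ‖centralProj κ x‖ = genSin κ ‖x‖ / genCos κ ‖x‖ := by
  rw [centralProj, norm_smul, Real.norm_of_nonneg (radialFactor_pos hκ ⟨norm_nonneg x, hx⟩).le,
    mul_comm, mul_radialFactor_sq]

/-- The projection preserves rays from the origin, and on norms it acts as the strictly increasing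
function `genSin / genCos`, which maps `[0, 1)` onto `[0, kleinRadius κ)`. -/
lemma bijOn_centralProj {κ : ℝ} (hκ : ∀ t ∈ Icc (0 : ℝ) 1, 0 < genCos κ t) :
    BijOn (centralProj κ) (Metric.ball (0 : E) 1) (Metric.ball (0 : E) (kleinRadius κ)) := by
  have hm := strictMonoOn_genSin_div_genCos hκ
  have hI : ∀ x ∈ Metric.ball (0 : E) 1, ‖x‖ ∈ Icc (0 : ℝ) 1 := fun x hx =>
    ⟨norm_nonneg x, (mem_ball_zero_iff.1 hx).le⟩
  refine ⟨fun x hx => ?_, fun x hx y hy h => ?_, fun y hy => ?_⟩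
  · rw [mem_ball_zero_iff, norm_centralProj hκ (hI x hx).2]
    exact hm (hI x hx) (by simp) (mem_ball_zero_iff.1 hx)
  · have h1 := congrArg norm h
    rw [norm_centralProj hκ (hI x hx).2, norm_centralProj hκ (hI y hy).2] at h1
    have h2 := hm.injOn (hI x hx) (hI y hy) h1
    rw [centralProj, centralProj, h2] at h
    exact smul_right_injective E (radialFactor_pos hκ (hI y hy)).ne' h
  · have h1 := intermediate_value_Ico zero_le_one (continuousOn_genSin_div_genCos hκ)
    obtain ⟨t, ht, hty⟩ := h1 (show ‖y‖ ∈ _ by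
      simpa [genSin_zero, kleinRadius] using mem_ball_zero_iff.1 hy)
    have htI := Ico_subset_Icc_self ht
    have hT := radialFactor_pos hκ htI
    have hnx : ‖(radialFactor κ (t ^ 2))⁻¹ • y‖ = t := by
      rw [norm_smul, norm_inv, Real.norm_of_nonneg hT.le, ← hty]
      simp only [← mul_radialFactor_sq]
      field_simp
    refine ⟨(radialFactor κ (t ^ 2))⁻¹ • y, ?_, ?_⟩
    · rw [mem_ball_zero_iff, hnx]; exact ht.2
    · rw [centralProj, hnx, smul_inv_smul₀ hT.ne']

end Projective

/-- A smooth bijection between open subsets of a finite-dimensional space with injective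
differentials has a smooth inverse. -/
lemma contDiffOn_inverse {E : Type*} [NormedAddCommGroup E] [NormedSpace ℝ E]
    [FiniteDimensional ℝ E] {f g : E → E} {U V : Set E} (hU : IsOpen U)
    (hf : ContDiffOn ℝ ∞ f U) (hd : ∀ x ∈ U, Function.Injective (fderiv ℝ f x))
    (hg : MapsTo g V U) (hinv : InvOn g f U V) : ContDiffOn ℝ ∞ g V := by
  intro y hy
  have : CompleteSpace E := FiniteDimensional.complete ℝ E
  have hx := hg hy
  have hfx := hf.contDiffAt (hU.mem_nhds hx)
  let f' : E ≃L[ℝ] E := (LinearEquiv.ofInjectiveEndo (fderiv ℝ f (g y) : E →ₗ[ℝ] E)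
    (hd _ hx)).toContinuousLinearEquiv
  have hf' : HasFDerivAt f (f' : E →L[ℝ] E) (g y) := by
    refine (hfx.differentiableAt (by simp)).hasFDerivAt.congr_fderiv ?_
    ext u
    rfl
  have hloc := hfx.to_localInverse hf' (by simp)
  rw [hinv.2 hy] at hloc
  have hst := hfx.hasStrictFDerivAt' hf' (by simp)
  have h1 := hst.eventually_right_inverse
  rw [hinv.2 hy] at h1
  have h2 : hst.localInverse f f' (g y) y = g y := by
    have := hst.localInverse_apply_image
    rwa [hinv.2 hy] at this
  -- The local inverse must take values in `U` before injectivity of `f` on `U` can identify it with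
  -- `g`.
  have h3 : ∀ᶠ z in 𝓝 y, hst.localInverse f f' (g y) z ∈ U :=
    hloc.continuousAt.eventually_mem (by
      change U ∈ 𝓝 (hst.localInverse f f' (g y) y)
      rw [h2]
      exact hU.mem_nhds hx)
  refine (hloc.congr_of_eventuallyEq ?_).contDiffWithinAt
  filter_upwards [h1, h3] with z hz1 hz3
  change g z = hst.localInverse f f' (g y) z
  rw [← hinv.1 hz3, hz1]

/-! ### Metric, connection and curvature in a chart -/

section Charts

variable {d : ℕ}

lemma eq_sum_basisVec (u : EuclideanSpace ℝ (Fin d)) : u = ∑ i, u i • basisVec i := by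
  ext k
  simp [basisVec, Pi.single_apply]

lemma isLinearMap_eq_sum_basisVec {f : EuclideanSpace ℝ (Fin d) → ℝ} (hf : IsLinearMap ℝ f)
    (u : EuclideanSpace ℝ (Fin d)) : f u = ∑ i, f (basisVec i) * u i := by
  conv_lhs => rw [SpaceForm.eq_sum_basisVec u]
  change hf.mk' f _ = _
  rw [map_sum]
  refine Finset.sum_congr rfl fun i _ => ?_
  rw [map_smul, smul_eq_mul, mul_comm]
  rfl

/-- Reduces the Koszul formula and the curvature identity to basis vectors, where the coefficients
are defined. -/
lemma trilinear_eq_sum {f : EuclideanSpace ℝ (Fin d) → EuclideanSpace ℝ (Fin d) →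
      EuclideanSpace ℝ (Fin d) → ℝ} (h1 : ∀ v w, IsLinearMap ℝ fun u => f u v w)
    (h2 : ∀ u w, IsLinearMap ℝ fun v => f u v w) (h3 : ∀ u v, IsLinearMap ℝ fun w => f u v w)
    (u v w : EuclideanSpace ℝ (Fin d)) :
    f u v w = ∑ i, ∑ j, ∑ k, f (basisVec i) (basisVec j) (basisVec k) * u i * v j * w k := by
  rw [isLinearMap_eq_sum_basisVec (h1 v w) u]
  refine Finset.sum_congr rfl fun i _ => ?_
  rw [isLinearMap_eq_sum_basisVec (h2 _ w) v, Finset.sum_mul]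
  refine Finset.sum_congr rfl fun j _ => ?_
  rw [isLinearMap_eq_sum_basisVec (h3 _ _) w, Finset.sum_mul, Finset.sum_mul]
  refine Finset.sum_congr rfl fun k _ => ?_
  ring

lemma fderiv_bilin_apply {E F : Type*} [NormedAddCommGroup E] [NormedSpace ℝ E]
    [NormedAddCommGroup F] [NormedSpace ℝ F] {f : E → E →L[ℝ] E →L[ℝ] F} {y : E}
    (hf : DifferentiableAt ℝ f y) (ℓ : F →L[ℝ] ℝ) (a b c : E) :
    ℓ (fderiv ℝ f y a b c) = fderiv ℝ (fun z => ℓ (f z b c)) y a := by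
  have h : HasFDerivAt (fun z => ℓ (f z b c)) ((ℓ.comp ((ContinuousLinearMap.apply ℝ F c).comp
      (ContinuousLinearMap.apply ℝ (E →L[ℝ] F) b))).comp (fderiv ℝ f y)) y :=
    (ℓ.comp ((ContinuousLinearMap.apply ℝ F c).comp
      (ContinuousLinearMap.apply ℝ (E →L[ℝ] F) b))).hasFDerivAt.comp y hf.hasFDerivAt
  rw [h.fderiv]
  rfl

variable {M : Type*} [TopologicalSpace M] [ChartedSpace (EuclideanSpace ℝ (Fin d)) M]

lemma mfderiv_symm_injective
    {e : OpenPartialHomeomorph M (EuclideanSpace ℝ (Fin d))}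
    (he : e ∈ IsManifold.maximalAtlas (𝓡 d) ∞ M)
    {y : EuclideanSpace ℝ (Fin d)} (hy : y ∈ e.target) :
    Function.Injective (mfderiv (𝓡 d) (𝓡 d) e.symm y) := by
  have h1 : MDifferentiableAt (𝓡 d) (𝓡 d) e.symm y :=
    (contMDiffAt_symm_of_mem_maximalAtlas he hy).mdifferentiableAt (by simp)
  have h2 : MDifferentiableAt (𝓡 d) (𝓡 d) e (e.symm y) :=
    (contMDiffAt_of_mem_maximalAtlas he (e.map_target hy)).mdifferentiableAt (by simp)
  have h3 : mfderiv (𝓡 d) (𝓡 d) (e ∘ e.symm) y = ContinuousLinearMap.id ℝ _ := by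
    rw [← mfderiv_id (I := 𝓡 d) (x := y)]
    refine Filter.EventuallyEq.mfderiv_eq ?_
    filter_upwards [e.open_target.mem_nhds hy] with z hz using e.right_inv hz
  rw [mfderiv_comp y h2 h1] at h3
  intro u v huv
  have := congrArg (mfderiv (𝓡 d) (𝓡 d) e (e.symm y)) huv
  have h4 := DFunLike.congr_fun h3 u
  have h5 := DFunLike.congr_fun h3 v
  exact h4.symm.trans (this.trans h5)

variable [RiemannianBundle (fun x : M => TangentSpace (𝓡 d) x)]

/-- The metric in the local coordinates `e`, as a bilinear form. -/
def chartMetric (e : OpenPartialHomeomorph M (EuclideanSpace ℝ (Fin d)))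
    (y : EuclideanSpace ℝ (Fin d)) :
    EuclideanSpace ℝ (Fin d) →L[ℝ] EuclideanSpace ℝ (Fin d) →L[ℝ] ℝ :=
  ∑ i, ∑ j, metricCoeff e y i j •
    (EuclideanSpace.proj i : EuclideanSpace ℝ (Fin d) →L[ℝ] ℝ).smulRight
      (EuclideanSpace.proj j : EuclideanSpace ℝ (Fin d) →L[ℝ] ℝ)

/-- The Christoffel symbols in the local coordinates `e`, as a bilinear map. -/
def chartChristoffel (e : OpenPartialHomeomorph M (EuclideanSpace ℝ (Fin d)))
    (y : EuclideanSpace ℝ (Fin d)) :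
    EuclideanSpace ℝ (Fin d) →L[ℝ] EuclideanSpace ℝ (Fin d) →L[ℝ] EuclideanSpace ℝ (Fin d) :=
  ∑ k, ∑ i, ∑ j, christoffel e y k i j •
    (EuclideanSpace.proj i : EuclideanSpace ℝ (Fin d) →L[ℝ] ℝ).smulRight
      ((EuclideanSpace.proj j : EuclideanSpace ℝ (Fin d) →L[ℝ] ℝ).smulRight (basisVec k))

variable (e : OpenPartialHomeomorph M (EuclideanSpace ℝ (Fin d)))

lemma chartMetric_apply (y u v : EuclideanSpace ℝ (Fin d)) :
    chartMetric e y u v = metricInner e y u v := by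
  simp only [chartMetric, metricInner, sum_apply, smul_apply,
    ContinuousLinearMap.smulRight_apply, smul_eq_mul, mul_assoc]
  rfl

lemma chartMetric_eq_inner (y u v : EuclideanSpace ℝ (Fin d)) :
    chartMetric e y u v =
      inner ℝ (mfderiv (𝓡 d) (𝓡 d) e.symm y u : TangentSpace (𝓡 d) (e.symm y))
        (mfderiv (𝓡 d) (𝓡 d) e.symm y v : TangentSpace (𝓡 d) (e.symm y)) := by
  have h : ∀ u : EuclideanSpace ℝ (Fin d), mfderiv (𝓡 d) (𝓡 d) e.symm y u =
      ∑ i, u i • (mfderiv (𝓡 d) (𝓡 d) e.symm y (basisVec i) : TangentSpace (𝓡 d) (e.symm y)) := by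
    have h1 : ∀ (A : EuclideanSpace ℝ (Fin d) →L[ℝ] EuclideanSpace ℝ (Fin d)) u,
        A u = ∑ i, u i • A (basisVec i) := fun A u => by
      conv_lhs => rw [eq_sum_basisVec u]
      simp only [map_sum, map_smul]
    exact h1 _
  rw [h u, h v, chartMetric_apply, metricInner, sum_inner]
  refine Finset.sum_congr rfl fun i _ => ?_
  rw [inner_sum]
  refine Finset.sum_congr rfl fun j _ => ?_
  rw [inner_smul_left, inner_smul_right, metricCoeff]
  simp only [Matrix.of_apply, conj_trivial]
  ring

lemma chartMetric_symm (y u v : EuclideanSpace ℝ (Fin d)) :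
    chartMetric e y u v = chartMetric e y v u := by
  rw [chartMetric_eq_inner, chartMetric_eq_inner, real_inner_comm]

lemma chartMetric_basisVec (y : EuclideanSpace ℝ (Fin d)) (i j : Fin d) :
    chartMetric e y (basisVec i) (basisVec j) = metricCoeff e y i j := by
  rw [chartMetric_eq_inner]; rfl

lemma chartChristoffel_apply (y u v : EuclideanSpace ℝ (Fin d)) (k : Fin d) :
    chartChristoffel e y u v k = ∑ i, ∑ j, christoffel e y k i j * u i * v j := by
  simp [chartChristoffel, basisVec, Pi.single_apply, mul_assoc]

lemma chartChristoffel_basisVec (y : EuclideanSpace ℝ (Fin d)) (i j k : Fin d) :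
    chartChristoffel e y (basisVec i) (basisVec j) k = christoffel e y k i j := by
  rw [chartChristoffel_apply]
  simp [basisVec]

variable {e}

lemma chartMetric_pos (he : e ∈ IsManifold.maximalAtlas (𝓡 d) ∞ M)
    {y : EuclideanSpace ℝ (Fin d)} (hy : y ∈ e.target) {u : EuclideanSpace ℝ (Fin d)}
    (hu : u ≠ 0) : 0 < chartMetric e y u u := by
  rw [chartMetric_eq_inner]
  have h : mfderiv (𝓡 d) (𝓡 d) e.symm y u ≠ 0 := fun h =>
    hu (mfderiv_symm_injective he hy (h.trans (map_zero _).symm))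
  exact real_inner_self_pos.2 h

lemma isUnit_det_metricCoeff (he : e ∈ IsManifold.maximalAtlas (𝓡 d) ∞ M)
    {y : EuclideanSpace ℝ (Fin d)} (hy : y ∈ e.target) : IsUnit (metricCoeff e y).det := by
  rw [isUnit_iff_ne_zero]
  intro h
  obtain ⟨v, hv, hv2⟩ := Matrix.exists_mulVec_eq_zero_iff.2 h
  have := chartMetric_pos he hy (u := WithLp.toLp 2 v) (by simpa using hv)
  rw [chartMetric_apply, metricInner] at this
  refine this.ne' ?_
  refine Finset.sum_eq_zero fun i _ => ?_
  have h3 := congrFun hv2 i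
  simp only [Matrix.mulVec, dotProduct, Pi.zero_apply] at h3
  calc _ = v i * ∑ j, metricCoeff e y i j * v j := by
        rw [Finset.mul_sum]; exact Finset.sum_congr rfl fun j _ => by simp; ring
    _ = 0 := by rw [h3, mul_zero]

/-- Lowering the upper index cancels the inverse matrix in the definition of `christoffel`. -/
lemma chartMetric_christoffel_basisVec (he : e ∈ IsManifold.maximalAtlas (𝓡 d) ∞ M)
    {y : EuclideanSpace ℝ (Fin d)} (hy : y ∈ e.target) (i j l : Fin d) :
    2 * chartMetric e y (chartChristoffel e y (basisVec i) (basisVec j)) (basisVec l) =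
      metricDeriv e y i j l + metricDeriv e y j i l - metricDeriv e y l i j := by
  rw [chartMetric_symm, chartMetric_apply, metricInner]
  simp only [chartChristoffel_basisVec]
  have h1 : ∀ a, ∑ b, metricCoeff e y a b * basisVec l a * christoffel e y b i j =
      if a = l then ∑ b, metricCoeff e y l b * christoffel e y b i j else 0 := by
    intro a
    split_ifs with h
    · subst h
      simp [basisVec]
    · simp [basisVec, h]
  simp only [h1, Finset.sum_ite_eq', Finset.mem_univ, if_true]
  simp only [christoffel]
  have h2 := Matrix.mul_nonsing_inv _ (isUnit_det_metricCoeff he hy)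
  set c : Fin d → ℝ := fun m =>
    metricDeriv e y i j m + metricDeriv e y j i m - metricDeriv e y m i j with hc
  have h3 : (metricCoeff e y).mulVec ((metricCoeff e y)⁻¹.mulVec c) = c := by
    rw [Matrix.mulVec_mulVec, h2, Matrix.one_mulVec]
  have h4 := congrFun h3 l
  simp only [Matrix.mulVec, dotProduct] at h4
  rw [← show c l = metricDeriv e y i j l + metricDeriv e y j i l - metricDeriv e y l i j from rfl,
    ← h4, Finset.mul_sum]
  refine Finset.sum_congr rfl fun b _ => ?_
  ring

variable [IsManifold (𝓡 d) ∞ M] [IsContMDiffRiemannianBundle (𝓡 d) ∞ (EuclideanSpace ℝ (Fin d))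
      (fun x : M => TangentSpace (𝓡 d) x)]

/-- The coordinate fields are smooth sections, being images of constant fields under the tangent map
of `e.symm`; the inner product of smooth sections is smooth. -/
lemma contDiffOn_metricCoeff (he : e ∈ IsManifold.maximalAtlas (𝓡 d) ∞ M) (i j : Fin d) :
    ContDiffOn ℝ ∞ (fun y => metricCoeff e y i j) e.target := by
  rw [← contMDiffOn_iff_contDiffOn]
  have hs : ∀ i : Fin d, ContMDiffOn (𝓡 d) (𝓡 d).tangent ∞ (fun y =>
      (⟨e.symm y, mfderiv (𝓡 d) (𝓡 d) e.symm y (basisVec i)⟩ : TangentBundle (𝓡 d) M)) e.target := by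
    intro i
    have h1 := (contMDiffOn_symm_of_mem_maximalAtlas he).contMDiffOn_tangentMapWithin
      (m := ∞) (by simp) e.open_target.uniqueMDiffOn
    have h2 : ContMDiff (𝓡 d) (𝓡 d).tangent ∞ (fun y : EuclideanSpace ℝ (Fin d) =>
      (⟨y, basisVec i⟩ : TangentBundle (𝓡 d) (EuclideanSpace ℝ (Fin d)))) :=
      contMDiff_vectorSpace_iff_contDiff.2 contDiff_const
    have h3 := h1.comp (s := e.target) h2.contMDiffOn (fun y hy => hy)
    refine h3.congr fun y hy => ?_
    simp only [Function.comp_apply, tangentMapWithin]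
    rw [mfderivWithin_of_isOpen e.open_target hy]
  exact ContMDiffOn.inner_bundle (IB := 𝓡 d) (F := EuclideanSpace ℝ (Fin d))
    (E := fun x : M => TangentSpace (𝓡 d) x) (hs i) (hs j)

lemma contDiffOn_det {F : Type*} [NormedAddCommGroup F] [NormedSpace ℝ F] {s : Set F} {n : ℕ}
    {A : F → Matrix (Fin n) (Fin n) ℝ} (hA : ∀ i j, ContDiffOn ℝ ∞ (fun y => A y i j) s) :
    ContDiffOn ℝ ∞ (fun y => (A y).det) s := by
  simp only [Matrix.det_apply']
  exact ContDiffOn.sum fun σ _ => contDiffOn_const.mul (contDiffOn_prod fun i _ => hA _ _)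

/-- Cramer's rule. -/
lemma contDiffOn_inv_metricCoeff (he : e ∈ IsManifold.maximalAtlas (𝓡 d) ∞ M) (i j : Fin d) :
    ContDiffOn ℝ ∞ (fun y => (metricCoeff e y)⁻¹ i j) e.target := by
  have hdet := contDiffOn_det (contDiffOn_metricCoeff he)
  have hadj : ContDiffOn ℝ ∞ (fun y => (metricCoeff e y).adjugate i j) e.target := by
    simp only [Matrix.adjugate_apply]
    refine contDiffOn_det fun a b => ?_
    simp only [Matrix.updateRow_apply]
    by_cases h : a = j
    · simpa [h] using contDiffOn_const
    · simpa [h] using contDiffOn_metricCoeff he a b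
  refine ((hdet.inv fun y hy => (isUnit_det_metricCoeff he hy).ne_zero).mul hadj).congr
    fun y hy => ?_
  simp [Matrix.inv_def, Ring.inverse_eq_inv']

lemma contDiffOn_metricDeriv (he : e ∈ IsManifold.maximalAtlas (𝓡 d) ∞ M) (k i j : Fin d) :
    ContDiffOn ℝ ∞ (fun y => metricDeriv e y k i j) e.target :=
  ((contDiffOn_metricCoeff he i j).fderiv_of_isOpen e.open_target (m := ∞) (by simp)).clm_apply
    contDiffOn_const

lemma contDiffOn_christoffel (he : e ∈ IsManifold.maximalAtlas (𝓡 d) ∞ M) (k i j : Fin d) :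
    ContDiffOn ℝ ∞ (fun y => christoffel e y k i j) e.target :=
  contDiffOn_const.mul (ContDiffOn.sum fun l _ => (contDiffOn_inv_metricCoeff he k l).mul
    (((contDiffOn_metricDeriv he i j l).add (contDiffOn_metricDeriv he j i l)).sub
      (contDiffOn_metricDeriv he l i j)))

lemma contDiffOn_chartMetric (he : e ∈ IsManifold.maximalAtlas (𝓡 d) ∞ M) :
    ContDiffOn ℝ ∞ (chartMetric e) e.target :=
  ContDiffOn.sum fun i _ => ContDiffOn.sum fun j _ =>
    (contDiffOn_metricCoeff he i j).smul contDiffOn_const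

lemma contDiffOn_chartChristoffel (he : e ∈ IsManifold.maximalAtlas (𝓡 d) ∞ M) :
    ContDiffOn ℝ ∞ (chartChristoffel e) e.target :=
  ContDiffOn.sum fun k _ => ContDiffOn.sum fun i _ => ContDiffOn.sum fun j _ =>
    (contDiffOn_christoffel he k i j).smul contDiffOn_const

lemma fderiv_chartMetric_basisVec (he : e ∈ IsManifold.maximalAtlas (𝓡 d) ∞ M)
    {y : EuclideanSpace ℝ (Fin d)} (hy : y ∈ e.target) (k i j : Fin d) :
    fderiv ℝ (chartMetric e) y (basisVec k) (basisVec i) (basisVec j) = metricDeriv e y k i j := by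
  have h := fderiv_bilin_apply (((contDiffOn_chartMetric he).contDiffAt
    (e.open_target.mem_nhds hy)).differentiableAt (by simp)) (ContinuousLinearMap.id ℝ ℝ)
    (basisVec k) (basisVec i) (basisVec j)
  simp only [ContinuousLinearMap.id_apply, chartMetric_basisVec] at h
  exact h

lemma fderiv_chartChristoffel_basisVec (he : e ∈ IsManifold.maximalAtlas (𝓡 d) ∞ M)
    {y : EuclideanSpace ℝ (Fin d)} (hy : y ∈ e.target) (m k i j : Fin d) :
    fderiv ℝ (chartChristoffel e) y (basisVec m) (basisVec i) (basisVec j) k =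
      christoffelDeriv e y m k i j := by
  have h := fderiv_bilin_apply (((contDiffOn_chartChristoffel he).contDiffAt
    (e.open_target.mem_nhds hy)).differentiableAt (by simp))
    (EuclideanSpace.proj k : EuclideanSpace ℝ (Fin d) →L[ℝ] ℝ)
    (basisVec m) (basisVec i) (basisVec j)
  refine h.trans ?_
  rw [christoffelDeriv]
  congr 2
  funext z
  exact chartChristoffel_basisVec e z i j k

/-- The metric and the Christoffel symbols in local coordinates satisfy the Koszul formula. -/
theorem isLeviCivitaOn_chart (he : e ∈ IsManifold.maximalAtlas (𝓡 d) ∞ M) :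
    IsLeviCivitaOn (chartMetric e) (chartChristoffel e) e.target where
  isOpen := e.open_target
  contDiffOn_metric := contDiffOn_chartMetric he
  contDiffOn_christoffel := contDiffOn_chartChristoffel he
  symm := fun x _ a b => chartMetric_symm e x a b
  pos := fun x hx a ha => chartMetric_pos he hx ha
  koszul := fun x hx a b c => by
    have h := trilinear_eq_sum (f := fun a b c => 2 * chartMetric e x (chartChristoffel e x a b) c -
      (fderiv ℝ (chartMetric e) x a b c + fderiv ℝ (chartMetric e) x b a c -
        fderiv ℝ (chartMetric e) x c a b))
      (fun v w => by constructor <;> intros <;> simp <;> ring)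
      (fun v w => by constructor <;> intros <;> simp <;> ring)
      (fun v w => by constructor <;> intros <;> simp <;> ring) a b c
    simp only [chartMetric_christoffel_basisVec he hx, fderiv_chartMetric_basisVec he hx, sub_self,
      zero_mul, Finset.sum_const_zero] at h
    exact sub_eq_zero.1 h

lemma curvature_basisVec (he : e ∈ IsManifold.maximalAtlas (𝓡 d) ∞ M)
    {y : EuclideanSpace ℝ (Fin d)} (hy : y ∈ e.target) (l i j k : Fin d) :
    curvature (chartChristoffel e) y (basisVec i) (basisVec j) (basisVec k) l =
      curvatureCoeff e y l i j k := by
  have h : ∀ i (w : EuclideanSpace ℝ (Fin d)), chartChristoffel e y (basisVec i) w l =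
      ∑ m, christoffel e y l i m * w m := by
    intro i w
    rw [chartChristoffel_apply]
    rw [Finset.sum_eq_single i (fun a _ ha => by simp [basisVec, ha]) (by simp)]
    simp [basisVec]
  simp only [curvature, curvatureCoeff, PiLp.sub_apply, PiLp.add_apply, h,
    fderiv_chartChristoffel_basisVec he hy, chartChristoffel_basisVec, Finset.sum_sub_distrib]
  ring

lemma curvatureVec_eq (he : e ∈ IsManifold.maximalAtlas (𝓡 d) ∞ M)
    {y : EuclideanSpace ℝ (Fin d)} (hy : y ∈ e.target) (u v w : EuclideanSpace ℝ (Fin d)) :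
    curvatureVec e y u v w = curvature (chartChristoffel e) y u v w := by
  ext l
  have h := trilinear_eq_sum (f := fun u v w => curvature (chartChristoffel e) y u v w l)
      (fun v w => by constructor <;> intros <;> simp [curvature] <;> ring)
      (fun v w => by constructor <;> intros <;> simp [curvature] <;> ring)
      (fun v w => by constructor <;> intros <;> simp [curvature] <;> ring) u v w
  rw [h]
  simp only [curvature_basisVec he hy, curvatureVec]

/-- Constant sectional curvature in terms of the curvature tensor. -/
theorem HasConstantSectionalCurvature.inner_curvature {κ : ℝ}
    (hκ : HasConstantSectionalCurvature d M κ) (he : e ∈ IsManifold.maximalAtlas (𝓡 d) ∞ M)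
    {y : EuclideanSpace ℝ (Fin d)} (hy : y ∈ e.target) (u v : EuclideanSpace ℝ (Fin d)) :
    chartMetric e y (curvature (chartChristoffel e) y u v v) u =
      κ * (chartMetric e y u u * chartMetric e y v v - chartMetric e y u v ^ 2) := by
  by_cases hli : LinearIndependent ℝ ![u, v]
  · have h := hκ e he y hy u v hli
    simp only [sectionalCurvature, ← chartMetric_apply, curvatureVec_eq he hy] at h
    have hv : v ≠ 0 := hli.ne_zero 1
    -- The squared length of this nonzero vector is `⟨v, v⟩` times the Gram determinant of `u` and
    -- `v`. Hence the denominator of the sectional curvature is positive.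
    have hw : chartMetric e y v v • u - chartMetric e y u v • v ≠ 0 := by
      intro h0
      have := (LinearIndependent.pair_iff.1 hli (chartMetric e y v v) (-chartMetric e y u v) (by
        rw [neg_smul, ← sub_eq_add_neg, h0])).1
      exact (chartMetric_pos he hy hv).ne' this
    have h1 := chartMetric_pos he hy hw
    have h2 := chartMetric_pos he hy hv
    simp only [map_sub, map_smul, sub_apply, smul_apply, smul_eq_mul,
      chartMetric_symm e y v u] at h1
    have h3 : 0 < chartMetric e y v v *
        (chartMetric e y u u * chartMetric e y v v - chartMetric e y u v ^ 2) := by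
      refine h1.trans_eq ?_
      ring
    have h4 := pos_of_mul_pos_right h3 h2.le
    rw [← h, div_mul_cancel₀ _ h4.ne']
  -- For dependent vectors `hκ` says nothing, but both sides vanish: the left by antisymmetry of the
  -- curvature, the right as a Gram determinant.
  · by_cases hv : v = 0
    · simp [hv, curvature]
    · rw [LinearIndependent.pair_symm_iff, LinearIndependent.pair_iff' hv] at hli
      push Not at hli
      obtain ⟨a, rfl⟩ := hli
      have : curvature (chartChristoffel e) y (a • v) v v = 0 := by
        simp [curvature]
      rw [this]
      simp
      right; ring

end Charts

/-! ### Change of coordinates for the Christoffel tensor -/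

section Transformation

variable {E : Type*} [NormedAddCommGroup E] [NormedSpace ℝ E]

/-- The transformation law of the Christoffel symbols. -/
theorem IsLeviCivitaOn.christoffel_pullback {G G' : E → E →L[ℝ] E →L[ℝ] ℝ}
    {Γ Γ' : E → E →L[ℝ] E →L[ℝ] E} {U U' : Set E} (L : IsLeviCivitaOn G Γ U)
    (L' : IsLeviCivitaOn G' Γ' U') {φ : E → E} {y : E} (hy : y ∈ U) (hφy : φ y ∈ U')
    (hφ : ContDiffAt ℝ ∞ φ y) (hsurj : Function.Surjective (fderiv ℝ φ y))
    (hG : ∀ᶠ z in 𝓝 y, ∀ a b, G z a b = G' (φ z) (fderiv ℝ φ z a) (fderiv ℝ φ z b)) (a b : E) :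
    fderiv ℝ φ y (Γ y a b) =
      Γ' (φ y) (fderiv ℝ φ y a) (fderiv ℝ φ y b) + fderiv ℝ (fderiv ℝ φ) y a b := by
  have hφd : HasFDerivAt φ (fderiv ℝ φ y) y := (hφ.differentiableAt (by simp)).hasFDerivAt
  have hφ2 : HasFDerivAt (fderiv ℝ φ) (fderiv ℝ (fderiv ℝ φ) y) y :=
    ((hφ.fderiv_right (m := ∞) (by simp)).differentiableAt (by simp)).hasFDerivAt
  have hsym : ∀ a b, fderiv ℝ (fderiv ℝ φ) y a b = fderiv ℝ (fderiv ℝ φ) y b a :=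
    fun a b => (hφ.isSymmSndFDerivAt (by
      simp only [minSmoothness_of_isRCLikeNormedField]
      exact ENat.LEInfty.out)).eq a b
  -- Differentiating the isometry identity `hG` adds two terms with second derivatives of `φ`.
  have hD : ∀ a b c, fderiv ℝ G y a b c =
      fderiv ℝ G' (φ y) (fderiv ℝ φ y a) (fderiv ℝ φ y b) (fderiv ℝ φ y c) +
      G' (φ y) (fderiv ℝ (fderiv ℝ φ) y a b) (fderiv ℝ φ y c) +
      G' (φ y) (fderiv ℝ φ y b) (fderiv ℝ (fderiv ℝ φ) y a c) := by
    intro a b c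
    have hl : HasDerivAt (fun s : ℝ => y + s • a) a 0 := by
      simpa using ((hasDerivAt_id (0 : ℝ)).smul_const a).const_add y
    have hl0 : y = y + (0 : ℝ) • a := by simp
    have h1 : HasDerivAt (fun s : ℝ => G (y + s • a) b c) (fderiv ℝ G y a b c) 0 := by
      have h := (((hl0 ▸ L.hasFDerivAt_metric hy :
        HasFDerivAt G (fderiv ℝ G y) (y + (0 : ℝ) • a)).comp_hasDerivAt 0 hl).clm_apply
          (hasDerivAt_const 0 b)).clm_apply (hasDerivAt_const 0 c)
      simpa using h
    have hf : HasDerivAt (fun s : ℝ => φ (y + s • a)) (fderiv ℝ φ y a) 0 :=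
      HasFDerivAt.comp_hasDerivAt (l := φ) 0 (by simpa using hφd) hl
    have hX : ∀ b, HasDerivAt (fun s : ℝ => fderiv ℝ φ (y + s • a) b)
        (fderiv ℝ (fderiv ℝ φ) y a b) 0 := by
      intro b
      have h := (HasFDerivAt.comp_hasDerivAt (l := fderiv ℝ φ) 0
        (by simpa using hφ2) hl).clm_apply (hasDerivAt_const 0 b)
      simpa using h
    have h2 := L'.hasDerivAt_inner hf (hX b) (hX c) (by simpa using hφy)
    have h3 : (fun s : ℝ => G (y + s • a) b c) =ᶠ[𝓝 0] fun s : ℝ =>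
        G' (φ (y + s • a)) (fderiv ℝ φ (y + s • a) b) (fderiv ℝ φ (y + s • a) c) := by
      have hc : Tendsto (fun s : ℝ => y + s • a) (𝓝 0) (𝓝 y) := by
        simpa using hl.continuousAt.tendsto
      filter_upwards [hc.eventually hG] with s hs using hs b c
    have h4 := h1.unique (h2.congr_of_eventuallyEq h3)
    rw [h4, L'.fderiv_metric hφy]
    simp only [zero_smul, add_zero, map_add, add_apply]
    ring
  refine L'.eq_of_metric_eq hφy fun c' => ?_
  obtain ⟨c, rfl⟩ := hsurj c'
  have k1 := L.koszul y hy a b c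
  have k2 := L'.koszul (φ y) hφy (fderiv ℝ φ y a) (fderiv ℝ φ y b) (fderiv ℝ φ y c)
  rw [hD, hD, hD, hG.self_of_nhds] at k1
  rw [map_add, add_apply]
  -- By symmetry of the second derivative, four of the six extra terms in the Koszul formula cancel
  -- and the remaining two are equal.
  rw [L'.symm _ hφy (fderiv ℝ φ y b) (fderiv ℝ (fderiv ℝ φ) y a c),
    L'.symm _ hφy (fderiv ℝ φ y a) (fderiv ℝ (fderiv ℝ φ) y b c),
    L'.symm _ hφy (fderiv ℝ φ y a) (fderiv ℝ (fderiv ℝ φ) y c b),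
    hsym c a, hsym c b, hsym b a] at k1
  linarith

end Transformation

/-! ### The geodesic equation in charts -/

section Geodesics

variable {d : ℕ} {M : Type*} [TopologicalSpace M] [ChartedSpace (EuclideanSpace ℝ (Fin d)) M]

lemma contDiffAt_transition {e e' : OpenPartialHomeomorph M (EuclideanSpace ℝ (Fin d))}
    (he : e ∈ IsManifold.maximalAtlas (𝓡 d) ∞ M) (he' : e' ∈ IsManifold.maximalAtlas (𝓡 d) ∞ M)
    {y : EuclideanSpace ℝ (Fin d)} (hy : y ∈ e.target) (hy' : e.symm y ∈ e'.source) :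
    ContDiffAt ℝ ∞ (e' ∘ e.symm) y := by
  rw [← contMDiffAt_iff_contDiffAt]
  exact (contMDiffAt_of_mem_maximalAtlas he' hy').comp y (contMDiffAt_symm_of_mem_maximalAtlas he hy)

lemma mfderiv_symm_transition {e e' : OpenPartialHomeomorph M (EuclideanSpace ℝ (Fin d))}
    (he : e ∈ IsManifold.maximalAtlas (𝓡 d) ∞ M) (he' : e' ∈ IsManifold.maximalAtlas (𝓡 d) ∞ M)
    {y : EuclideanSpace ℝ (Fin d)} (hy : y ∈ e.target) (hy' : e.symm y ∈ e'.source)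
    (u : EuclideanSpace ℝ (Fin d)) :
    (mfderiv (𝓡 d) (𝓡 d) e.symm y u : EuclideanSpace ℝ (Fin d)) =
      mfderiv (𝓡 d) (𝓡 d) e'.symm (e' (e.symm y)) (fderiv ℝ (e' ∘ e.symm) y u) := by
  have hφ := contDiffAt_transition he he' hy hy'
  have h1 : e.symm =ᶠ[𝓝 y] e'.symm ∘ (e' ∘ e.symm) := by
    have : ∀ᶠ z in 𝓝 y, e.symm z ∈ e'.source :=
      (e.continuousAt_symm hy).eventually_mem (e'.open_source.mem_nhds hy')
    filter_upwards [this] with z hz using (e'.left_inv hz).symm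
  have h2 : MDifferentiableAt (𝓡 d) (𝓡 d) e'.symm ((e' ∘ e.symm) y) :=
    (contMDiffAt_symm_of_mem_maximalAtlas he' (e'.map_source hy')).mdifferentiableAt (by simp)
  have h3 : MDifferentiableAt (𝓡 d) (𝓡 d) (e' ∘ e.symm) y :=
    (hφ.differentiableAt (by simp)).mdifferentiableAt
  have h4 : (mfderiv (𝓡 d) (𝓡 d) e.symm y : EuclideanSpace ℝ (Fin d) →L[ℝ] EuclideanSpace ℝ (Fin d))
      = mfderiv (𝓡 d) (𝓡 d) (e'.symm ∘ (e' ∘ e.symm)) y := h1.mfderiv_eq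
  have h5 := mfderiv_comp y h2 h3
  have h6 := DFunLike.congr_fun h4 u
  refine h6.trans ((DFunLike.congr_fun h5 u).trans ?_)
  have h7 : mfderiv (𝓡 d) (𝓡 d) (e' ∘ e.symm) y = fderiv ℝ (e' ∘ e.symm) y := mfderiv_eq_fderiv
  rw [h7]
  rfl

lemma fderiv_transition_surjective {e e' : OpenPartialHomeomorph M (EuclideanSpace ℝ (Fin d))}
    (he : e ∈ IsManifold.maximalAtlas (𝓡 d) ∞ M) (he' : e' ∈ IsManifold.maximalAtlas (𝓡 d) ∞ M)
    {y : EuclideanSpace ℝ (Fin d)} (hy : y ∈ e.target) (hy' : e.symm y ∈ e'.source) :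
    Function.Surjective (fderiv ℝ (e' ∘ e.symm) y) := by
  refine (LinearMap.injective_iff_surjective
    (f := (fderiv ℝ (e' ∘ e.symm) y : EuclideanSpace ℝ (Fin d) →ₗ[ℝ] _))).1 fun u v huv => ?_
  apply mfderiv_symm_injective he hy
  have h1 := mfderiv_symm_transition he he' hy hy' u
  have h2 := mfderiv_symm_transition he he' hy hy' v
  have huv' : fderiv ℝ (e' ∘ e.symm) y u = fderiv ℝ (e' ∘ e.symm) y v := huv
  rw [huv'] at h1
  exact h1.trans h2.symm

variable [RiemannianBundle (fun x : M => TangentSpace (𝓡 d) x)]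

/-- The Riemannian inner product at `x` of tangent vectors given as elements of the model space. -/
def innerAt (x : M) (u v : EuclideanSpace ℝ (Fin d)) : ℝ :=
  @inner ℝ (TangentSpace (𝓡 d) x) _ u v

/-- With vectors in the fixed model space, the base point can be rewritten freely; `TangentSpace`
depends on it. -/
lemma chartMetric_eq_innerAt (e : OpenPartialHomeomorph M (EuclideanSpace ℝ (Fin d)))
    (y u v : EuclideanSpace ℝ (Fin d)) :
    chartMetric e y u v = innerAt (e.symm y) (mfderiv (𝓡 d) (𝓡 d) e.symm y u)
      (mfderiv (𝓡 d) (𝓡 d) e.symm y v) :=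
  chartMetric_eq_inner e y u v

lemma chartMetric_transition {e e' : OpenPartialHomeomorph M (EuclideanSpace ℝ (Fin d))}
    (he : e ∈ IsManifold.maximalAtlas (𝓡 d) ∞ M) (he' : e' ∈ IsManifold.maximalAtlas (𝓡 d) ∞ M)
    {y : EuclideanSpace ℝ (Fin d)} (hy : y ∈ e.target) (hy' : e.symm y ∈ e'.source)
    (u v : EuclideanSpace ℝ (Fin d)) :
    chartMetric e y u v = chartMetric e' (e' (e.symm y)) (fderiv ℝ (e' ∘ e.symm) y u)
      (fderiv ℝ (e' ∘ e.symm) y v) := by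
  rw [chartMetric_eq_innerAt, chartMetric_eq_innerAt, e'.left_inv hy']
  congr 1
  · exact mfderiv_symm_transition he he' hy hy' u
  · exact mfderiv_symm_transition he he' hy hy' v

/-- The geodesic equation for the curve `c` in the local coordinates `e`. -/
def GeodesicEquation (e : OpenPartialHomeomorph M (EuclideanSpace ℝ (Fin d)))
    (c : ℝ → EuclideanSpace ℝ (Fin d)) (t : ℝ) : Prop :=
  deriv (deriv c) t + chartChristoffel e (c t) (deriv c t) (deriv c t) = 0

lemma deriv_coord {c : ℝ → EuclideanSpace ℝ (Fin d)} {t : ℝ} (hc : DifferentiableAt ℝ c t)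
    (k : Fin d) : deriv (fun τ => c τ k) t = deriv c t k :=
  ((EuclideanSpace.proj k : EuclideanSpace ℝ (Fin d) →L[ℝ] ℝ).hasFDerivAt.comp_hasDerivAt t
    hc.hasDerivAt).deriv

lemma ContDiffAt.eventually_differentiableAt {F : Type*} [NormedAddCommGroup F] [NormedSpace ℝ F]
    {c : ℝ → F} {t : ℝ} (hc : ContDiffAt ℝ ∞ c t) : ∀ᶠ τ in 𝓝 t, DifferentiableAt ℝ c τ := by
  have h := (hc.of_le (m := 1) (by simp)).eventually (by simp)
  exact h.mono fun τ hτ => hτ.differentiableAt (by simp)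

lemma ContDiffAt.deriv_smooth {F : Type*} [NormedAddCommGroup F] [NormedSpace ℝ F]
    {c : ℝ → F} {t : ℝ} (hc : ContDiffAt ℝ ∞ c t) : ContDiffAt ℝ ∞ (deriv c) t :=
  (hc.fderiv_right (m := ∞) (by simp)).clm_apply contDiffAt_const

lemma geodesicEquation_iff (e : OpenPartialHomeomorph M (EuclideanSpace ℝ (Fin d)))
    {c : ℝ → EuclideanSpace ℝ (Fin d)} {t : ℝ} (hc : ContDiffAt ℝ ∞ c t) :
    GeodesicEquation e c t ↔ ∀ k : Fin d, deriv (deriv fun τ => c τ k) t +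
      ∑ i, ∑ j, christoffel e (c t) k i j *
        deriv (fun τ => c τ i) t * deriv (fun τ => c τ j) t = 0 := by
  have hd := hc.differentiableAt (by simp)
  have h1 : ∀ k, deriv (deriv fun τ => c τ k) t = deriv (deriv c) t k := fun k => by
    have : (deriv fun τ => c τ k) =ᶠ[𝓝 t] fun τ => deriv c τ k :=
      (ContDiffAt.eventually_differentiableAt hc).mono fun τ hτ => deriv_coord hτ k
    rw [this.deriv_eq, deriv_coord ((ContDiffAt.deriv_smooth hc).differentiableAt (by simp))]
  simp only [h1, deriv_coord hd, ← chartChristoffel_apply]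
  constructor
  · intro h k
    exact congrArg (fun v : EuclideanSpace ℝ (Fin d) => v k) h
  · intro h
    exact PiLp.ext h

lemma IsGeodesicOn.contDiffAt {γ : ℝ → M} {s : Set ℝ} (h : IsGeodesicOn d γ s)
    {e : OpenPartialHomeomorph M (EuclideanSpace ℝ (Fin d))}
    (he : e ∈ IsManifold.maximalAtlas (𝓡 d) ∞ M) {t : ℝ} (ht : t ∈ s) (hte : γ t ∈ e.source) :
    ContDiffAt ℝ ∞ (fun τ => e (γ τ)) t := by
  rw [← contMDiffAt_iff_contDiffAt]
  exact (contMDiffAt_of_mem_maximalAtlas he hte).comp t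
    (h.contMDiffOn.contMDiffAt (h.isOpen.mem_nhds ht))

lemma IsGeodesicOn.geodesicEquation {γ : ℝ → M} {s : Set ℝ} (h : IsGeodesicOn d γ s)
    {e : OpenPartialHomeomorph M (EuclideanSpace ℝ (Fin d))}
    (he : e ∈ IsManifold.maximalAtlas (𝓡 d) ∞ M) {t : ℝ} (ht : t ∈ s) (hte : γ t ∈ e.source) :
    GeodesicEquation e (fun τ => e (γ τ)) t :=
  (geodesicEquation_iff e (h.contDiffAt he ht hte)).2 (h.equation e he t ht hte)

variable [IsManifold (𝓡 d) ∞ M] [IsContMDiffRiemannianBundle (𝓡 d) ∞ (EuclideanSpace ℝ (Fin d))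
      (fun x : M => TangentSpace (𝓡 d) x)]

/-- The geodesic equation does not depend on the local coordinates. -/
lemma GeodesicEquation.change {e e' : OpenPartialHomeomorph M (EuclideanSpace ℝ (Fin d))}
    (he : e ∈ IsManifold.maximalAtlas (𝓡 d) ∞ M) (he' : e' ∈ IsManifold.maximalAtlas (𝓡 d) ∞ M)
    {c : ℝ → EuclideanSpace ℝ (Fin d)} {t : ℝ} (hc : ContDiffAt ℝ ∞ c t) (hy : c t ∈ e.target)
    (hy' : e.symm (c t) ∈ e'.source) (h : GeodesicEquation e c t) :
    GeodesicEquation e' (fun τ => e' (e.symm (c τ))) t := by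
  have hφ := contDiffAt_transition he he' hy hy'
  set φ := e' ∘ e.symm with hφdef
  have hev : ∀ᶠ z in 𝓝 (c t), z ∈ e.target ∧ e.symm z ∈ e'.source :=
    (e.open_target.eventually_mem hy).and
      ((e.continuousAt_symm hy).eventually_mem (e'.open_source.mem_nhds hy'))
  have hΓ := (isLeviCivitaOn_chart he).christoffel_pullback (isLeviCivitaOn_chart he') hy
    (e'.map_source hy') hφ (fderiv_transition_surjective he he' hy hy')
    (hev.mono fun z hz a b => chartMetric_transition he he' hz.1 hz.2 a b)
    (deriv c t) (deriv c t)
  have hφ2 : HasFDerivAt (fderiv ℝ φ) (fderiv ℝ (fderiv ℝ φ) (c t)) (c t) :=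
    ((hφ.fderiv_right (m := ∞) (by simp)).differentiableAt (by simp)).hasFDerivAt
  have hd : ∀ᶠ τ in 𝓝 t, deriv (fun τ => φ (c τ)) τ = fderiv ℝ φ (c τ) (deriv c τ) := by
    filter_upwards [ContDiffAt.eventually_differentiableAt hc,
      hc.continuousAt.eventually hev] with τ h1 h2
    have h3 := (contDiffAt_transition he he' h2.1 h2.2).differentiableAt (by simp)
    exact (h3.hasFDerivAt.comp_hasDerivAt τ h1.hasDerivAt).deriv
  have hdd : deriv (deriv fun τ => φ (c τ)) t =
      fderiv ℝ (fderiv ℝ φ) (c t) (deriv c t) (deriv c t) +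
        fderiv ℝ φ (c t) (deriv (deriv c) t) := by
    rw [Filter.EventuallyEq.deriv_eq hd]
    exact ((hφ2.comp_hasDerivAt t (hc.differentiableAt (by simp)).hasDerivAt).clm_apply
      ((ContDiffAt.deriv_smooth hc).differentiableAt (by simp)).hasDerivAt).deriv
  have h2 : deriv (deriv c) t = -chartChristoffel e (c t) (deriv c t) (deriv c t) :=
    eq_neg_of_add_eq_zero_left h
  change deriv (deriv fun τ => φ (c τ)) t + chartChristoffel e' (φ (c t))
    (deriv (fun τ => φ (c τ)) t) (deriv (fun τ => φ (c τ)) t) = 0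
  -- The second derivative of `φ` from the chain rule cancels the one from the transformation law.
  rw [hdd, hd.self_of_nhds, h2, map_neg, hΓ]
  abel

/-- A curve which satisfies the geodesic equation in one chart is a geodesic. -/
theorem isGeodesicOn_of_chart {e : OpenPartialHomeomorph M (EuclideanSpace ℝ (Fin d))}
    (he : e ∈ IsManifold.maximalAtlas (𝓡 d) ∞ M) {c : ℝ → EuclideanSpace ℝ (Fin d)} {s : Set ℝ}
    (hs : IsOpen s) (hs' : s.OrdConnected) (hc : ContDiffOn ℝ ∞ c s) (hmaps : MapsTo c s e.target)
    (h : ∀ t ∈ s, GeodesicEquation e c t) : IsGeodesicOn d (fun t => e.symm (c t)) s where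
  isOpen := hs
  ordConnected := hs'
  contMDiffOn := (contMDiffOn_symm_of_mem_maximalAtlas he).comp hc.contMDiffOn hmaps
  equation := fun e' he' t ht hte' => by
    have hct := hc.contDiffAt (hs.mem_nhds ht)
    have h1 : ContDiffAt ℝ ∞ (fun τ => e' (e.symm (c τ))) t :=
      (contDiffAt_transition he he' (hmaps ht) hte').comp t hct
    exact (geodesicEquation_iff e' h1).1
      (GeodesicEquation.change he he' hct (hmaps ht) hte' (h t ht))

end Geodesics

/-! ### Uniqueness of geodesics and the exponential map -/

section ExponentialMap

variable {d : ℕ} {M : Type*} [TopologicalSpace M] [ChartedSpace (EuclideanSpace ℝ (Fin d)) M]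

lemma velocity_eq_iff {γ : ℝ → M} {t : ℝ} {p : M} {v : EuclideanSpace ℝ (Fin d)} :
    velocity d γ t = ⟨p, v⟩ ↔
      γ t = p ∧ (mfderiv 𝓘(ℝ, ℝ) (𝓡 d) γ t (1 : ℝ) : EuclideanSpace ℝ (Fin d)) = v := by
  constructor
  · intro h
    exact ⟨congrArg TotalSpace.proj h,
      congrArg (fun z : TangentBundle (𝓡 d) M => (z.2 : EuclideanSpace ℝ (Fin d))) h⟩
  · rintro ⟨rfl, rfl⟩
    rfl

lemma deriv_chart_comp {γ : ℝ → M} {t : ℝ} (hγ : MDifferentiableAt 𝓘(ℝ, ℝ) (𝓡 d) γ t)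
    {e : OpenPartialHomeomorph M (EuclideanSpace ℝ (Fin d))}
    (he : e ∈ IsManifold.maximalAtlas (𝓡 d) ∞ M) (hte : γ t ∈ e.source) :
    deriv (fun τ => e (γ τ)) t =
      mfderiv (𝓡 d) (𝓡 d) e (γ t) (mfderiv 𝓘(ℝ, ℝ) (𝓡 d) γ t (1 : ℝ)) := by
  have h := mfderiv_comp t ((contMDiffAt_of_mem_maximalAtlas he hte).mdifferentiableAt (by simp)) hγ
  have h2 : mfderiv 𝓘(ℝ, ℝ) (𝓡 d) (e ∘ γ) t = fderiv ℝ (e ∘ γ) t := mfderiv_eq_fderiv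
  have h3 := DFunLike.congr_fun (h2.symm.trans h) (1 : ℝ)
  rw [← fderiv_apply_one_eq_deriv]
  exact h3

variable [RiemannianBundle (fun x : M => TangentSpace (𝓡 d) x)]

/-- Geodesics may be reparametrized linearly. -/
lemma IsGeodesicOn.comp_mul {γ : ℝ → M} {s : Set ℝ} (h : IsGeodesicOn d γ s) (a : ℝ) :
    IsGeodesicOn d (fun τ => γ (a * τ)) ((fun τ => a * τ) ⁻¹' s) where
  isOpen := h.isOpen.preimage (continuous_const.mul continuous_id)
  ordConnected := by
    rcases le_total 0 a with ha | ha
    · exact h.ordConnected.preimage_mono (monotone_mul_left_of_nonneg ha)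
    · exact h.ordConnected.preimage_anti (antitone_mul_left ha)
  contMDiffOn := h.contMDiffOn.comp (t := s)
    (contMDiff_iff_contDiff.2 (contDiff_const.mul contDiff_id)).contMDiffOn (fun τ hτ => hτ)
  equation := fun e he t ht hte => by
    have hc := h.contDiffAt he (show a * t ∈ s from ht) hte
    have hc' : ContDiffAt ℝ ∞ (fun τ => e (γ (a * τ))) t :=
      ContDiffAt.comp (g := fun τ => e (γ τ)) t hc (contDiffAt_const.mul contDiffAt_id)
    refine (geodesicEquation_iff e hc').1 ?_
    have hg := h.geodesicEquation he (show a * t ∈ s from ht) hte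
    have hd : deriv (fun τ => e (γ (a * τ))) = fun τ => a • deriv (fun σ => e (γ σ)) (a * τ) :=
      funext fun τ => deriv_comp_mul_left a (fun σ => e (γ σ)) τ
    have hdd : deriv (deriv (fun τ => e (γ (a * τ)))) t =
        a • a • deriv (deriv fun σ => e (γ σ)) (a * t) := by
      rw [hd, deriv_fun_const_smul_field]
      congr 1
      exact deriv_comp_mul_left a (deriv fun σ => e (γ σ)) t
    rw [GeodesicEquation, hdd, hd]
    rw [GeodesicEquation] at hg
    rw [eq_neg_of_add_eq_zero_left hg]
    simp

lemma velocity_comp_mul {γ : ℝ → M} {s : Set ℝ} (h : IsGeodesicOn d γ s) (h0 : (0 : ℝ) ∈ s)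
    {p : M} {v : EuclideanSpace ℝ (Fin d)} (hv : velocity d γ 0 = ⟨p, v⟩) (a : ℝ) :
    velocity d (fun τ => γ (a * τ)) 0 = ⟨p, (a • v : EuclideanSpace ℝ (Fin d))⟩ := by
  obtain ⟨hp, hm⟩ := velocity_eq_iff.1 hv
  refine velocity_eq_iff.2 ⟨by simpa using hp, ?_⟩
  have hγ : MDifferentiableAt 𝓘(ℝ, ℝ) (𝓡 d) γ (a * 0) := by
    rw [mul_zero]
    exact (h.contMDiffOn.contMDiffAt (h.isOpen.mem_nhds h0)).mdifferentiableAt (by simp)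
  have hl : HasDerivAt (fun τ : ℝ => a * τ) a 0 := by simpa using (hasDerivAt_id (0 : ℝ)).const_mul a
  have h1 := mfderiv_comp (0 : ℝ) hγ hl.differentiableAt.mdifferentiableAt
  have h2 := DFunLike.congr_fun h1 (1 : ℝ)
  have h3 : mfderiv 𝓘(ℝ, ℝ) 𝓘(ℝ, ℝ) (fun τ : ℝ => a * τ) 0 = fderiv ℝ (fun τ : ℝ => a * τ) 0 :=
    mfderiv_eq_fderiv
  let D : ℝ → ℝ →L[ℝ] EuclideanSpace ℝ (Fin d) := fun t => mfderiv 𝓘(ℝ, ℝ) (𝓡 d) γ t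
  have h4 : D (a * 0) (fderiv ℝ (fun τ : ℝ => a * τ) 0 1) = a • v := by
    rw [fderiv_apply_one_eq_deriv, hl.deriv, mul_zero, ← hm]
    change D 0 a = a • D 0 1
    rw [← map_smul]; simp
  refine Eq.trans h2 (Eq.trans ?_ h4)
  rw [← h3]
  rfl

variable [IsManifold (𝓡 d) ∞ M] [IsContMDiffRiemannianBundle (𝓡 d) ∞ (EuclideanSpace ℝ (Fin d))
      (fun x : M => TangentSpace (𝓡 d) x)]

/-- The pair `(c, c')` solves the autonomous first-order system of the vector field `F`, which is
smooth at the initial point and hence Lipschitz near it. -/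
lemma geodesicEquation_unique {e : OpenPartialHomeomorph M (EuclideanSpace ℝ (Fin d))}
    (he : e ∈ IsManifold.maximalAtlas (𝓡 d) ∞ M) {c₁ c₂ : ℝ → EuclideanSpace ℝ (Fin d)} {t : ℝ}
    (hc₁ : ContDiffAt ℝ ∞ c₁ t) (hc₂ : ContDiffAt ℝ ∞ c₂ t) (ht : c₁ t ∈ e.target)
    (h₁ : ∀ᶠ τ in 𝓝 t, GeodesicEquation e c₁ τ) (h₂ : ∀ᶠ τ in 𝓝 t, GeodesicEquation e c₂ τ)
    (heq : c₁ t = c₂ t) (heq' : deriv c₁ t = deriv c₂ t) : c₁ =ᶠ[𝓝 t] c₂ := by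
  let F : EuclideanSpace ℝ (Fin d) × EuclideanSpace ℝ (Fin d) →
      EuclideanSpace ℝ (Fin d) × EuclideanSpace ℝ (Fin d) :=
    fun z => (z.2, -chartChristoffel e z.1 z.2 z.2)
  have hF : ContDiffAt ℝ ∞ F (c₁ t, deriv c₁ t) := by
    have h1 : ContDiffAt ℝ ∞ (fun z : EuclideanSpace ℝ (Fin d) × EuclideanSpace ℝ (Fin d) =>
        chartChristoffel e z.1) (c₁ t, deriv c₁ t) :=
      ContDiffAt.comp (g := chartChristoffel e) (f := Prod.fst) (c₁ t, deriv c₁ t)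
        ((contDiffOn_chartChristoffel he).contDiffAt (e.open_target.mem_nhds ht)) contDiffAt_fst
    exact contDiffAt_snd.prodMk ((h1.clm_apply contDiffAt_snd).clm_apply contDiffAt_snd).neg
  obtain ⟨K, S, hS, hK⟩ := (hF.of_le (m := 1) (by simp)).exists_lipschitzOnWith
  have key : ∀ c : ℝ → EuclideanSpace ℝ (Fin d), ContDiffAt ℝ ∞ c t →
      (∀ᶠ τ in 𝓝 t, GeodesicEquation e c τ) → S ∈ 𝓝 (c t, deriv c t) →
      ∀ᶠ τ in 𝓝 t, HasDerivAt (fun τ => (c τ, deriv c τ)) (F (c τ, deriv c τ)) τ ∧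
        (c τ, deriv c τ) ∈ S := by
    intro c hc hg hSc
    have hc' := ContDiffAt.deriv_smooth hc
    filter_upwards [ContDiffAt.eventually_differentiableAt hc,
      ContDiffAt.eventually_differentiableAt hc', hg,
      (hc.continuousAt.prodMk hc'.continuousAt).eventually_mem hSc] with τ a1 a2 a3 a4
    refine ⟨?_, a4⟩
    have := a1.hasDerivAt.prodMk a2.hasDerivAt
    rwa [eq_neg_of_add_eq_zero_left a3] at this
  have hu := ODE_solution_unique_of_eventually (v := fun _ => F) (s := fun _ => S) (K := K)
    (Eventually.of_forall fun _ => hK) (key c₁ hc₁ h₁ hS) (key c₂ hc₂ h₂ (by rwa [heq, heq'] at hS))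
    (by simp [heq, heq'])
  exact hu.mono fun τ hτ => congrArg Prod.fst hτ

lemma IsGeodesicOn.eventuallyEq {γ₁ γ₂ : ℝ → M} {s₁ s₂ : Set ℝ} (h₁ : IsGeodesicOn d γ₁ s₁)
    (h₂ : IsGeodesicOn d γ₂ s₂) {t : ℝ} (ht₁ : t ∈ s₁) (ht₂ : t ∈ s₂) (heq : γ₁ t = γ₂ t)
    {e : OpenPartialHomeomorph M (EuclideanSpace ℝ (Fin d))}
    (he : e ∈ IsManifold.maximalAtlas (𝓡 d) ∞ M) (hte : γ₁ t ∈ e.source)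
    (heq' : deriv (fun τ => e (γ₁ τ)) t = deriv (fun τ => e (γ₂ τ)) t) : γ₁ =ᶠ[𝓝 t] γ₂ := by
  have hte₂ : γ₂ t ∈ e.source := heq ▸ hte
  have hev₁ : ∀ᶠ τ in 𝓝 t, τ ∈ s₁ ∧ γ₁ τ ∈ e.source := (h₁.isOpen.eventually_mem ht₁).and
    ((h₁.contMDiffOn.continuousOn.continuousAt (h₁.isOpen.mem_nhds ht₁)).eventually_mem
      (e.open_source.mem_nhds hte))
  have hev₂ : ∀ᶠ τ in 𝓝 t, τ ∈ s₂ ∧ γ₂ τ ∈ e.source := (h₂.isOpen.eventually_mem ht₂).and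
    ((h₂.contMDiffOn.continuousOn.continuousAt (h₂.isOpen.mem_nhds ht₂)).eventually_mem
      (e.open_source.mem_nhds hte₂))
  have hu := geodesicEquation_unique he (h₁.contDiffAt he ht₁ hte) (h₂.contDiffAt he ht₂ hte₂)
    (e.map_source hte) (hev₁.mono fun τ hτ => h₁.geodesicEquation he hτ.1 hτ.2)
    (hev₂.mono fun τ hτ => h₂.geodesicEquation he hτ.1 hτ.2) (congrArg e heq) heq'
  filter_upwards [hu, hev₁, hev₂] with τ a1 a2 a3 using e.injOn a2.2 a3.2 a1

/-- Uniqueness of geodesics. -/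
theorem IsGeodesicOn.eqOn [T2Space M] {γ₁ γ₂ : ℝ → M} {s₁ s₂ : Set ℝ} (h₁ : IsGeodesicOn d γ₁ s₁)
    (h₂ : IsGeodesicOn d γ₂ s₂) {t : ℝ} (ht₁ : t ∈ s₁) (ht₂ : t ∈ s₂)
    (hv : velocity d γ₁ t = velocity d γ₂ t) : EqOn γ₁ γ₂ (s₁ ∩ s₂) := by
  have hpre : IsPreconnected (s₁ ∩ s₂) := (h₁.ordConnected.inter h₂.ordConnected).isPreconnected
  have hC₁ : ∀ τ ∈ s₁, ContinuousAt γ₁ τ := fun τ hτ =>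
    h₁.contMDiffOn.continuousOn.continuousAt (h₁.isOpen.mem_nhds hτ)
  have hC₂ : ∀ τ ∈ s₂, ContinuousAt γ₂ τ := fun τ hτ =>
    h₂.contMDiffOn.continuousOn.continuousAt (h₂.isOpen.mem_nhds hτ)
  set u : Set ℝ := {τ | γ₁ =ᶠ[𝓝 τ] γ₂} with hu
  have hopen : IsOpen u := isOpen_iff_mem_nhds.2 fun τ hτ => hτ.eventually_nhds
  have hsub : s₁ ∩ s₂ ⊆ u := by
    -- The set where the geodesics agree locally is open. It is relatively closed because, at a
    -- limit point, positions agree as `M` is Hausdorff, and chart velocities agree by continuity;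
    -- local uniqueness then applies there.
    refine hpre.subset_of_closure_inter_subset hopen ⟨t, ⟨ht₁, ht₂⟩, ?_⟩ ?_
    · obtain ⟨hp, hm⟩ := velocity_eq_iff.1 hv
      have he := IsManifold.chart_mem_maximalAtlas (I := 𝓡 d) (n := ∞) (γ₁ t)
      have hsrc := mem_chart_source (EuclideanSpace ℝ (Fin d)) (γ₁ t)
      refine h₁.eventuallyEq h₂ ht₁ ht₂ hp he hsrc ?_
      rw [deriv_chart_comp ((h₁.contMDiffOn.contMDiffAt
          (h₁.isOpen.mem_nhds ht₁)).mdifferentiableAt (by simp)) he hsrc,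
        deriv_chart_comp ((h₂.contMDiffOn.contMDiffAt
          (h₂.isOpen.mem_nhds ht₂)).mdifferentiableAt (by simp)) he (hp ▸ hsrc)]
      let D : M → EuclideanSpace ℝ (Fin d) →L[ℝ] EuclideanSpace ℝ (Fin d) :=
        fun x => mfderiv (𝓡 d) (𝓡 d) (chartAt (EuclideanSpace ℝ (Fin d)) (γ₁ t)) x
      change D (γ₁ t) _ = D (γ₂ t) _
      rw [hp]
      exact congrArg (D (γ₂ t)) hm
    · rintro τ ⟨hcl, hτ₁, hτ₂⟩
      have hfreq : ∃ᶠ z in 𝓝 τ, γ₁ =ᶠ[𝓝 z] γ₂ := mem_closure_iff_frequently.1 hcl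
      have heq : γ₁ τ = γ₂ τ := by
        by_contra hne
        have : ∀ᶠ z in 𝓝 τ, γ₁ z ≠ γ₂ z := by
          obtain ⟨U, V, hU, hV, hxU, hxV, hUV⟩ := t2_separation hne
          filter_upwards [(hC₁ τ hτ₁).eventually_mem (hU.mem_nhds hxU),
            (hC₂ τ hτ₂).eventually_mem (hV.mem_nhds hxV)] with z a1 a2 h
          exact disjoint_left.1 hUV a1 (h ▸ a2)
        obtain ⟨z, hz1, hz2⟩ := (hfreq.and_eventually this).exists
        exact hz2 hz1.self_of_nhds
      have he := IsManifold.chart_mem_maximalAtlas (I := 𝓡 d) (n := ∞) (γ₁ τ)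
      have hsrc := mem_chart_source (EuclideanSpace ℝ (Fin d)) (γ₁ τ)
      refine h₁.eventuallyEq h₂ hτ₁ hτ₂ heq he hsrc ?_
      have hd₁ := (ContDiffAt.deriv_smooth (h₁.contDiffAt he hτ₁ hsrc)).continuousAt
      have hd₂ := (ContDiffAt.deriv_smooth (h₂.contDiffAt he hτ₂ (heq ▸ hsrc))).continuousAt
      by_contra hne
      obtain ⟨U, V, hU, hV, hxU, hxV, hUV⟩ := t2_separation hne
      have := (hd₁.eventually_mem (hU.mem_nhds hxU)).and (hd₂.eventually_mem (hV.mem_nhds hxV))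
      obtain ⟨z, hz, a1, a2⟩ := (hfreq.and_eventually this).exists
      refine disjoint_left.1 hUV a1 ?_
      have hzd : (fun σ => chartAt (EuclideanSpace ℝ (Fin d)) (γ₁ τ) (γ₁ σ)) =ᶠ[𝓝 z]
          fun σ => chartAt (EuclideanSpace ℝ (Fin d)) (γ₁ τ) (γ₂ σ) :=
        hz.mono fun σ hσ => congrArg _ hσ
      rw [hzd.deriv_eq]
      exact a2
  exact fun τ hτ => (hsub hτ).self_of_nhds

/-- The exponential map in terms of geodesics. -/
lemma IsGeodesicOn.expMap_eq [T2Space M] {γ : ℝ → M} {s : Set ℝ} (h : IsGeodesicOn d γ s)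
    (h0 : (0 : ℝ) ∈ s) {p : M} {v : EuclideanSpace ℝ (Fin d)} (hv : velocity d γ 0 = ⟨p, v⟩)
    {t : ℝ} (ht : t ∈ s) : expMap d p (t • v : EuclideanSpace ℝ (Fin d)) = γ t := by
  have hsub : Icc (0 : ℝ) 1 ⊆ (fun τ => t * τ) ⁻¹' s := by
    intro τ hτ
    have : t * τ ∈ uIcc 0 t := by
      rcases le_total 0 t with h1 | h1
      · rw [uIcc_of_le h1]
        exact ⟨mul_nonneg h1 hτ.1, mul_le_of_le_one_right h1 hτ.2⟩
      · rw [uIcc_of_ge h1]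
        exact ⟨by nlinarith [hτ.2], mul_nonpos_of_nonpos_of_nonneg h1 hτ.1⟩
    exact h.ordConnected.uIcc_subset h0 ht this
  have hdom : (t • v : EuclideanSpace ℝ (Fin d)) ∈ expDomain d p :=
    ⟨_, _, h.comp_mul t, hsub, velocity_comp_mul h h0 hv t⟩
  refine (dif_pos hdom).trans ?_
  -- `expMap` evaluates an arbitrarily chosen geodesic at time `1`; by uniqueness it agrees there
  -- with `τ ↦ γ (t τ)`.
  obtain ⟨s', h', hs', hv'⟩ := hdom.choose_spec
  have h2 := h'.eqOn (h.comp_mul t) (hs' (by simp : (0 : ℝ) ∈ Icc (0 : ℝ) 1))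
    (hsub (by simp : (0 : ℝ) ∈ Icc (0 : ℝ) 1)) (hv'.trans (velocity_comp_mul h h0 hv t).symm)
  have h3 := h2 (x := 1) ⟨hs' (by simp), hsub (by simp)⟩
  simpa using h3

end ExponentialMap

/-! ### Normal coordinates -/

section NormalChart

variable {d : ℕ} {M : Type*} [TopologicalSpace M] [ChartedSpace (EuclideanSpace ℝ (Fin d)) M]

/-- A diffeomorphism from an open set of `M` onto an open set of `ℝᵈ`, as a chart. -/
def chartOfDiffeo (f : M → EuclideanSpace ℝ (Fin d)) (g : EuclideanSpace ℝ (Fin d) → M)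
    {U : Set M} {V : Set (EuclideanSpace ℝ (Fin d))} (hU : IsOpen U) (hV : IsOpen V)
    (hfU : MapsTo f U V) (hgV : MapsTo g V U) (hinv : InvOn g f U V) (hf : ContinuousOn f U)
    (hg : ContinuousOn g V) : OpenPartialHomeomorph M (EuclideanSpace ℝ (Fin d)) where
  toFun := f
  invFun := g
  source := U
  target := V
  map_source' := hfU
  map_target' := hgV
  left_inv' := hinv.1
  right_inv' := hinv.2
  open_source := hU
  open_target := hV
  continuousOn_toFun := hf
  continuousOn_invFun := hg

variable [RiemannianBundle (fun x : M => TangentSpace (𝓡 d) x)]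

variable (d) in
/-- A linear isometry from `ℝᵈ` onto the tangent space at `p`. -/
lemma exists_orthonormal_frame (p : M) :
    ∃ A : EuclideanSpace ℝ (Fin d) ≃L[ℝ] EuclideanSpace ℝ (Fin d),
      ∀ x y, innerAt p (A x) (A y) = inner ℝ x y := by
  have hfd : FiniteDimensional ℝ (TangentSpace (𝓡 d) p) :=
    inferInstanceAs (FiniteDimensional ℝ (EuclideanSpace ℝ (Fin d)))
  have hrank : Module.finrank ℝ (TangentSpace (𝓡 d) p) = d :=
    (finrank_euclideanSpace_fin (𝕜 := ℝ) (n := d))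
  let b := (stdOrthonormalBasis ℝ (TangentSpace (𝓡 d) p)).reindex (finCongr hrank)
  let A : EuclideanSpace ℝ (Fin d) ≃ₗ[ℝ] EuclideanSpace ℝ (Fin d) := b.repr.symm.toLinearEquiv
  exact ⟨A.toContinuousLinearEquiv, fun x y => b.repr.symm.inner_map_map x y⟩

lemma tangentNorm_frame {p : M} {A : EuclideanSpace ℝ (Fin d) ≃L[ℝ] EuclideanSpace ℝ (Fin d)}
    (hA : ∀ x y, innerAt p (A x) (A y) = inner ℝ x y) (x : EuclideanSpace ℝ (Fin d)) :
    tangentNorm (p := p) (A x) = ‖x‖ := by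
  have h : ∀ v : TangentSpace (𝓡 d) p, tangentNorm v ^ 2 = innerAt p v v := fun v =>
    (real_inner_self_eq_norm_sq v).symm
  have h1 := (h (A x)).trans (hA x x)
  rw [real_inner_self_eq_norm_sq] at h1
  have hn : ∀ v : TangentSpace (𝓡 d) p, 0 ≤ tangentNorm v := fun v => norm_nonneg v
  exact (pow_left_inj₀ (hn (A x)) (norm_nonneg x) two_ne_zero).1 h1

lemma tangentBall_frame {p : M} {A : EuclideanSpace ℝ (Fin d) ≃L[ℝ] EuclideanSpace ℝ (Fin d)}
    (hA : ∀ x y, innerAt p (A x) (A y) = inner ℝ x y) (r : ℝ) :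
    tangentBall d p r = A '' Metric.ball 0 r := by
  ext v
  constructor
  · intro hv
    refine ⟨A.symm v, ?_, A.apply_symm_apply v⟩
    rw [mem_ball_zero_iff, ← tangentNorm_frame hA, A.apply_symm_apply]
    exact hv
  · rintro ⟨x, hx, rfl⟩
    rw [mem_ball_zero_iff, ← tangentNorm_frame hA] at hx
    exact hx

variable [IsManifold (𝓡 d) ∞ M]

/-- Normal coordinates at `p`. -/
theorem exists_normal_chart {p : M} {r : ℝ} (hr : IsInjectivityBound d p r)
    {A : EuclideanSpace ℝ (Fin d) ≃L[ℝ] EuclideanSpace ℝ (Fin d)}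
    (hA : ∀ x y, innerAt p (A x) (A y) = inner ℝ x y) :
    ∃ N ∈ IsManifold.maximalAtlas (𝓡 d) ∞ M, N.target = Metric.ball 0 r ∧
      ∀ x, N.symm x = expMap d p (A x) := by
  obtain ⟨-, hU, hV, hmaps, hsm, g, hgm, hginv, hgs⟩ := hr
  have hball := tangentBall_frame hA r
  have hAm : MapsTo A (Metric.ball 0 r) (tangentBall d p r) := by
    rw [hball]; exact mapsTo_image _ _
  have hAm' : MapsTo A.symm (tangentBall d p r) (Metric.ball 0 r) := by
    rw [hball]; rintro _ ⟨x, hx, rfl⟩; simpa using hx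
  have hf : ContMDiffOn (𝓡 d) (𝓡 d) ∞ (A.symm ∘ g) (geodesicBall d p r) :=
    (contMDiff_iff_contDiff.2 A.symm.contDiff).comp_contMDiffOn hgs
  have hg : ContMDiffOn (𝓡 d) (𝓡 d) ∞ (fun x => expMap d p (A x)) (Metric.ball 0 r) :=
    hsm.comp (contMDiff_iff_contDiff.2 A.contDiff).contMDiffOn hAm
  let N := chartOfDiffeo (A.symm ∘ g) (fun x => expMap d p (A x)) hV Metric.isOpen_ball
    (hAm'.comp hgm) (hmaps.comp hAm)
    ⟨fun x hx => by
      simp only [Function.comp_apply, A.apply_symm_apply]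
      exact hginv.2 hx,
    fun x hx => by
      simp only [Function.comp_apply]
      rw [show g (expMap d p (A x)) = A x from hginv.1 (hAm hx), A.symm_apply_apply]⟩
    hf.continuousOn hg.continuousOn
  exact ⟨N, N.mem_maximalAtlas_of_contMDiffOn hf hg, rfl, fun x => rfl⟩

variable [IsContMDiffRiemannianBundle (𝓡 d) ∞ (EuclideanSpace ℝ (Fin d))
      (fun x : M => TangentSpace (𝓡 d) x)]

/-- The rays of normal coordinates are geodesics. -/
lemma exists_radial_geodesic [T2Space M] {p : M} {r : ℝ} (hr : IsInjectivityBound d p r)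
    {A : EuclideanSpace ℝ (Fin d) ≃L[ℝ] EuclideanSpace ℝ (Fin d)}
    (hA : ∀ x y, innerAt p (A x) (A y) = inner ℝ x y) {x : EuclideanSpace ℝ (Fin d)}
    (hx : x ∈ Metric.ball (0 : EuclideanSpace ℝ (Fin d)) r) :
    ∃ (γ : ℝ → M) (s : Set ℝ), IsGeodesicOn d γ s ∧ Icc 0 1 ⊆ s ∧
      velocity d γ 0 = ⟨p, A x⟩ ∧ ∀ t ∈ s, expMap d p (A (t • x)) = γ t := by
  obtain ⟨γ, s, h, hs, hv⟩ := hr.1 (A x) (by rw [tangentBall_frame hA]; exact ⟨x, hx, rfl⟩)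
  refine ⟨γ, s, h, hs, hv, fun t ht => ?_⟩
  rw [map_smul]
  exact h.expMap_eq (hs (by simp)) hv ht

/-- In the normal chart a geodesic from `p` reads `τ ↦ τ x`. Its second derivative is zero, so the
geodesic equation leaves only the Christoffel term. -/
theorem christoffel_radial [T2Space M] {p : M} {r : ℝ} (hr : IsInjectivityBound d p r)
    {A : EuclideanSpace ℝ (Fin d) ≃L[ℝ] EuclideanSpace ℝ (Fin d)}
    (hA : ∀ x y, innerAt p (A x) (A y) = inner ℝ x y)
    {N : OpenPartialHomeomorph M (EuclideanSpace ℝ (Fin d))}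
    (hN : N ∈ IsManifold.maximalAtlas (𝓡 d) ∞ M) (hNt : N.target = Metric.ball 0 r)
    (hNs : ∀ x, N.symm x = expMap d p (A x)) (hr0 : 0 < r)
    (v : EuclideanSpace ℝ (Fin d)) (t : ℝ) (ht : t • v ∈ Metric.ball (0 : EuclideanSpace ℝ (Fin d)) r) :
    chartChristoffel N (t • v) v v = 0 := by
  have key : ∀ x ∈ Metric.ball (0 : EuclideanSpace ℝ (Fin d)) r, ∀ t ∈ Icc (0 : ℝ) 1,
      chartChristoffel N (t • x) x x = 0 := by
    intro x hx t ht
    obtain ⟨γ, s, h, hs, -, hγ⟩ := exists_radial_geodesic hr hA hx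
    have hts := hs ht
    have htx : t • x ∈ N.target := by
      rw [hNt]
      rw [mem_ball_zero_iff] at hx ⊢
      rw [norm_smul, Real.norm_of_nonneg ht.1]
      exact (mul_le_of_le_one_left (norm_nonneg _) ht.2).trans_lt hx
    have hev : (fun τ => N (γ τ)) =ᶠ[𝓝 t] fun τ => τ • x := by
      have hc : ContinuousAt (fun τ : ℝ => τ • x) t := by fun_prop
      filter_upwards [h.isOpen.eventually_mem hts,
        hc.eventually_mem (N.open_target.mem_nhds htx)] with τ h1 h2
      rw [← hγ τ h1, ← hNs, N.right_inv h2]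
    have hsrc : γ t ∈ N.source := by
      rw [← hγ t hts, ← hNs]; exact N.map_target htx
    have hg := h.geodesicEquation hN hts hsrc
    have hd : ∀ τ : ℝ, deriv (fun τ : ℝ => τ • x) τ = x := fun τ => by
      simpa using ((hasDerivAt_id τ).smul_const x).deriv
    rw [GeodesicEquation, hev.deriv.deriv_eq, hev.deriv_eq, show N (γ t) = t • x from hev.self_of_nhds, hd,
      funext hd] at hg
    simpa using hg
  -- The vector `v` itself may lie outside the ball, so `key` is applied to a multiple of it and the
  -- square of the factor is divided out.
  by_cases h0 : t = 0
  · subst h0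
    obtain ⟨a, ha, hav⟩ : ∃ a : ℝ, 0 < a ∧ a • v ∈ Metric.ball (0 : EuclideanSpace ℝ (Fin d)) r := by
      refine ⟨r / (‖v‖ + 1), by positivity, ?_⟩
      rw [mem_ball_zero_iff, norm_smul, Real.norm_of_nonneg (by positivity), div_mul_eq_mul_div,
        div_lt_iff₀ (by positivity)]
      nlinarith
    have := key _ hav 0 (by simp)
    simpa [ha.ne'] using this
  · have := key _ ht 1 (by simp)
    simpa [h0] using this

/-- The geodesic through `p` with velocity `A x` is the image of the ray `τ x`. Hence the
differential of `N.symm` at `0` is `A`, a linear isometry onto the tangent space. -/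
theorem chartMetric_normal_zero [T2Space M] {p : M} {r : ℝ} (hr : IsInjectivityBound d p r)
    {A : EuclideanSpace ℝ (Fin d) ≃L[ℝ] EuclideanSpace ℝ (Fin d)}
    (hA : ∀ x y, innerAt p (A x) (A y) = inner ℝ x y)
    {N : OpenPartialHomeomorph M (EuclideanSpace ℝ (Fin d))}
    (hN : N ∈ IsManifold.maximalAtlas (𝓡 d) ∞ M) (hNt : N.target = Metric.ball 0 r)
    (hNs : ∀ x, N.symm x = expMap d p (A x)) (hr0 : 0 < r)
    (u v : EuclideanSpace ℝ (Fin d)) : chartMetric N 0 u v = inner ℝ u v := by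
  have h0t : (0 : EuclideanSpace ℝ (Fin d)) ∈ N.target := by rw [hNt]; simpa using hr0
  have hsm : MDifferentiableAt (𝓡 d) (𝓡 d) N.symm 0 :=
    (contMDiffAt_symm_of_mem_maximalAtlas hN h0t).mdifferentiableAt (by simp)
  have h0 : N.symm 0 = p := by
    obtain ⟨γ, s, h, hs, hv, hγ⟩ := exists_radial_geodesic hr hA (x := 0) (by simpa using hr0)
    have := hγ 0 (hs (by simp))
    rw [← hNs, zero_smul] at this
    rw [this]
    exact (velocity_eq_iff.1 hv).1
  let D : EuclideanSpace ℝ (Fin d) →L[ℝ] EuclideanSpace ℝ (Fin d) := mfderiv (𝓡 d) (𝓡 d) N.symm 0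
  have hball : ∀ x ∈ Metric.ball (0 : EuclideanSpace ℝ (Fin d)) r, D x = A x := by
    intro x hx
    obtain ⟨γ, s, h, hs, hv, hγ⟩ := exists_radial_geodesic hr hA hx
    have hl : HasDerivAt (fun τ : ℝ => τ • x) x 0 := by
      simpa using (hasDerivAt_id (0 : ℝ)).smul_const x
    have hev : γ =ᶠ[𝓝 0] N.symm ∘ fun τ : ℝ => τ • x := by
      filter_upwards [h.isOpen.eventually_mem (hs (by simp : (0 : ℝ) ∈ Icc (0 : ℝ) 1))] with τ h1
      rw [Function.comp_apply, hNs, hγ τ h1]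
    have h1 : (mfderiv 𝓘(ℝ, ℝ) (𝓡 d) γ 0 : ℝ →L[ℝ] EuclideanSpace ℝ (Fin d)) =
      mfderiv 𝓘(ℝ, ℝ) (𝓡 d) (N.symm ∘ fun τ : ℝ => τ • x) 0 := hev.mfderiv_eq
    have h2 := mfderiv_comp_of_eq (x := (0 : ℝ)) (f := fun τ : ℝ => τ • x) hsm
      hl.differentiableAt.mdifferentiableAt (zero_smul ℝ x)
    have h3 := (DFunLike.congr_fun h1 (1 : ℝ)).symm.trans (velocity_eq_iff.1 hv).2
    have h4 : mfderiv 𝓘(ℝ, ℝ) (𝓡 d) (fun τ : ℝ => τ • x) 0 = fderiv ℝ (fun τ : ℝ => τ • x) 0 :=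
      mfderiv_eq_fderiv
    have h5 : fderiv ℝ (fun τ : ℝ => τ • x) 0 1 = x := by
      rw [fderiv_apply_one_eq_deriv, hl.deriv]
    rw [← h3]
    conv_lhs => rw [← h5]
    let D' : EuclideanSpace ℝ (Fin d) → EuclideanSpace ℝ (Fin d) →L[ℝ] EuclideanSpace ℝ (Fin d) :=
      fun y => mfderiv (𝓡 d) (𝓡 d) N.symm y
    have h6 : D = D' ((0 : ℝ) • x) := by
      change D' 0 = _
      rw [zero_smul]
    rw [← h4, h6]
    exact (DFunLike.congr_fun h2 (1 : ℝ)).symm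
  have hD : ∀ x, D x = A x := by
    intro x
    obtain ⟨a, ha, hav⟩ : ∃ a : ℝ, 0 < a ∧ a • x ∈ Metric.ball (0 : EuclideanSpace ℝ (Fin d)) r := by
      refine ⟨r / (‖x‖ + 1), by positivity, ?_⟩
      rw [mem_ball_zero_iff, norm_smul, Real.norm_of_nonneg (by positivity), div_mul_eq_mul_div,
        div_lt_iff₀ (by positivity)]
      nlinarith
    have := hball _ hav
    rw [map_smul, map_smul] at this
    exact smul_right_injective _ ha.ne' this
  rw [chartMetric_eq_innerAt, h0, ← hA]
  exact congrArg₂ (innerAt p) (hD u) (hD v)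

end NormalChart

/-! ### Projective coordinates on the unit geodesic ball -/

section KleinChart

lemma kleinMetric_add_self {E : Type*} [NormedAddCommGroup E] [InnerProductSpace ℝ E]
    (κ : ℝ) (y a b : E) : kleinMetric κ y (a + b) (a + b) =
      kleinMetric κ y a a + 2 * kleinMetric κ y a b + kleinMetric κ y b b := by
  simp only [kleinMetric, inner_add_left, inner_add_right, real_inner_comm a b]
  ring

lemma hasDerivAt_kleinMetric {E : Type*} [NormedAddCommGroup E] [InnerProductSpace ℝ E]
    {κ : ℝ} {y : E} (hy : 1 + κ * ‖y‖ ^ 2 ≠ 0) (a b c : E) :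
    HasDerivAt (fun s : ℝ => kleinMetric κ (y + s • a) b c)
      (-(2 * κ * inner ℝ y a * inner ℝ b c) / (1 + κ * ‖y‖ ^ 2) ^ 2 -
        κ * (inner ℝ a b * inner ℝ y c + inner ℝ y b * inner ℝ a c) / (1 + κ * ‖y‖ ^ 2) ^ 2 +
        4 * κ ^ 2 * inner ℝ y a * inner ℝ y b * inner ℝ y c / (1 + κ * ‖y‖ ^ 2) ^ 3) 0 := by
  have hl : HasDerivAt (fun s : ℝ => y + s • a) a 0 := by
    simpa using ((hasDerivAt_id (0 : ℝ)).smul_const a).const_add y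
  have hn : HasDerivAt (fun s : ℝ => 1 + κ * ‖y + s • a‖ ^ 2) (κ * (2 * inner ℝ y a)) 0 := by
    have := hl.norm_sq
    simp only [zero_smul, add_zero] at this
    exact (this.const_mul κ).const_add 1
  have hi : ∀ b, HasDerivAt (fun s : ℝ => inner ℝ (y + s • a) b) (inner ℝ a b) 0 := fun b => by
    simpa using hl.inner ℝ (hasDerivAt_const 0 b)
  have h1 := ((hasDerivAt_const (0 : ℝ) (inner ℝ b c : ℝ)).fun_div hn (by simpa using hy)).fun_sub
    ((((hi b).const_mul κ).fun_mul (hi c)).fun_div (hn.fun_pow 2)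
      (by simpa using hy))
  refine h1.congr_deriv ?_
  simp only [zero_smul, add_zero]
  field_simp
  push_cast
  ring

variable {d : ℕ} {M : Type*} [TopologicalSpace M] [ChartedSpace (EuclideanSpace ℝ (Fin d)) M]
  [RiemannianBundle (fun x : M => TangentSpace (𝓡 d) x)]

/-- `K` is a chart from `B` onto the ball of radius `R` in which the metric is that of the
projective model of curvature `κ`. -/
structure IsKleinChart (κ R : ℝ) (B : Set M)
    (K : OpenPartialHomeomorph M (EuclideanSpace ℝ (Fin d))) : Prop where
  mem_maximalAtlas : K ∈ IsManifold.maximalAtlas (𝓡 d) ∞ M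
  source_eq : K.source = B
  target_eq : K.target = Metric.ball 0 R
  pos : ∀ y ∈ Metric.ball (0 : EuclideanSpace ℝ (Fin d)) R, 0 < 1 + κ * ‖y‖ ^ 2
  metric : ∀ y ∈ Metric.ball (0 : EuclideanSpace ℝ (Fin d)) R, ∀ u v,
    chartMetric K y u v = kleinMetric κ y u v

variable [IsManifold (𝓡 d) ∞ M] [IsContMDiffRiemannianBundle (𝓡 d) ∞ (EuclideanSpace ℝ (Fin d))
      (fun x : M => TangentSpace (𝓡 d) x)]

/-- The Christoffel symbols in projective coordinates. -/
theorem IsKleinChart.christoffel {κ R : ℝ} {B : Set M}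
    {K : OpenPartialHomeomorph M (EuclideanSpace ℝ (Fin d))} (hK : IsKleinChart κ R B K)
    {y : EuclideanSpace ℝ (Fin d)} (hy : y ∈ Metric.ball (0 : EuclideanSpace ℝ (Fin d)) R)
    (a : EuclideanSpace ℝ (Fin d)) :
    chartChristoffel K y a a = -(2 * κ * inner ℝ y a / (1 + κ * ‖y‖ ^ 2)) • a := by
  have L := isLeviCivitaOn_chart hK.mem_maximalAtlas
  have hyt : y ∈ K.target := by rwa [hK.target_eq]
  have hD := (hK.pos y hy).ne'
  have hder : ∀ a b c, fderiv ℝ (chartMetric K) y a b c =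
      -(2 * κ * inner ℝ y a * inner ℝ b c) / (1 + κ * ‖y‖ ^ 2) ^ 2 -
        κ * (inner ℝ a b * inner ℝ y c + inner ℝ y b * inner ℝ a c) / (1 + κ * ‖y‖ ^ 2) ^ 2 +
        4 * κ ^ 2 * inner ℝ y a * inner ℝ y b * inner ℝ y c / (1 + κ * ‖y‖ ^ 2) ^ 3 := by
    intro a b c
    have hl : HasDerivAt (fun s : ℝ => y + s • a) a 0 := by
      simpa using ((hasDerivAt_id (0 : ℝ)).smul_const a).const_add y
    have hG : HasFDerivAt (chartMetric K) (fderiv ℝ (chartMetric K) y) (y + (0 : ℝ) • a) := by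
      simpa using L.hasFDerivAt_metric hyt
    have h1 := ((hG.comp_hasDerivAt 0 hl).clm_apply (hasDerivAt_const 0 b)).clm_apply
      (hasDerivAt_const 0 c)
    have hc : ∀ᶠ s : ℝ in 𝓝 0, y + s • a ∈ Metric.ball (0 : EuclideanSpace ℝ (Fin d)) R :=
      hl.continuousAt.eventually_mem (by simpa using Metric.isOpen_ball.mem_nhds hy)
    have h2 := h1.unique ((hasDerivAt_kleinMetric hD a b c).congr_of_eventuallyEq
      (hc.mono fun s hs => hK.metric _ hs b c))
    simpa using h2
  -- The geodesic equation involves only the diagonal values `Γ(a, a)`. That they are multiples of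
  -- `a` is what makes geodesics straight.
  refine L.eq_of_metric_eq hyt fun c => ?_
  have h := L.koszul y hyt a a c
  rw [hder, hder] at h
  rw [map_smul, smul_apply, hK.metric y hy a c, smul_eq_mul, kleinMetric]
  have h' : chartMetric K y (chartChristoffel K y a a) c = _ := (eq_div_iff two_ne_zero).2
    ((mul_comm _ _).trans h)
  rw [h', real_inner_comm c a]
  field_simp
  ring

/-- A manifold of constant curvature and large injectivity radius has projective coordinates on
unit balls. -/
theorem exists_kleinChart [T2Space M] (hd : 2 ≤ d) {κ : ℝ}
    (hκ : HasConstantSectionalCurvature d M κ) (hinj : 10 ≤ injectivityRadius d M) (p : M) :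
    (∀ t ∈ Icc (0 : ℝ) 1, 0 < genCos κ t) ∧
      ∃ K : OpenPartialHomeomorph M (EuclideanSpace ℝ (Fin d)),
        IsKleinChart κ (kleinRadius κ) (geodesicBall d p 1) K := by
  -- The supremum that defines the injectivity radius at `p` need not be attained, hence a radius
  -- above `9` rather than `10`.
  obtain ⟨r, hr9, hr⟩ : ∃ r : ℝ, 9 < r ∧ IsInjectivityBound d p r := by
    have h1 : (9 : ℝ≥0∞) < injectivityRadiusAt d p :=
      lt_of_lt_of_le (by norm_num) (hinj.trans (iInf_le _ p))
    simp only [injectivityRadiusAt, lt_iSup_iff] at h1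
    obtain ⟨r, hr, h2⟩ := h1
    refine ⟨r, ?_, hr⟩
    have : ((9 : ℝ≥0) : ℝ≥0∞) < r := by exact_mod_cast h2
    exact_mod_cast ENNReal.coe_lt_coe.1 this
  have hr0 : 0 < r := by linarith
  obtain ⟨A, hA⟩ := exists_orthonormal_frame d p
  obtain ⟨N, hN, hNt, hNs⟩ := exists_normal_chart hr hA
  have L := isLeviCivitaOn_chart hN
  rw [hNt] at L
  have hG0 := chartMetric_normal_zero hr hA hN hNt hNs hr0
  have hrad := christoffel_radial hr hA hN hNt hNs hr0
  have hcurv : ∀ x ∈ Metric.ball (0 : EuclideanSpace ℝ (Fin d)) r, ∀ u v,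
      chartMetric N x (curvature (chartChristoffel N) x u v v) u =
        κ * (chartMetric N x u u * chartMetric N x v v - chartMetric N x u v ^ 2) :=
    fun x hx u v => hκ.inner_curvature hN (by rwa [hNt]) u v
  -- Here `2 ≤ d` enters: a conjugate point can only be excluded along a ray that has an orthogonal
  -- direction.
  have hcos : ∀ t ∈ Icc (0 : ℝ) 1, 0 < genCos κ t := fun t ht => by
    refine genCos_pos_of_genSin_ne_zero (fun t ht ht9 => ?_) ht
    exact L.no_conjugate_point hG0 hrad hcurv (hasDerivAt_genSin κ) (hasDerivAt_genCos κ)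
      (genSin_zero κ) (genCos_zero κ) (genCos_sq_add κ) (v := basisVec ⟨0, by lia⟩)
      (w := basisVec ⟨1, by lia⟩) (by simp [basisVec]) (by simp [basisVec])
      (by simp [basisVec, EuclideanSpace.inner_single_left]) ht (by linarith)
  refine ⟨hcos, ?_⟩
  have hsub : Metric.ball (0 : EuclideanSpace ℝ (Fin d)) 1 ⊆ Metric.ball 0 r :=
    Metric.ball_subset_ball (by linarith)
  have hcos' : ∀ x ∈ Metric.ball (0 : EuclideanSpace ℝ (Fin d)) 1, genCos κ ‖x‖ ≠ 0 := fun x hx =>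
    (hcos _ ⟨norm_nonneg x, (mem_ball_zero_iff.1 hx).le⟩).ne'
  have hmetric : ∀ x ∈ Metric.ball (0 : EuclideanSpace ℝ (Fin d)) 1, ∀ u,
      kleinMetric κ (centralProj κ x) (fderiv ℝ (centralProj κ) x u)
        (fderiv ℝ (centralProj κ) x u) = chartMetric N x u u := fun x hx u =>
    kleinMetric_eq_of_normal (hcos' x hx) (fun h => by rw [h, hG0])
      (L.metric_normal hG0 hrad hcurv (hasDerivAt_genSin κ) (hasDerivAt_genCos κ)
        (genSin_zero κ) (genCos_zero κ) (genCos_sq_add κ) (hsub hx) rfl u)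
  -- The pulled-back Klein metric equals the positive definite `chartMetric N`, so the differential
  -- has no kernel.
  have hDinj : ∀ x ∈ Metric.ball (0 : EuclideanSpace ℝ (Fin d)) 1,
      Function.Injective (fderiv ℝ (centralProj κ) x) := by
    intro x hx
    refine (injective_iff_map_eq_zero _).2 fun u hu => ?_
    by_contra hne
    have h1 := L.pos x (hsub hx) u hne
    rw [← hmetric x hx, hu] at h1
    simp [kleinMetric] at h1
  have hbij := bijOn_centralProj (E := EuclideanSpace ℝ (Fin d)) hcos
  have hcp : ContDiffOn ℝ ∞ (centralProj κ) (Metric.ball (0 : EuclideanSpace ℝ (Fin d)) 1) :=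
    fun x hx => (contDiffAt_centralProj (hcos' x hx)).contDiffWithinAt
  set ψ := Function.invFunOn (centralProj κ) (Metric.ball (0 : EuclideanSpace ℝ (Fin d)) 1) with hψ
  have hinv : InvOn ψ (centralProj κ) (Metric.ball (0 : EuclideanSpace ℝ (Fin d)) 1)
      (Metric.ball 0 (kleinRadius κ)) := hbij.invOn_invFunOn
  have hψm : MapsTo ψ (Metric.ball 0 (kleinRadius κ))
      (Metric.ball (0 : EuclideanSpace ℝ (Fin d)) 1) := hbij.surjOn.mapsTo_invFunOn
  have hψs := contDiffOn_inverse Metric.isOpen_ball hcp hDinj hψm hinv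
  have hB : geodesicBall d p 1 = N.source ∩ N ⁻¹' Metric.ball 0 1 := by
    have h1 : geodesicBall d p 1 = N.symm '' Metric.ball 0 1 := by
      rw [geodesicBall, tangentBall_frame hA, image_image]
      exact image_congr fun x _ => (hNs x).symm
    rw [h1]
    ext m
    constructor
    · rintro ⟨x, hx, rfl⟩
      have hxt : x ∈ N.target := by rw [hNt]; exact hsub hx
      exact ⟨N.map_target hxt, by rwa [mem_preimage, N.right_inv hxt]⟩
    · rintro ⟨h1, h2⟩
      exact ⟨N m, h2, N.left_inv h1⟩
  have hBo : IsOpen (geodesicBall d p 1) := by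
    rw [hB]; exact N.isOpen_inter_preimage Metric.isOpen_ball
  have hNB : MapsTo N (geodesicBall d p 1) (Metric.ball 0 1) := fun m hm => by
    rw [hB] at hm; exact hm.2
  have hNB' : MapsTo N.symm (Metric.ball 0 1) (geodesicBall d p 1) := fun x hx => by
    have hxt : x ∈ N.target := by rw [hNt]; exact hsub hx
    rw [hB]
    exact ⟨N.map_target hxt, by rwa [mem_preimage, N.right_inv hxt]⟩
  have hinv2 : InvOn (N.symm ∘ ψ) (centralProj κ ∘ N) (geodesicBall d p 1)
      (Metric.ball 0 (kleinRadius κ)) := by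
    refine ⟨fun m hm => ?_, fun y hy => ?_⟩
    · simp only [Function.comp_apply]
      rw [hinv.1 (hNB hm)]
      rw [hB] at hm
      exact N.left_inv hm.1
    · simp only [Function.comp_apply]
      rw [N.right_inv (by rw [hNt]; exact hsub (hψm hy)), hinv.2 hy]
  have hfs : ContMDiffOn (𝓡 d) (𝓡 d) ∞ (centralProj κ ∘ N) (geodesicBall d p 1) :=
    hcp.contMDiffOn.comp ((contMDiffOn_of_mem_maximalAtlas hN).mono fun m hm => by
      rw [hB] at hm; exact hm.1) hNB
  have hgs : ContMDiffOn (𝓡 d) (𝓡 d) ∞ (N.symm ∘ ψ) (Metric.ball 0 (kleinRadius κ)) :=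
    (contMDiffOn_symm_of_mem_maximalAtlas hN).comp hψs.contMDiffOn fun y hy => by
      rw [hNt]; exact hsub (hψm hy)
  let K := chartOfDiffeo (centralProj κ ∘ N) (N.symm ∘ ψ) hBo Metric.isOpen_ball
    (hbij.mapsTo.comp hNB) (hNB'.comp hψm) hinv2 hfs.continuousOn hgs.continuousOn
  have hKa : K ∈ IsManifold.maximalAtlas (𝓡 d) ∞ M := K.mem_maximalAtlas_of_contMDiffOn hfs hgs
  refine ⟨K, hKa, rfl, rfl, fun y hy => ?_, fun y hy => ?_⟩
  · obtain ⟨x, hx, rfl⟩ := hbij.surjOn hy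
    have h1 := genCos_sq_mul (hcos' x hx)
    exact pos_of_mul_pos_right (h1 ▸ one_pos) (sq_nonneg _)
  · obtain ⟨x, hx, rfl⟩ := hbij.surjOn hy
    have hxt : x ∈ N.target := by rw [hNt]; exact hsub hx
    have hφ : K ∘ N.symm =ᶠ[𝓝 x] centralProj κ := by
      filter_upwards [N.open_target.mem_nhds hxt] with z hz
      change centralProj κ (N (N.symm z)) = _
      rw [N.right_inv hz]
    -- `hmetric` compares quadratic forms only; the bilinear identity follows by polarization.
    have hquad : ∀ u, chartMetric K (centralProj κ x) u u = kleinMetric κ (centralProj κ x) u u := by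
      intro u
      obtain ⟨u', rfl⟩ := (LinearMap.injective_iff_surjective
        (f := (fderiv ℝ (centralProj κ) x : EuclideanSpace ℝ (Fin d) →ₗ[ℝ] _))).1 (hDinj x hx) u
      have h1 := chartMetric_transition hN hKa hxt (hNB' hx) u' u'
      rw [hφ.fderiv_eq, show K (N.symm x) = centralProj κ x from hφ.self_of_nhds] at h1
      exact h1.symm.trans (hmetric x hx u').symm
    intro u v
    have h1 := hquad (u + v)
    rw [kleinMetric_add_self, ← hquad u, ← hquad v] at h1
    simp only [map_add, add_apply] at h1
    rw [chartMetric_symm K _ v u] at h1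
    linarith

end KleinChart

/-! ### Geodesics in projective coordinates are chords -/

section Lines

/-- Solution of the autonomous equation `F' = q(F)` by separation of variables. -/
lemma exists_autonomous_solution {q : ℝ → ℝ} (hq : ContDiff ℝ ∞ q) {J : Set ℝ} (hJ : IsOpen J)
    (hJ' : J.OrdConnected) (hpos : ∀ τ ∈ J, 0 < q τ) {τ₀ : ℝ} (hτ₀ : τ₀ ∈ J) (t₀ : ℝ) :
    ∃ (θ F : ℝ → ℝ) (s : Set ℝ), IsOpen s ∧ s.OrdConnected ∧ MapsTo θ J s ∧ MapsTo F s J ∧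
      InvOn F θ J s ∧ θ τ₀ = t₀ ∧ ContDiffOn ℝ ∞ F s ∧
      (∀ τ ∈ J, HasDerivAt θ (q τ)⁻¹ τ) ∧ ∀ t ∈ s, HasDerivAt F (q (F t)) t := by
  have hne : ∀ τ ∈ J, q τ ≠ 0 := fun τ hτ => (hpos τ hτ).ne'
  have hqi : ContDiffOn ℝ ∞ (fun τ => (q τ)⁻¹) J := hq.contDiffOn.inv hne
  -- `θ` is time as a function of position; the solution `F` is its inverse on the image of `J`.
  set θ : ℝ → ℝ := fun τ => t₀ + ∫ x in τ₀..τ, (q x)⁻¹ with hθ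
  have hd : ∀ τ ∈ J, HasDerivAt θ (q τ)⁻¹ τ := fun τ hτ => by
    refine (intervalIntegral.integral_hasDerivAt_right ?_ ?_ ?_).const_add t₀
    · exact (hqi.continuousOn.mono (hJ'.uIcc_subset hτ₀ hτ)).intervalIntegrable
    · exact hqi.continuousOn.stronglyMeasurableAtFilter hJ τ hτ
    · exact hqi.continuousOn.continuousAt (hJ.mem_nhds hτ)
  have hθs : ContDiffOn ℝ ∞ θ J := (contDiffOn_infty_iff_deriv_of_isOpen hJ).2
    ⟨fun τ hτ => (hd τ hτ).differentiableAt.differentiableWithinAt,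
      hqi.congr fun τ hτ => (hd τ hτ).deriv⟩
  have hmono : StrictMonoOn θ J := strictMonoOn_of_deriv_pos hJ'.convex hθs.continuousOn
    fun τ hτ => by
      rw [hJ.interior_eq] at hτ
      rw [(hd τ hτ).deriv]
      exact inv_pos.2 (hpos τ hτ)
  have hbij : BijOn θ J (θ '' J) := hmono.injOn.bijOn_image
  have hso : IsOpen (θ '' J) := by
    refine isOpen_iff_mem_nhds.2 ?_
    rintro _ ⟨τ, hτ, rfl⟩
    have h1 : HasStrictDerivAt θ (q τ)⁻¹ τ := by
      have := (hθs.contDiffAt (hJ.mem_nhds hτ)).hasStrictDerivAt (by simp)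
      rwa [(hd τ hτ).deriv] at this
    rw [← h1.map_nhds_eq (inv_ne_zero (hne τ hτ))]
    exact image_mem_map (hJ.mem_nhds hτ)
  have hinv : InvOn (Function.invFunOn θ J) θ J (θ '' J) := hbij.invOn_invFunOn
  have hF : MapsTo (Function.invFunOn θ J) (θ '' J) J := hbij.surjOn.mapsTo_invFunOn
  have hFs := contDiffOn_inverse hJ hθs (fun τ hτ => by
    refine (injective_iff_map_eq_zero _).2 fun u hu => ?_
    rw [(hd τ hτ).hasFDerivAt.fderiv] at hu
    simpa [hne τ hτ] using hu) hF hinv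
  refine ⟨θ, Function.invFunOn θ J, θ '' J, hso,
    (hJ'.isPreconnected.image θ hθs.continuousOn).ordConnected, mapsTo_image θ J, hF, hinv,
    by simp [hθ], hFs, hd, fun t ht => ?_⟩
  have h := (hd _ (hF ht)).of_local_left_inverse
    (hFs.continuousOn.continuousAt (hso.mem_nhds ht)) (inv_ne_zero (hne _ (hF ht)))
    (hso.eventually_mem ht |>.mono fun y hy => hinv.2 hy)
  rwa [inv_inv] at h

variable {E : Type*} [NormedAddCommGroup E] [InnerProductSpace ℝ E]

/-- The geodesic equation of the projective model preserves the direction of the velocity. -/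
lemma deriv_eq_smul_of_klein {κ : ℝ} {c : ℝ → E} {s : Set ℝ} (hs : IsOpen s)
    (hs' : s.OrdConnected) (hc : ∀ t ∈ s, ContDiffAt ℝ ∞ c t)
    (hpos : ∀ t ∈ s, 0 < 1 + κ * ‖c t‖ ^ 2)
    (h : ∀ t ∈ s, deriv (deriv c) t =
      (2 * κ * inner ℝ (c t) (deriv c t) / (1 + κ * ‖c t‖ ^ 2)) • deriv c t) :
    ∃ w : E, ∀ t ∈ s, deriv c t = (1 + κ * ‖c t‖ ^ 2) • w := by
  -- Dividing the velocity by `1 + κ|c|²` removes the tangential acceleration and leaves a constant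
  -- vector.
  have hW : ∀ t ∈ s, HasDerivAt (fun t => (1 + κ * ‖c t‖ ^ 2)⁻¹ • deriv c t) 0 t := by
    intro t ht
    have hct := ((hc t ht).differentiableAt (by simp)).hasDerivAt
    have hct' := ((ContDiffAt.deriv_smooth (hc t ht)).differentiableAt (by simp)).hasDerivAt
    have hD : HasDerivAt (fun t => 1 + κ * ‖c t‖ ^ 2) (κ * (2 * inner ℝ (c t) (deriv c t))) t :=
      (hct.norm_sq.const_mul κ).const_add 1
    have hne := (hpos t ht).ne'
    refine ((hD.fun_inv hne).fun_smul hct').congr_deriv ?_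
    rw [h t ht, smul_smul, ← add_smul]
    convert zero_smul ℝ _ using 2
    field_simp
    ring
  obtain ⟨w, hw⟩ := hs.exists_is_const_of_deriv_eq_zero hs'.isPreconnected
    (fun t ht => (hW t ht).differentiableAt.differentiableWithinAt) fun t ht => (hW t ht).deriv
  refine ⟨w, fun t ht => ?_⟩
  rw [← hw t ht, smul_smul, mul_inv_cancel₀ (hpos t ht).ne', one_smul]

/-- A curve whose velocity has constant direction runs on a line. -/
lemma eq_add_smul_of_deriv {c : ℝ → E} {ρ : ℝ → ℝ} {s : Set ℝ} (hs : IsOpen s)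
    (hs' : s.OrdConnected) {w : E} (hw : w ≠ 0) (hc : ∀ t ∈ s, HasDerivAt c (ρ t • w) t)
    {t₀ : ℝ} (ht₀ : t₀ ∈ s) :
    ∃ f : ℝ → ℝ, f t₀ = 0 ∧ (∀ t ∈ s, HasDerivAt f (ρ t) t) ∧ ∀ t ∈ s, c t = c t₀ + f t • w := by
  have hw' : (inner ℝ w w : ℝ) ≠ 0 := inner_self_ne_zero.2 hw
  -- The parameter on the line is read off by projecting orthogonally on `w`.
  have hf : ∀ t ∈ s, HasDerivAt (fun t => inner ℝ (c t - c t₀) w / inner ℝ w w) (ρ t) t := by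
    intro t ht
    have := (((hc t ht).sub_const (c t₀)).inner ℝ (hasDerivAt_const t w)).div_const (inner ℝ w w)
    refine this.congr_deriv ?_
    rw [inner_zero_right, zero_add, real_inner_smul_left, mul_div_assoc, div_self hw', mul_one]
  refine ⟨fun t => inner ℝ (c t - c t₀) w / inner ℝ w w, by simp, hf, fun t ht => ?_⟩
  refine hs.eqOn_of_deriv_eq hs'.isPreconnected
    (fun t ht => (hc t ht).differentiableAt.differentiableWithinAt)
    (fun t ht => (((hf t ht).smul_const w).const_add (c t₀)).differentiableAt.differentiableWithinAt)
    (fun t ht => ?_) ht₀ (by simp) ht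
  rw [(hc t ht).deriv, (((hf t ht).smul_const w).const_add (c t₀)).deriv]

variable {d : ℕ} {M : Type*} [TopologicalSpace M] [ChartedSpace (EuclideanSpace ℝ (Fin d)) M]
  [RiemannianBundle (fun x : M => TangentSpace (𝓡 d) x)]

lemma MapsGeodesicsToLines.smul {B : Set M} {R : ℝ} {Φ : M → EuclideanSpace ℝ (Fin d)}
    (h : MapsGeodesicsToLines B R Φ) {σ : ℝ} (hσ : 0 < σ) :
    MapsGeodesicsToLines B (σ * R) (fun x => σ • Φ x) := by
  intro γ s hγ hB hne
  obtain ⟨a, w, hw, ⟨f, hf, hf'⟩, hmax⟩ := h γ s hγ hB hne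
  refine ⟨σ • a, σ • w, smul_ne_zero hσ.ne' hw, ⟨f, hf, fun t ht => ?_⟩, fun hm => ?_⟩
  · change σ • Φ (γ t) = _
    rw [hf' t ht, smul_add, smul_comm]
  · have h1 : (fun x => σ • Φ x) '' (γ '' s) = (fun y => σ • y) '' (Φ '' (γ '' s)) := by
      rw [image_image (fun y => σ • y) Φ]
    rw [h1, hmax hm]
    ext y
    constructor
    · rintro ⟨_, ⟨⟨τ, rfl⟩, hy⟩, rfl⟩
      refine ⟨⟨τ, by rw [smul_comm τ σ w, ← smul_add]⟩, ?_⟩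
      rw [mem_ball_zero_iff] at hy ⊢
      rw [norm_smul, Real.norm_of_nonneg hσ.le]
      exact mul_lt_mul_of_pos_left hy hσ
    · rintro ⟨⟨τ, rfl⟩, hy⟩
      have h2 : σ • a + τ • σ • w = σ • (a + τ • w) := by rw [smul_add, smul_comm]
      rw [h2] at hy ⊢
      refine ⟨_, ⟨⟨τ, rfl⟩, ?_⟩, rfl⟩
      rw [mem_ball_zero_iff] at hy ⊢
      rw [norm_smul, Real.norm_of_nonneg hσ.le] at hy
      exact lt_of_mul_lt_mul_left hy hσ.le

variable [IsManifold (𝓡 d) ∞ M] [IsContMDiffRiemannianBundle (𝓡 d) ∞ (EuclideanSpace ℝ (Fin d))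
      (fun x : M => TangentSpace (𝓡 d) x)]

/-- Every chord of the ball is traced out by a geodesic. -/
lemma IsKleinChart.isGeodesicOn_chord {κ R : ℝ} {B : Set M}
    {K : OpenPartialHomeomorph M (EuclideanSpace ℝ (Fin d))} (hK : IsKleinChart κ R B K)
    {a w : EuclideanSpace ℝ (Fin d)} {F : ℝ → ℝ} {s : Set ℝ} (hs : IsOpen s)
    (hs' : s.OrdConnected) (hF : ContDiffOn ℝ ∞ F s)
    (hmaps : ∀ t ∈ s, a + F t • w ∈ Metric.ball (0 : EuclideanSpace ℝ (Fin d)) R)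
    (hder : ∀ t ∈ s, HasDerivAt F (1 + κ * ‖a + F t • w‖ ^ 2) t) :
    IsGeodesicOn d (fun t => K.symm (a + F t • w)) s := by
  refine isGeodesicOn_of_chart hK.mem_maximalAtlas hs hs'
    (contDiffOn_const.add (hF.smul contDiffOn_const))
    (fun t ht => by rw [hK.target_eq]; exact hmaps t ht) fun t ht => ?_
  have hd : ∀ t ∈ s, HasDerivAt (fun t => a + F t • w) ((1 + κ * ‖a + F t • w‖ ^ 2) • w) t :=
    fun t ht => ((hder t ht).smul_const w).const_add a
  have hev : deriv (fun t => a + F t • w) =ᶠ[𝓝 t] fun t => (1 + κ * ‖a + F t • w‖ ^ 2) • w := by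
    filter_upwards [hs.mem_nhds ht] with τ hτ using (hd τ hτ).deriv
  have hdd : HasDerivAt (fun t => (1 + κ * ‖a + F t • w‖ ^ 2) • w) _ t :=
    (((hd t ht).norm_sq.const_mul κ).const_add 1).smul_const w
  rw [GeodesicEquation, hK.christoffel (hmaps t ht), hev.deriv_eq, hdd.deriv, hev.self_of_nhds,
    smul_smul, ← add_smul]
  have hne := (hK.pos _ (hmaps t ht)).ne'
  convert zero_smul ℝ w using 2
  rw [real_inner_smul_right]
  field_simp
  ring

/-- Projective coordinates map geodesics to straight lines. -/
theorem IsKleinChart.mapsGeodesicsToLines {κ R : ℝ} {B : Set M}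
    {K : OpenPartialHomeomorph M (EuclideanSpace ℝ (Fin d))} (hK : IsKleinChart κ R B K) :
    MapsGeodesicsToLines B R K := by
  intro γ s hγ hB hne
  have hsrc : ∀ t ∈ s, γ t ∈ K.source := fun t ht => by rw [hK.source_eq]; exact hB ht
  have hball : ∀ t ∈ s, K (γ t) ∈ Metric.ball (0 : EuclideanSpace ℝ (Fin d)) R := fun t ht => by
    rw [← hK.target_eq]; exact K.map_source (hsrc t ht)
  have hc : ∀ t ∈ s, ContDiffAt ℝ ∞ (fun τ => K (γ τ)) t := fun t ht =>
    hγ.contDiffAt hK.mem_maximalAtlas ht (hsrc t ht)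
  obtain ⟨w, hw⟩ := deriv_eq_smul_of_klein (κ := κ) hγ.isOpen hγ.ordConnected hc
    (fun t ht => hK.pos _ (hball t ht)) fun t ht => by
      have h1 := hγ.geodesicEquation hK.mem_maximalAtlas ht (hsrc t ht)
      rw [GeodesicEquation, hK.christoffel (hball t ht)] at h1
      rw [eq_neg_of_add_eq_zero_left h1, neg_smul, neg_neg]
  have hcd : ∀ t ∈ s, HasDerivAt (fun τ => K (γ τ)) ((1 + κ * ‖K (γ t)‖ ^ 2) • w) t :=
    fun t ht => hw t ht ▸ ((hc t ht).differentiableAt (by simp)).hasDerivAt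
  obtain ⟨_, ⟨t₀, ht₀, rfl⟩, _, ⟨t₁, ht₁, rfl⟩, hne'⟩ := hne
  -- Zero direction would make `K ∘ γ`, and so `γ`, constant.
  have hw0 : w ≠ 0 := by
    rintro rfl
    obtain ⟨b, hb⟩ := hγ.isOpen.exists_is_const_of_deriv_eq_zero hγ.ordConnected.isPreconnected
      (fun t ht => (hcd t ht).differentiableAt.differentiableWithinAt)
      (fun t ht => by rw [(hcd t ht).deriv]; simp)
    exact hne' (K.injOn (hsrc t₀ ht₀) (hsrc t₁ ht₁) ((hb t₀ ht₀).trans (hb t₁ ht₁).symm))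
  obtain ⟨f, hf0, hfd, hf⟩ := eq_add_smul_of_deriv hγ.isOpen hγ.ordConnected hw0 hcd ht₀
  set a := K (γ t₀) with ha
  refine ⟨a, w, hw0, ⟨f, ?_, hf⟩, fun hmax => ?_⟩
  · refine strictMonoOn_of_deriv_pos hγ.ordConnected.convex
      (fun t ht => (hfd t ht).continuousAt.continuousWithinAt) fun t ht => ?_
    rw [hγ.isOpen.interior_eq] at ht
    rw [(hfd t ht).deriv]
    exact hK.pos _ (hball t ht)
  set ℓ : ℝ → EuclideanSpace ℝ (Fin d) := fun τ => a + τ • w with hℓ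
  have hℓc : ContDiff ℝ ∞ ℓ := contDiff_const.add (contDiff_id.smul contDiff_const)
  have hfJ : ∀ t ∈ s, f t ∈ ℓ ⁻¹' Metric.ball 0 R := fun t ht => by
    simp only [mem_preimage, hℓ]
    rw [← hf t ht]
    exact hball t ht
  have hJc : Convex ℝ (ℓ ⁻¹' Metric.ball 0 R) := by
    have : ℓ = AffineMap.lineMap a (a + w) := by
      ext1 τ
      simp [hℓ, AffineMap.lineMap_apply, add_comm]
    rw [this]
    exact (convex_ball _ _).affine_preimage _
  -- Here the whole chord through `a` is parametrized at the speed that the geodesic equation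
  -- prescribes, with the base point `a` reached at time `t₀`.
  obtain ⟨θ, F, s', hs'o, hs'c, hθm, hFm, hinv, hθ0, hFs, hθd, hFd⟩ :=
    exists_autonomous_solution (q := fun τ => 1 + κ * ‖ℓ τ‖ ^ 2)
      (contDiff_const.add (contDiff_const.mul (hℓc.norm_sq ℝ)))
      (Metric.isOpen_ball.preimage hℓc.continuous) hJc.ordConnected
      (fun τ hτ => hK.pos _ hτ) (hf0 ▸ hfJ t₀ ht₀) t₀
  -- `θ ∘ f` has derivative `1` and fixes `t₀`. So `γ` runs on the chord with the same time
  -- parameter and is a restriction of the chord geodesic.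
  have hθf : EqOn (fun t => θ (f t)) id s := by
    refine hγ.isOpen.eqOn_of_deriv_eq hγ.ordConnected.isPreconnected (fun t ht => ?_)
      differentiableOn_id (fun t ht => ?_) ht₀ (by simp [hf0, hθ0])
    · exact ((hθd _ (hfJ t ht)).comp t (hfd t ht)).differentiableAt.differentiableWithinAt
    · have h1 := ((hθd _ (hfJ t ht)).comp t (hfd t ht)).deriv
      refine h1.trans ?_
      rw [show ℓ (f t) = K (γ t) from (hf t ht).symm,
        inv_mul_cancel₀ (hK.pos _ (hball t ht)).ne']
      simp
  have hss : s ⊆ s' := fun t ht => by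
    have := hθm (hfJ t ht)
    rwa [show θ (f t) = t from hθf ht] at this
  have hFf : ∀ t ∈ s, F t = f t := fun t ht => by
    have := hinv.1 (hfJ t ht)
    rwa [show θ (f t) = t from hθf ht] at this
  have hgeo := hK.isGeodesicOn_chord (a := a) (w := w) hs'o hs'c hFs (fun t ht => hFm ht)
    (fun t ht => hFd t ht)
  -- The chord geodesic stays in `B` and extends `γ`, so maximality forces the two intervals to
  -- coincide.
  have hss' := hmax.2.2 _ s' hgeo (fun t ht => by
      rw [← hK.source_eq]
      exact K.map_target (by rw [hK.target_eq]; exact hFm ht)) hss fun t ht => by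
    simp only [hFf t ht, ← hf t ht]
    exact (K.left_inv (hsrc t ht)).symm
  ext y
  constructor
  · rintro ⟨_, ⟨t, ht, rfl⟩, rfl⟩
    exact ⟨⟨f t, hf t ht⟩, hball t ht⟩
  · rintro ⟨⟨τ, rfl⟩, hy⟩
    have hτ : θ τ ∈ s := hss' ▸ hθm hy
    refine ⟨_, ⟨θ τ, hτ, rfl⟩, ?_⟩
    rw [hf _ hτ, ← hFf _ hτ, hinv.1 hy]

end Lines

/-! ### The sphere and the hyperboloid, with `ε = 1` and `ε = -1` -/

section Models

variable {d : ℕ}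

/-- The point of `ℝᵈ⁺¹` with first coordinates `u` and last coordinate `z`. -/
def appendLast : EuclideanSpace ℝ (Fin d) × ℝ →L[ℝ] EuclideanSpace ℝ (Fin (d + 1)) :=
  LinearMap.toContinuousLinearMap
    { toFun := fun x => WithLp.toLp 2 (Fin.snoc (α := fun _ => ℝ) x.1 x.2)
      map_add' := fun x y => by
        ext i
        refine Fin.lastCases ?_ (fun j => ?_) i <;> simp
      map_smul' := fun c x => by
        ext i
        refine Fin.lastCases ?_ (fun j => ?_) i <;> simp }

@[simp] lemma appendLast_castSucc (u : EuclideanSpace ℝ (Fin d)) (z : ℝ) (i : Fin d) :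
    appendLast (u, z) i.castSucc = u i := by
  simp [appendLast]

@[simp] lemma appendLast_last (u : EuclideanSpace ℝ (Fin d)) (z : ℝ) :
    appendLast (u, z) (Fin.last d) = z := by
  simp [appendLast]

/-- The form `x_1 y_1 + ⋯ + x_d y_d + ε x_{d+1} y_{d+1}`. -/
def modelForm (ε : ℝ) (x y : EuclideanSpace ℝ (Fin (d + 1))) : ℝ :=
  ∑ i : Fin d, x i.castSucc * y i.castSucc + ε * (x (Fin.last d) * y (Fin.last d))

lemma inner_eq_modelForm (x y : EuclideanSpace ℝ (Fin (d + 1))) :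
    inner ℝ x y = modelForm 1 x y := by
  rw [PiLp.inner_apply, Fin.sum_univ_castSucc]
  simp [modelForm, mul_comm]

lemma lorentzForm_eq_modelForm (x y : EuclideanSpace ℝ (Fin (d + 1))) :
    lorentzForm x y = modelForm (-1) x y := by
  simp [lorentzForm, modelForm, sub_eq_add_neg]

lemma modelForm_appendLast (ε : ℝ) (u v : EuclideanSpace ℝ (Fin d)) (z z' : ℝ) :
    modelForm ε (appendLast (u, z)) (appendLast (v, z')) = inner ℝ u v + ε * (z * z') := by
  simp [modelForm, PiLp.inner_apply, mul_comm]

/-- The inverse of the gnomonic projection (`ε = 1`) or of the Beltrami–Klein map (`ε = -1`). -/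
def modelLift (ε : ℝ) (u : EuclideanSpace ℝ (Fin d)) : EuclideanSpace ℝ (Fin (d + 1)) :=
  appendLast ((√(1 + ε * ‖u‖ ^ 2))⁻¹ • u, -(ε * (√(1 + ε * ‖u‖ ^ 2))⁻¹))

/-- The gnomonic projection (`ε = 1`) or the Beltrami–Klein map (`ε = -1`). -/
def modelProj (ε : ℝ) (x : EuclideanSpace ℝ (Fin (d + 1))) : EuclideanSpace ℝ (Fin d) :=
  WithLp.toLp 2 fun i => -(ε * (x i.castSucc / x (Fin.last d)))

/-- The ball of the unit sphere (`ε = 1`) or hyperboloid (`ε = -1`) cut out by the hyperplane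
`x_{d+1} = -ε C`. -/
def modelBall (d : ℕ) (ε C : ℝ) : Set (EuclideanSpace ℝ (Fin (d + 1))) :=
  {x | modelForm ε x x = ε ∧ 0 < -(ε * x (Fin.last d)) ∧ x (Fin.last d) < -(ε * C)}

/-- The lift scales `(u, -ε)` onto the quadric by `(1 + ε|u|²)^(-1/2)`. Differentiating this factor
produces the second term of the Klein metric of curvature `ε`. -/
lemma modelForm_fderiv_modelLift {ε : ℝ} (hε : ε ^ 2 = 1) {u : EuclideanSpace ℝ (Fin d)}
    (hu : 0 < 1 + ε * ‖u‖ ^ 2) (v w : EuclideanSpace ℝ (Fin d)) :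
    ContDiffAt ℝ ∞ (modelLift ε) u ∧
      modelForm ε (fderiv ℝ (modelLift ε) u v) (fderiv ℝ (modelLift ε) u w) =
        kleinMetric ε u v w := by
  have hN : √(1 + ε * ‖u‖ ^ 2) ≠ 0 := (Real.sqrt_pos.2 hu).ne'
  have hc : ContDiffAt ℝ ∞ (fun u : EuclideanSpace ℝ (Fin d) => (√(1 + ε * ‖u‖ ^ 2))⁻¹) u :=
    ((contDiffAt_const.add (contDiffAt_const.mul (contDiffAt_id.norm_sq ℝ))).sqrt hu.ne').inv hN
  have hL : ContDiffAt ℝ ∞ (modelLift ε) u := appendLast.contDiff.contDiffAt.comp u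
    ((hc.smul contDiffAt_id).prodMk (contDiffAt_const.mul hc).neg)
  refine ⟨hL, ?_⟩
  have hd : ∀ v, fderiv ℝ (modelLift ε) u v = appendLast
      ((√(1 + ε * ‖u‖ ^ 2))⁻¹ • v - (ε * inner ℝ u v / √(1 + ε * ‖u‖ ^ 2) ^ 3) • u,
        -(ε * -(ε * inner ℝ u v / √(1 + ε * ‖u‖ ^ 2) ^ 3))) := by
    intro v
    have hl : HasDerivAt (fun s : ℝ => u + s • v) v 0 := by
      simpa using ((hasDerivAt_id (0 : ℝ)).smul_const v).const_add u
    have h0 : u + (0 : ℝ) • v = u := by simp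
    have hn : HasDerivAt (fun s : ℝ => (√(1 + ε * ‖u + s • v‖ ^ 2))⁻¹)
        (-(ε * inner ℝ u v / √(1 + ε * ‖u‖ ^ 2) ^ 3)) 0 := by
      have h1 := (((hl.norm_sq.const_mul ε).const_add 1).sqrt (by rw [h0]; exact hu.ne')).fun_inv
        (by rwa [h0])
      simp only [h0] at h1
      refine h1.congr_deriv ?_
      field_simp
    have h2 := appendLast.hasFDerivAt.comp_hasDerivAt (0 : ℝ)
      ((hn.fun_smul hl).prodMk (hn.const_mul ε).fun_neg)
    simp only [h0] at h2
    have h3 := HasFDerivAt.comp_hasDerivAt (l := modelLift ε) (0 : ℝ)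
      (h0.symm ▸ (hL.differentiableAt (by simp)).hasFDerivAt :
        HasFDerivAt (modelLift ε) (fderiv ℝ (modelLift ε) u) (u + (0 : ℝ) • v)) hl
    rw [h3.unique h2]
    congr 2
    rw [neg_smul, sub_eq_add_neg]
  have hsq : √(1 + ε * ‖u‖ ^ 2) ^ 2 = 1 + ε * ‖u‖ ^ 2 := Real.sq_sqrt hu.le
  have hnu : ε * ‖u‖ ^ 2 = √(1 + ε * ‖u‖ ^ 2) ^ 2 - 1 := by rw [hsq]; ring
  rw [hd, hd, modelForm_appendLast, kleinMetric]
  set N := √(1 + ε * ‖u‖ ^ 2)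
  rw [← hsq]
  simp only [inner_sub_left, inner_sub_right, real_inner_smul_left, real_inner_smul_right,
    real_inner_self_eq_norm_sq, real_inner_comm u v]
  field_simp
  linear_combination inner ℝ u v * inner ℝ u w * ε * (hnu + (ε ^ 2 + 1) * hε)

lemma modelProj_modelLift {ε : ℝ} (hε : ε ^ 2 = 1) {u : EuclideanSpace ℝ (Fin d)}
    (hu : 0 < 1 + ε * ‖u‖ ^ 2) : modelProj ε (modelLift ε u) = u := by
  have hN : √(1 + ε * ‖u‖ ^ 2) ≠ 0 := (Real.sqrt_pos.2 hu).ne'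
  have hε0 : ε ≠ 0 := by rintro rfl; norm_num at hε
  ext i
  simp only [modelProj, modelLift, appendLast_castSucc, appendLast_last, PiLp.smul_apply,
    smul_eq_mul]
  field_simp

/-- The equation of the quadric divided by the square of the last coordinate. -/
lemma norm_modelProj_sq {ε : ℝ} (hε : ε ^ 2 = 1) {x : EuclideanSpace ℝ (Fin (d + 1))}
    (hx : modelForm ε x x = ε) (hx0 : x (Fin.last d) ≠ 0) :
    1 + ε * ‖modelProj ε x‖ ^ 2 = (x (Fin.last d) ^ 2)⁻¹ := by
  have h1 : ‖modelProj ε x‖ ^ 2 = (∑ i : Fin d, x i.castSucc * x i.castSucc) / x (Fin.last d) ^ 2 := by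
    rw [EuclideanSpace.norm_sq_eq, Finset.sum_div]
    refine Finset.sum_congr rfl fun i _ => ?_
    simp only [modelProj, Real.norm_eq_abs, sq_abs]
    linear_combination (x i.castSucc / x (Fin.last d)) ^ 2 * hε
  have h2 : (∑ i : Fin d, x i.castSucc * x i.castSucc) = ε - ε * (x (Fin.last d)) ^ 2 := by
    rw [modelForm] at hx
    linear_combination hx
  rw [h1, h2]
  field_simp
  linear_combination (1 - x (Fin.last d) ^ 2) * hε

lemma modelLift_modelProj {ε : ℝ} (hε : ε ^ 2 = 1) {x : EuclideanSpace ℝ (Fin (d + 1))}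
    (hx : modelForm ε x x = ε) (hx0 : 0 < -(ε * x (Fin.last d))) :
    (√(1 + ε * ‖modelProj ε x‖ ^ 2))⁻¹ = -(ε * x (Fin.last d)) ∧
      modelLift ε (modelProj ε x) = x := by
  have hne : x (Fin.last d) ≠ 0 := by intro h; simp [h] at hx0
  have hN : (√(1 + ε * ‖modelProj ε x‖ ^ 2))⁻¹ = -(ε * x (Fin.last d)) := by
    rw [norm_modelProj_sq hε hx hne, Real.sqrt_inv, inv_inv]
    have : x (Fin.last d) ^ 2 = (-(ε * x (Fin.last d))) ^ 2 := by
      linear_combination -(x (Fin.last d)) ^ 2 * hε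
    rw [this, Real.sqrt_sq hx0.le]
  refine ⟨hN, ?_⟩
  rw [modelLift, hN]
  ext i
  refine Fin.lastCases ?_ (fun j => ?_) i
  · rw [appendLast_last]
    linear_combination x (Fin.last d) * hε
  · rw [appendLast_castSucc]
    simp only [modelProj, PiLp.smul_apply, smul_eq_mul]
    field_simp
    linear_combination x j.castSucc * hε

/-- `C` and `S` play the roles of `cos ρ, sin ρ` or `cosh ρ, sinh ρ`, and `(1 + ε n²)^(-1/2)` is the
cosine or hyperbolic cosine belonging to the tangent `n`. The factor `ε` appears because `cos`
decreases with the radius while `cosh` increases; squaring turns both sides into `n² C² < S²`. -/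
lemma norm_lt_iff_of_model {ε C S n : ℝ} (hε : ε = 1 ∨ ε = -1) (hC : 0 < C) (hS : 0 < S)
    (hn : 0 ≤ n) (hCS : C ^ 2 + ε * S ^ 2 = 1) (hD : 0 < 1 + ε * n ^ 2) :
    n < S / C ↔ ε * C < ε * (√(1 + ε * n ^ 2))⁻¹ := by
  have hN := Real.sqrt_pos.2 hD
  have hsq := Real.sq_sqrt hD.le
  set N := √(1 + ε * n ^ 2)
  have h1 : n < S / C ↔ n ^ 2 * C ^ 2 < S ^ 2 := by
    rw [lt_div_iff₀ hC, ← mul_pow, sq_lt_sq₀ (by positivity) hS.le]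
  rw [h1]
  rcases hε with rfl | rfl
  · rw [one_mul, one_mul, lt_inv_comm₀ hC hN, ← one_div, lt_div_iff₀ hC,
      ← sq_lt_sq₀ (by positivity) zero_le_one, mul_pow, hsq]
    constructor <;> intro h <;> linarith
  · rw [neg_one_mul, neg_one_mul, neg_lt_neg_iff, inv_lt_comm₀ hN hC, ← one_div, div_lt_iff₀ hC,
      ← sq_lt_sq₀ zero_le_one (by positivity), mul_pow, hsq]
    constructor <;> intro h <;> linarith

lemma bijOn_modelLift {ε C S : ℝ} (hε : ε = 1 ∨ ε = -1) (hC : 0 < C) (hS : 0 < S)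
    (hCS : C ^ 2 + ε * S ^ 2 = 1)
    (hD : ∀ u ∈ Metric.ball (0 : EuclideanSpace ℝ (Fin d)) (S / C), 0 < 1 + ε * ‖u‖ ^ 2) :
    BijOn (modelLift ε) (Metric.ball (0 : EuclideanSpace ℝ (Fin d)) (S / C)) (modelBall d ε C) := by
  have hε2 : ε ^ 2 = 1 := by rcases hε with rfl | rfl <;> norm_num
  refine InvOn.bijOn (f' := modelProj ε) ⟨fun u hu => modelProj_modelLift hε2 (hD u hu),
    fun x hx => (modelLift_modelProj hε2 hx.1 hx.2.1).2⟩ (fun u hu => ?_) fun x hx => ?_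
  · have h1 := (norm_lt_iff_of_model hε hC hS (norm_nonneg u) hCS (hD u hu)).1
      (mem_ball_zero_iff.1 hu)
    have hN := Real.sqrt_pos.2 (hD u hu)
    have hsq := Real.sq_sqrt (hD u hu).le
    refine ⟨?_, ?_, ?_⟩
    · rw [modelLift, modelForm_appendLast, real_inner_smul_left, real_inner_smul_right,
        real_inner_self_eq_norm_sq]
      field_simp
      rw [hsq]
      linear_combination (ε - ‖u‖ ^ 2) * hε2
    · rw [modelLift, appendLast_last]
      have : -(ε * -(ε * (√(1 + ε * ‖u‖ ^ 2))⁻¹)) = (√(1 + ε * ‖u‖ ^ 2))⁻¹ := by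
        linear_combination (√(1 + ε * ‖u‖ ^ 2))⁻¹ * hε2
      rw [this]
      exact inv_pos.2 hN
    · rw [modelLift, appendLast_last]
      exact neg_lt_neg h1
  · obtain ⟨h1, h2, h3⟩ := hx
    have hne : x (Fin.last d) ≠ 0 := by intro h; simp [h] at h2
    refine mem_ball_zero_iff.2 ((norm_lt_iff_of_model hε hC hS (norm_nonneg _) hCS ?_).2 ?_)
    · rw [norm_modelProj_sq hε2 h1 hne]
      positivity
    · rw [(modelLift_modelProj hε2 h1 h2).1]
      linear_combination h3 + x (Fin.last d) * hε2

/-- Positivity of `cos ρ` makes the lower-hemisphere condition in `modelBall` redundant. -/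
lemma modelBall_one {ρ : ℝ} (hρ : 0 < Real.cos ρ) : modelBall d 1 (Real.cos ρ) = sphereBall d ρ := by
  ext x
  have h : ‖x‖ = 1 ↔ modelForm 1 x x = 1 := by
    rw [← inner_eq_modelForm, real_inner_self_eq_norm_sq, pow_eq_one_iff_of_nonneg (norm_nonneg x) two_ne_zero]
  simp only [modelBall, sphereBall, mem_ofPred_eq, h, one_mul]
  constructor
  · rintro ⟨h1, -, h3⟩
    exact ⟨h1, h3⟩
  · rintro ⟨h1, h3⟩
    exact ⟨h1, by linarith, h3⟩

lemma modelBall_neg_one (ρ : ℝ) : modelBall d (-1) (Real.cosh ρ) = hyperbolicBall d ρ := by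
  ext x
  simp [modelBall, hyperbolicBall, hyperboloid, lorentzForm_eq_modelForm, and_assoc]

lemma gnomonic_eq_modelProj (x : EuclideanSpace ℝ (Fin (d + 1))) :
    gnomonic x = modelProj 1 x := by
  simp [gnomonic, modelProj]

lemma beltramiKlein_eq_modelProj (x : EuclideanSpace ℝ (Fin (d + 1))) :
    beltramiKlein x = modelProj (-1) x := by
  simp [beltramiKlein, modelProj]

end Models

/-! ### From projective coordinates to the models -/

section Isometry

variable {d : ℕ} {M : Type*} [TopologicalSpace M] [ChartedSpace (EuclideanSpace ℝ (Fin d)) M]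
  [RiemannianBundle (fun x : M => TangentSpace (𝓡 d) x)]

/-- Counterpart of `chartMetric_eq_innerAt`, through the chain rule for `e.symm ∘ e = id`. -/
lemma inner_eq_chartMetric {e : OpenPartialHomeomorph M (EuclideanSpace ℝ (Fin d))}
    (he : e ∈ IsManifold.maximalAtlas (𝓡 d) ∞ M) {x : M} (hx : x ∈ e.source)
    (u v : EuclideanSpace ℝ (Fin d)) :
    innerAt x u v = chartMetric e (e x) (mfderiv (𝓡 d) (𝓡 d) e x u) (mfderiv (𝓡 d) (𝓡 d) e x v) := by
  have h1 : MDifferentiableAt (𝓡 d) (𝓡 d) e x :=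
    (contMDiffAt_of_mem_maximalAtlas he hx).mdifferentiableAt (by simp)
  have h2 : MDifferentiableAt (𝓡 d) (𝓡 d) e.symm (e x) :=
    (contMDiffAt_symm_of_mem_maximalAtlas he (e.map_source hx)).mdifferentiableAt (by simp)
  have h3 : mfderiv (𝓡 d) (𝓡 d) (e.symm ∘ e) x = mfderiv (𝓡 d) (𝓡 d) (id : M → M) x := by
    refine Filter.EventuallyEq.mfderiv_eq ?_
    filter_upwards [e.open_source.mem_nhds hx] with z hz using e.left_inv hz
  rw [mfderiv_comp x h2 h1, mfderiv_id] at h3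
  have h4 : ∀ u : EuclideanSpace ℝ (Fin d), (mfderiv (𝓡 d) (𝓡 d) e.symm (e x)
      (mfderiv (𝓡 d) (𝓡 d) e x u) : EuclideanSpace ℝ (Fin d)) = u := fun u => DFunLike.congr_fun h3 u
  refine Eq.trans ?_ (chartMetric_eq_innerAt e (e x) _ _).symm
  rw [e.left_inv hx]
  exact (congrArg₂ (innerAt x) (h4 u) (h4 v)).symm

variable {κ R : ℝ} {B : Set M} {K : OpenPartialHomeomorph M (EuclideanSpace ℝ (Fin d))}

lemma IsKleinChart.bijOn (hK : IsKleinChart κ R B K) :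
    BijOn K B (Metric.ball (0 : EuclideanSpace ℝ (Fin d)) R) := by
  rw [← hK.source_eq, ← hK.target_eq]
  exact K.bijOn

lemma bijOn_smul_ball {E : Type*} [NormedAddCommGroup E] [NormedSpace ℝ E] {σ : ℝ} (hσ : 0 < σ)
    (R : ℝ) : BijOn (fun y : E => σ • y) (Metric.ball 0 R) (Metric.ball 0 (σ * R)) := by
  refine InvOn.bijOn (f' := fun y : E => σ⁻¹ • y)
    ⟨fun y _ => inv_smul_smul₀ hσ.ne' y, fun y _ => smul_inv_smul₀ hσ.ne' y⟩
    (fun y hy => ?_) fun y hy => ?_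
  · rw [mem_ball_zero_iff] at hy ⊢
    rw [norm_smul, Real.norm_of_nonneg hσ.le]
    exact mul_lt_mul_of_pos_left hy hσ
  · rw [mem_ball_zero_iff] at hy ⊢
    rwa [norm_smul, Real.norm_of_nonneg (inv_nonneg.2 hσ.le), inv_mul_lt_iff₀ hσ]

lemma IsKleinChart.isDiffeoOn (hK : IsKleinChart κ R B K) {σ : ℝ} (hσ : 0 < σ) :
    IsDiffeoOn (EuclideanSpace ℝ (Fin d)) (EuclideanSpace ℝ (Fin d)) (fun x => σ • K x) B
      (Metric.ball 0 (σ * R)) := by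
  have hm : MapsTo (fun y : EuclideanSpace ℝ (Fin d) => σ⁻¹ • y) (Metric.ball 0 (σ * R))
      K.target := fun y hy => by
    rw [hK.target_eq]
    rw [mem_ball_zero_iff] at hy ⊢
    rwa [norm_smul, Real.norm_of_nonneg (inv_nonneg.2 hσ.le), inv_mul_lt_iff₀ hσ]
  have hKs : ContMDiffOn (𝓡 d) (𝓡 d) ∞ K B :=
    hK.source_eq ▸ contMDiffOn_of_mem_maximalAtlas hK.mem_maximalAtlas
  refine ⟨hK.source_eq ▸ K.open_source, Metric.isOpen_ball,
    (bijOn_smul_ball hσ R).mapsTo.comp hK.bijOn.mapsTo, ?_,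
    fun y => K.symm (σ⁻¹ • y), fun y hy => hK.source_eq ▸ K.map_target (hm hy),
    ⟨fun x hx => ?_, fun y hy => ?_⟩, ?_⟩
  · exact (contDiff_const_smul (n := ∞) σ).contMDiff.comp_contMDiffOn hKs
  · simp only [inv_smul_smul₀ hσ.ne']
    exact K.left_inv (hK.source_eq.symm ▸ hx)
  · simp only [K.right_inv (hm hy), smul_inv_smul₀ hσ.ne']
  · exact (contMDiffOn_symm_of_mem_maximalAtlas hK.mem_maximalAtlas).comp
      (contDiff_const_smul (n := ∞) σ⁻¹).contMDiff.contMDiffOn hm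

/-- Since `K` carries the Riemannian metric to the Klein metric, only a pullback under the map `L`
of vector spaces remains to be checked. -/
lemma IsKleinChart.isHomotheticOn_comp (hK : IsKleinChart κ R B K) {V : Type*}
    [NormedAddCommGroup V] [NormedSpace ℝ V] {b : V → V → ℝ} {c : ℝ}
    {L : EuclideanSpace ℝ (Fin d) → V}
    (hL : ∀ y ∈ Metric.ball (0 : EuclideanSpace ℝ (Fin d)) R, ContDiffAt ℝ ∞ L y)
    (hb : ∀ y ∈ Metric.ball (0 : EuclideanSpace ℝ (Fin d)) R, ∀ u v,
      b (fderiv ℝ L y u) (fderiv ℝ L y v) = c * kleinMetric κ y u v) :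
    IsHomotheticOn d b c B (fun x => L (K x)) := by
  have hKs : ContMDiffOn (𝓡 d) (𝓡 d) ∞ K B :=
    hK.source_eq ▸ contMDiffOn_of_mem_maximalAtlas hK.mem_maximalAtlas
  refine ⟨ContMDiffOn.comp (g := L) (t := Metric.ball 0 R)
    (ContDiffOn.contMDiffOn fun y hy => (hL y hy).contDiffWithinAt) hKs hK.bijOn.mapsTo,
    fun x hx u v => ?_⟩
  have hxs : x ∈ K.source := hK.source_eq.symm ▸ hx
  have hy := hK.bijOn.mapsTo hx
  have h1 : MDifferentiableAt (𝓡 d) 𝓘(ℝ, V) L (K x) :=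
    ((hL _ hy).differentiableAt (by simp)).mdifferentiableAt
  have h2 : MDifferentiableAt (𝓡 d) (𝓡 d) K x :=
    (contMDiffAt_of_mem_maximalAtlas hK.mem_maximalAtlas hxs).mdifferentiableAt (by simp)
  have h3 : ∀ u : EuclideanSpace ℝ (Fin d),
      (mfderiv (𝓡 d) 𝓘(ℝ, V) (fun x => L (K x)) x u : V) =
        fderiv ℝ L (K x) (mfderiv (𝓡 d) (𝓡 d) K x u) := fun u => by
    refine (DFunLike.congr_fun (mfderiv_comp x h1 h2) u).trans ?_
    rw [mfderiv_eq_fderiv]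
    rfl
  refine (congrArg₂ b (h3 u) (h3 v)).trans ?_
  refine (hb _ hy _ _).trans ?_
  refine (congrArg (c * ·) (hK.metric _ hy _ _).symm).trans ?_
  exact congrArg (c * ·) (inner_eq_chartMetric hK.mem_maximalAtlas hxs u v).symm

/-- The dilation `y ↦ σ y` pulls the Klein metric of curvature `ε` back to `σ²` times that of
curvature `ε σ²`. -/
lemma IsKleinChart.isHomotheticOn_modelLift {ε σ : ℝ} (hε : ε ^ 2 = 1)
    (hK : IsKleinChart (ε * σ ^ 2) R B K) :
    IsHomotheticOn d (modelForm ε) (σ ^ 2) B (fun x => modelLift ε (σ • K x)) := by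
  have hpos : ∀ y ∈ Metric.ball (0 : EuclideanSpace ℝ (Fin d)) R, 0 < 1 + ε * ‖σ • y‖ ^ 2 :=
    fun y hy => by
      have := hK.pos y hy
      rwa [norm_smul, mul_pow, Real.norm_eq_abs, sq_abs, ← mul_assoc]
  refine hK.isHomotheticOn_comp (L := fun y => modelLift ε (σ • y)) (fun y hy => ?_)
    fun y hy u v => ?_
  · exact ContDiffAt.comp (g := modelLift ε) y
      (modelForm_fderiv_modelLift hε (hpos y hy) 0 0).1 (contDiff_const_smul σ).contDiffAt
  · have h1 : HasFDerivAt (fun y : EuclideanSpace ℝ (Fin d) => σ • y)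
        (σ • ContinuousLinearMap.id ℝ (EuclideanSpace ℝ (Fin d))) y :=
      (hasFDerivAt_id y).const_smul σ
    have h2 : fderiv ℝ (fun y => modelLift ε (σ • y)) y = _ :=
      (((modelForm_fderiv_modelLift hε (hpos y hy) 0 0).1.differentiableAt
        (by simp)).hasFDerivAt.comp y h1).fderiv
    rw [h2]
    refine (modelForm_fderiv_modelLift hε (hpos y hy) (σ • u) (σ • v)).2.trans ?_
    have := (hpos y hy).ne'
    rw [norm_smul, mul_pow, Real.norm_eq_abs, sq_abs] at this
    simp only [kleinMetric, norm_smul, mul_pow, Real.norm_eq_abs, sq_abs, real_inner_smul_left,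
      real_inner_smul_right, ← mul_assoc]
    ring

/-- The witness is the model lift of `σ K`. Its domain has radius `S / C` with `S = σ genSin` and `C
= genCos` at time `1`, and these satisfy `C² + ε S² = 1`. -/
lemma IsKleinChart.exists_model {ε σ : ℝ} (hε : ε = 1 ∨ ε = -1) (hσ : 0 < σ)
    (hcos : ∀ t ∈ Icc (0 : ℝ) 1, 0 < genCos (ε * σ ^ 2) t)
    (hK : IsKleinChart (ε * σ ^ 2) (kleinRadius (ε * σ ^ 2)) B K) :
    ∃ ι : M → EuclideanSpace ℝ (Fin (d + 1)), IsHomotheticOn d (modelForm ε) (σ ^ 2) B ι ∧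
      BijOn ι B (modelBall d ε (genCos (ε * σ ^ 2) 1)) ∧
      ∀ x ∈ B, σ • K x = modelProj ε (ι x) := by
  have hε2 : ε ^ 2 = 1 := by rcases hε with rfl | rfl <;> norm_num
  have hC := hcos 1 (by simp)
  have hS : 0 < genSin (ε * σ ^ 2) 1 := by
    have := mul_pos (kleinRadius_pos hcos) hC
    rwa [kleinRadius, div_mul_cancel₀ _ hC.ne'] at this
  have hbij := (bijOn_smul_ball hσ _).comp hK.bijOn
  have hR : σ * kleinRadius (ε * σ ^ 2) = σ * genSin (ε * σ ^ 2) 1 / genCos (ε * σ ^ 2) 1 := by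
    rw [kleinRadius, mul_div_assoc]
  have hpos : ∀ y ∈ Metric.ball (0 : EuclideanSpace ℝ (Fin d)) (σ * kleinRadius (ε * σ ^ 2)),
      0 < 1 + ε * ‖y‖ ^ 2 := fun y hy => by
    obtain ⟨z, hz, rfl⟩ := (bijOn_smul_ball hσ _).surjOn hy
    have := hK.pos z hz
    simpa only [norm_smul, mul_pow, Real.norm_eq_abs, sq_abs, ← mul_assoc] using this
  refine ⟨fun x => modelLift ε (σ • K x), hK.isHomotheticOn_modelLift hε2, ?_, fun x hx => ?_⟩
  · refine BijOn.comp (g := modelLift ε) (f := fun x => σ • K x) ?_ hbij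
    rw [hR] at hpos ⊢
    refine bijOn_modelLift hε hC (mul_pos hσ hS) ?_ hpos
    have := genCos_sq_add (ε * σ ^ 2) 1
    linear_combination this
  · exact (modelProj_modelLift hε2 (hpos _ (hbij.mapsTo hx))).symm

end Isometry

end SpaceForm

end

/-! ### The three signs of the curvature -/

theorem mainTheorem4 {d : ℕ} (hd : 2 ≤ d) {M : Type*} [TopologicalSpace M] [T2Space M]
    [ChartedSpace (EuclideanSpace ℝ (Fin d)) M] [IsManifold (𝓡 d) ∞ M]
    [RiemannianBundle (fun x : M => TangentSpace (𝓡 d) x)]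
    [IsContMDiffRiemannianBundle (𝓡 d) ∞ (EuclideanSpace ℝ (Fin d))
      (fun x : M => TangentSpace (𝓡 d) x)]
    (κ : ℝ) (hκ : SpaceForm.HasConstantSectionalCurvature d M κ)
    (hinj : 10 ≤ SpaceForm.injectivityRadius d M) (p : M) :
    ∃ (R : ℝ) (Φ : M → EuclideanSpace ℝ (Fin d)), 0 < R ∧
      SpaceForm.IsDiffeoOn (EuclideanSpace ℝ (Fin d)) (EuclideanSpace ℝ (Fin d)) Φ
        (SpaceForm.geodesicBall d p 1) (Metric.ball 0 R) ∧
      SpaceForm.MapsGeodesicsToLines (SpaceForm.geodesicBall d p 1) R Φ ∧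
      (0 < κ → ∃ ι : M → EuclideanSpace ℝ (Fin (d + 1)),
        SpaceForm.IsHomotheticOn d (fun x y => inner ℝ x y) κ (SpaceForm.geodesicBall d p 1) ι ∧
        BijOn ι (SpaceForm.geodesicBall d p 1) (SpaceForm.sphereBall d √κ) ∧
        (∀ x ∈ SpaceForm.geodesicBall d p 1, ι x (Fin.last d) < 0) ∧
        ∀ x ∈ SpaceForm.geodesicBall d p 1, Φ x = SpaceForm.gnomonic (ι x)) ∧
      (κ = 0 → SpaceForm.IsHomotheticOn d (fun x y => inner ℝ x y) 1
        (SpaceForm.geodesicBall d p 1) Φ) ∧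
      (κ < 0 → ∃ ι : M → EuclideanSpace ℝ (Fin (d + 1)),
        SpaceForm.IsHomotheticOn d SpaceForm.lorentzForm (-κ) (SpaceForm.geodesicBall d p 1) ι ∧
        BijOn ι (SpaceForm.geodesicBall d p 1) (SpaceForm.hyperbolicBall d √(-κ)) ∧
        ∀ x ∈ SpaceForm.geodesicBall d p 1, Φ x = SpaceForm.beltramiKlein (ι x)) := by
  obtain ⟨hcos, K, hK⟩ := SpaceForm.exists_kleinChart hd hκ hinj p
  have hR := SpaceForm.kleinRadius_pos hcos
  rcases SpaceForm.curvature_cases κ with ⟨σ, hσ, rfl⟩ | rfl | ⟨σ, hσ, rfl⟩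
  · have hκ0 : 0 < σ ^ 2 := by positivity
    -- Scaling by `σ = √κ` passes to the Klein ball of curvature `1`, where the gnomonic projection
    -- takes its values.
    refine ⟨σ * SpaceForm.kleinRadius (σ ^ 2), fun x => σ • K x, mul_pos hσ hR,
      hK.isDiffeoOn hσ, hK.mapsGeodesicsToLines.smul hσ, fun _ => ?_, fun h => absurd h hκ0.ne',
      fun h => absurd h hκ0.not_gt⟩
    obtain ⟨ι, h1, h2, h3⟩ := SpaceForm.IsKleinChart.exists_model (ε := 1) (Or.inl rfl) hσ
      (by rwa [one_mul]) (by rwa [one_mul])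
    have hc := hcos 1 (by simp)
    rw [SpaceForm.genCos_sq, mul_one] at hc
    rw [one_mul, SpaceForm.genCos_sq, mul_one, SpaceForm.modelBall_one hc] at h2
    rw [Real.sqrt_sq hσ.le]
    refine ⟨ι, ?_, h2, fun x hx => ?_, fun x hx => ?_⟩
    · simp only [SpaceForm.inner_eq_modelForm]
      exact h1
    · linarith [(h2.mapsTo hx).2]
    · rw [SpaceForm.gnomonic_eq_modelProj]
      exact h3 x hx
  · refine ⟨SpaceForm.kleinRadius 0, K, hR, ?_, hK.mapsGeodesicsToLines,
      fun h => absurd h (lt_irrefl _), fun _ => ?_, fun h => absurd h (lt_irrefl _)⟩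
    · simpa using hK.isDiffeoOn one_pos
    -- For `κ = 0` the Klein metric is the Euclidean inner product, so `K` is already an isometry.
    · refine hK.isHomotheticOn_comp (L := id) (fun y _ => contDiffAt_id) fun y _ u v => ?_
      simp [SpaceForm.kleinMetric]
  · have hκ0 : -σ ^ 2 < 0 := by simp only [neg_lt_zero]; positivity
    refine ⟨σ * SpaceForm.kleinRadius (-σ ^ 2), fun x => σ • K x, mul_pos hσ hR,
      hK.isDiffeoOn hσ, hK.mapsGeodesicsToLines.smul hσ, fun h => absurd h hκ0.not_gt, fun h => absurd h hκ0.ne,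
      fun _ => ?_⟩
    obtain ⟨ι, h1, h2, h3⟩ := SpaceForm.IsKleinChart.exists_model (ε := -1) (Or.inr rfl) hσ
      (by rwa [neg_one_mul]) (by rwa [neg_one_mul])
    rw [neg_one_mul, SpaceForm.genCos_neg_sq, mul_one, SpaceForm.modelBall_neg_one] at h2
    rw [neg_neg, Real.sqrt_sq hσ.le]
    refine ⟨ι, ?_, h2, fun x hx => ?_⟩
    · rw [show (SpaceForm.lorentzForm : EuclideanSpace ℝ (Fin (d + 1)) → _) =
        SpaceForm.modelForm (-1) from funext fun x => funext fun y =>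
          SpaceForm.lorentzForm_eq_modelForm x y]
      exact h1
    · rw [SpaceForm.beltramiKlein_eq_modelProj]
      exact h3 x hx
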